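/- Let $C$ be a real random variable and $T=(T_1,T_2,\dots)$ a sequence of real random variables, defined on the same probability space, such that a.s. the number $N=\#\{k: T_k\neq 0\}$ is finite, $T_1\ge T_2\ge\dots\ge T_N$ and $T_k=0$ for $k>N$ (with $T_N:=0$ if $N=0$). Put $\Sigma_\alpha=\sum_{k=1}^N|T_k|^\alpha$ and $\beta=\operatorname{ess\,sup}T_N^-$. Let $(C(v),T_1(v),T_2(v),\dots)$, $v\in\bigcup_{n\ge0}\mathbb N^n$, be i.i.d. copies of $(C,T_1,T_2,\dots)$. Put $L(\emptyset)=1$, $L(vk)=L(v)T_k(v)$ and $W_n=\sum_{k=0}^{n}\sum_{|v|=k}L(v)C(v)$, and let $W=\lim_{n\to\infty}W_n$ (the canonical solution of $X\overset{d}{=}\sum_{k=1}^NT_kX_k+C$). Write $$\mathbb D_\Psi=\{\theta\in\mathbb R:\mathbb E e^{\theta W}<\infty\},\qquad \mathbb D_\varphi=\{\theta\in\mathbb R:\mathbb E e^{\theta C}<\infty\},$$ $$a(\theta)=\mathbb E\big[e^{\theta C}\mathbf 1_{\{T_1=1\}}\big],\qquad b(\theta)=\mathbb E\big[e^{\theta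 C}\mathbf 1_{\{T_N=-\beta\}}\big].$$ **Theorem.** Suppose that for some $p\in[1,2]$ $$\mathbb E C=0,\qquad \mathbb E|C|^p<\infty,\qquad \mathbb E\,\Sigma_p<1,$$ that $|T_k|\le1$ a.s. for all $k$, that $\beta>0$, that $\Sigma_2$ is essentially bounded, and that for some $\delta\in(0,1)$ 1. a.s. $T_k\le 1-\delta$ for $2\le k\le N$ and $T_k\ge-\beta(1-\delta)$ for $1\le k\le N-1$; 2. $\mathbb P[T_1>1-\delta,\ T_N<-\beta(1-\delta)]=0$; 3. $\mathbb P[T_1=1,\ N\ge2]=\mathbb P[T_N=-\beta,\ N\ge2]=0$. Then $W_n$ converges a.s., so that $W$ is well defined, and the following hold. (a) If $\mathbb P[T_N=-\beta]>0$ and $\beta<1$, then $$\mathbb D_\Psi=\{\theta: a(-\beta\theta)\vee a(\theta)<1\text{ and }-\beta\theta,\theta\in\mathbb D_\varphi\}.$$ (b) If $\mathbb P[T_N=-1]>0$, then $$\mathbb D_\Psi=\{\theta: a(-\theta)\vee a(\theta)<1,\ (1-a(-\theta))(1-a(\theta))>b(\theta)b(-\theta)\text{ and }-\theta,\theta\in\mathbb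 D_\varphi\}.$$ (c) If $\mathbb P[T_N=-\beta]=0$, then $$\operatorname{int}(\mathbb D_\Psi)\subset\{\theta: a(-\beta\theta)\vee a(\theta)<1\text{ and }-\beta\theta,\theta\in\mathbb D_\varphi\}\subset\mathbb D_\Psi.$$ -/

import Mathlib

open MeasureTheory ProbabilityTheory Filter Topology
open scoped ENNReal

namespace SmoothingTransform

noncomputable section

/-- The number `N` of nonzero entries of a weight sequence `t`.
Sequences are indexed from `0`: the entry `t k` is the weight usually written with index `k + 1`. -/
def numWeights (t : ℕ → ℝ) : ℕ := {k | t k ≠ 0}.ncard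

/-- The nonzero entries of `t` are finite in number, they are listed first, and in
decreasing order. -/
def IsOrdered (t : ℕ → ℝ) : Prop :=
  {k | t k ≠ 0}.Finite ∧ (∀ k, numWeights t ≤ k → t k = 0) ∧
    ∀ i j, i ≤ j → j < numWeights t → t j ≤ t i

/-- The first (largest) weight; it is `0` if an ordered sequence has no nonzero weight. -/
def firstWeight (t : ℕ → ℝ) : ℝ := t 0

/-- The last (smallest) nonzero weight; it is `0` by convention if there is no nonzero weight. -/
def lastWeight (t : ℕ → ℝ) : ℝ := if numWeights t = 0 then 0 else t (numWeights t - 1)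

/-- The power sum of order `α` of the absolute values of the nonzero weights of an ordered
sequence. -/
def powerSum (α : ℝ) (t : ℕ → ℝ) : ℝ := ∑ k ∈ Finset.range (numWeights t), |t k| ^ α

/-- `L(v)`, the product of the edge weights along the path from the root to `v`.
A vertex of the Ulam-Harris tree is a finite word over `ℕ`, with the letter added last at the
head: the root is `[]`, the children of `v` are `k :: v`, and `y v = (C(v), T(v))`. -/
def branchWeight (y : List ℕ → ℝ × (ℕ → ℝ)) : List ℕ → ℝ
  | [] => 1
  | k :: v => branchWeight y v * (y v).2 k

/-- The sum of `L(v) C(v)` over the vertices `v` of generation `n`. -/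
def generationSum (y : List ℕ → ℝ × (ℕ → ℝ)) (n : ℕ) : ℝ :=
  ∑' v : {v : List ℕ // v.length = n}, branchWeight y v.1 * (y v.1).1

/-- `W_n`, the sum of `L(v) C(v)` over the vertices `v` of generation at most `n`. -/
def partialSolution (y : List ℕ → ℝ × (ℕ → ℝ)) (n : ℕ) : ℝ :=
  ∑ k ∈ Finset.range (n + 1), generationSum y k

/-- The canonical solution `W`, the limit of `W_n`. -/
def canonicalSolution (y : List ℕ → ℝ × (ℕ → ℝ)) : ℝ :=
  limUnder atTop (partialSolution y)

variable {Ω : Type*} [MeasurableSpace Ω]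

/-- The essential supremum of the negative part of the last weight. -/
def beta (P : Measure Ω) (T : Ω → ℕ → ℝ) : ℝ :=
  essSup (fun ω => max (-lastWeight (T ω)) 0) P

/-- `a(θ)`, the expectation of `exp (θ C)` on the event that the first weight is `1`
(it is finite for all `θ` with `exp (θ C)` integrable, and is used only for these). -/
def aFun (P : Measure Ω) (C : Ω → ℝ) (T : Ω → ℕ → ℝ) (θ : ℝ) : ℝ :=
  ∫ ω in {ω | firstWeight (T ω) = 1}, Real.exp (θ * C ω) ∂P

/-- `b(θ)`, the expectation of `exp (θ C)` on the event that the last weight is `-β`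
(it is finite for all `θ` with `exp (θ C)` integrable, and is used only for these). -/
def bFun (P : Measure Ω) (C : Ω → ℝ) (T : Ω → ℕ → ℝ) (θ : ℝ) : ℝ :=
  ∫ ω in {ω | lastWeight (T ω) = -beta P T}, Real.exp (θ * C ω) ∂P

/-- The set of `θ` with `max (a(θ)) (a(-βθ)) < 1` and both `θ` and `-βθ` in the domain of the
moment generating function of `C`. -/
def domainA (P : Measure Ω) (C : Ω → ℝ) (T : Ω → ℕ → ℝ) : Set ℝ :=
  {θ | max (aFun P C T (-beta P T * θ)) (aFun P C T θ) < 1 ∧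
    -beta P T * θ ∈ integrableExpSet C P ∧ θ ∈ integrableExpSet C P}

/-- The set of `θ` with `max (a(θ)) (a(-θ)) < 1`, `(1 - a(-θ)) (1 - a(θ)) > b(θ) b(-θ)` and both
`θ` and `-θ` in the domain of the moment generating function of `C`. -/
def domainB (P : Measure Ω) (C : Ω → ℝ) (T : Ω → ℕ → ℝ) : Set ℝ :=
  {θ | max (aFun P C T (-θ)) (aFun P C T θ) < 1 ∧
    (1 - aFun P C T (-θ)) * (1 - aFun P C T θ) > bFun P C T θ * bFun P C T (-θ) ∧
    -θ ∈ integrableExpSet C P ∧ θ ∈ integrableExpSet C P}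

end

end SmoothingTransform

namespace SmoothingTransform

noncomputable section

/-! The object of study is `Ψ(s) = E exp(s W)` with values in `[0, ∞]`. Splitting the tree at its
root shows that the law of `W` is a fixed point of `smoothingStep`, hence `Ψ(s) = E[exp(s C) ∏ Ψ(s
T_k)]` (`expMoment_smoothingStep_map`). Convergence of `W_n` (`canonicalSolution_spec`) rests on a
p-th moment estimate: the centred cost is dominated in convex order by a symmetric law, for which
each generation contracts the moment bound by exactly `E Σ_p < 1`. The generation sums are then
summable in `L¹`.

Necessity. Jensen gives `Ψ ≥ 1`. A weight equal to `1` or `-β` is the only nonzero one, so `Ψ(s) ≥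
a(s) Ψ(s) + b(s) Ψ(-β s) + E[exp(s C); rest]` (`lintegral_add_le_of_functional_eq`). If `Ψ(s)` is
finite, then `exp(s C)` is integrable and `a(s) < 1`. For `β = 1` the rest is strictly positive;
multiplying the inequalities at `θ` and `-θ` and cancelling `Ψ(θ) Ψ(-θ)` yields the determinant
condition. If `-β` is not attained, finiteness at `-β θ` is obtained only for interior `θ`, by using
a point slightly beyond `θ` and last weights close to `-β` (`lt_top_neg_of_mem_interior`).

Sufficiency. The transforms of the `W_n` are iterates of the functional equation started at `1`. It
suffices to bound them uniformly at `θ`, since Fatou's lemma passes the bound to `W`. Near the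
origin a bound `exp(K s²)` reproduces itself because `E Σ_2 < 1` (`exists_gaussian_bound_iterates`).
It is then pushed outwards along the rays through `θ` and `-β θ`, enlarging the range by the factor
`1 / (1 - δ)` finitely often (`exists_bound_iterates`). In one such step at most one child leaves
the range already controlled. The trial bounds `D + B x^m w_i(x)` reproduce themselves: for large
`m` the power suppresses extreme weights not equal to `1` or `-β`, while the exact values `1` and
`-β` leave a two-dimensional linear inequality with coefficients `a` and `b`. Positive weights `w_1,
w_2` solving it are `BalancedWeights`. For `β < 1` one of the two couplings carries `β^(2m)`, so `a
< 1` on both sides is enough; for `β = 1` the determinant condition gives a positive vector `(A₁,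
A₂)`, and `w_i(x) = A_i^x`. -/

/-! ### The Ulam-Harris tree -/

/-- The subtree of marks above the child `k` of the root. -/
def subtree (k : ℕ) (y : List ℕ → ℝ × (ℕ → ℝ)) : List ℕ → ℝ × (ℕ → ℝ) := fun v => y (v ++ [k])

/-- The sum of `t k * x k` over the nonzero weights `t k`. -/
def weightedSum (t x : ℕ → ℝ) : ℝ := ∑ k ∈ Finset.range (numWeights t), t k * x k

lemma branchWeight_append (y : List ℕ → ℝ × (ℕ → ℝ)) (k : ℕ) (v : List ℕ) :
    branchWeight y (v ++ [k]) = (y []).2 k * branchWeight (subtree k y) v := by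
  induction v with
  | nil => simp [branchWeight]
  | cons j v ih =>
    simp only [List.cons_append, branchWeight, ih, subtree]
    ring

/-- Only finitely many vertices of a generation are alive, so the `tsum` in `generationSum` is a
genuine finite sum and may be rearranged. -/
lemma finite_setOf_branchWeight_ne_zero {y : List ℕ → ℝ × (ℕ → ℝ)}
    (hy : ∀ v, IsOrdered (y v).2) (n : ℕ) :
    {v : List ℕ | v.length = n ∧ branchWeight y v ≠ 0}.Finite := by
  induction n with
  | zero =>
    refine (Set.finite_singleton ([] : List ℕ)).subset ?_
    rintro v ⟨hv, -⟩
    simpa using hv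
  | succ n ih =>
    refine (ih.biUnion fun v _ => (hy v).1.image fun k => k :: v).subset ?_
    rintro v ⟨hv, hne⟩
    cases v with
    | nil => simp at hv
    | cons k v =>
      simp only [branchWeight, mul_ne_zero_iff] at hne
      simp only [Set.mem_iUnion, Set.mem_image, Set.mem_ofPred_eq]
      exact ⟨v, ⟨by simpa using hv, hne.1⟩, k, hne.2, rfl⟩

lemma generationSum_zero (y : List ℕ → ℝ × (ℕ → ℝ)) : generationSum y 0 = (y []).1 := by
  unfold generationSum
  rw [tsum_eq_single ⟨[], rfl⟩]
  · simp [branchWeight]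
  · rintro ⟨v, hv⟩ hne
    exact absurd (Subtype.ext (List.length_eq_zero_iff.1 hv)) hne

/-- A word of length `n + 1` is a first letter followed by a word of length `n`. -/
def consEquiv (n : ℕ) : ℕ × {v : List ℕ // v.length = n} ≃ {v : List ℕ // v.length = n + 1} where
  toFun q := ⟨q.2.1 ++ [q.1], by simp [q.2.2]⟩
  invFun v := ⟨v.1.getLast (by rintro h; simpa [h] using v.2), v.1.dropLast, by simp [v.2]⟩
  left_inv q := by ext <;> simp
  right_inv v := by
    ext1
    exact List.dropLast_append_getLast _

/-- Words are split at the letter next to the root, stored last in the list. This gives the backward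
recursion over independent subtrees, rather than one over the newest generation. -/
lemma generationSum_succ {y : List ℕ → ℝ × (ℕ → ℝ)} (hy : ∀ v, IsOrdered (y v).2) (n : ℕ) :
    generationSum y (n + 1) =
      weightedSum (y []).2 fun k => generationSum (subtree k y) n := by
  unfold generationSum weightedSum
  rw [← (consEquiv n).tsum_eq]
  have hsupp : Summable fun q : ℕ × {v : List ℕ // v.length = n} =>
      branchWeight y ((consEquiv n q)).1 * (y ((consEquiv n q)).1).1 := by
    refine summable_of_hasFiniteSupport ?_
    have hf := finite_setOf_branchWeight_ne_zero hy (n + 1)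
    refine (Set.Finite.preimage (f := fun q => ((consEquiv n q)).1)
      (Subtype.val_injective.comp (consEquiv n).injective).injOn hf).subset ?_
    intro q hq
    exact ⟨(consEquiv n q).2, left_ne_zero_of_mul hq⟩
  rw [hsupp.tsum_prod, tsum_eq_sum (s := Finset.range (numWeights (y []).2))]
  · refine Finset.sum_congr rfl fun k _ => ?_
    rw [← tsum_mul_left]
    refine tsum_congr fun v => ?_
    simp only [consEquiv, Equiv.coe_fn_mk, branchWeight_append, subtree]
    ring
  · intro k hk
    have hk' : (y []).2 k = 0 := (hy []).2.1 k (by simpa using hk)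
    simp [consEquiv, branchWeight_append, hk']

lemma partialSolution_zero (y : List ℕ → ℝ × (ℕ → ℝ)) : partialSolution y 0 = (y []).1 := by
  simp [partialSolution, generationSum_zero]

lemma partialSolution_succ {y : List ℕ → ℝ × (ℕ → ℝ)} (hy : ∀ v, IsOrdered (y v).2) (n : ℕ) :
    partialSolution y (n + 1) =
      (y []).1 + weightedSum (y []).2 fun k => partialSolution (subtree k y) n := by
  unfold partialSolution
  rw [Finset.sum_range_succ', generationSum_zero, add_comm]
  congr 1
  simp only [generationSum_succ hy, weightedSum, Finset.mul_sum]
  rw [Finset.sum_comm]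

/-! ### Measurability of functionals of a weight sequence -/

lemma measurable_numWeights : Measurable numWeights := by
  have key : ∀ F : Finset ℕ, MeasurableSet {t : ℕ → ℝ | {k | t k ≠ 0} = (F : Set ℕ)} := by
    intro F
    have : {t : ℕ → ℝ | {k | t k ≠ 0} = (F : Set ℕ)} = ⋂ k, {t | t k ≠ 0 ↔ k ∈ F} := by
      ext t
      simp [Set.ext_iff]
    rw [this]
    refine MeasurableSet.iInter fun k => ?_
    have h0 : MeasurableSet {t : ℕ → ℝ | t k = 0} :=
      measurable_pi_apply k (measurableSet_singleton 0)
    by_cases hk : k ∈ F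
    · simp only [hk, iff_true]
      exact h0.compl
    · simp only [hk, iff_false, not_not]
      exact h0
  have hpos : ∀ n : ℕ, 0 < n → MeasurableSet (numWeights ⁻¹' {n}) := by
    intro n hn
    have : numWeights ⁻¹' {n} =
        ⋃ F ∈ {F : Finset ℕ | F.card = n}, {t : ℕ → ℝ | {k | t k ≠ 0} = (F : Set ℕ)} := by
      ext t
      simp only [numWeights, Set.mem_preimage, Set.mem_singleton_iff, Set.mem_ofPred_eq,
        Set.mem_iUnion, exists_prop]
      constructor
      · intro h
        have hfin : {k | t k ≠ 0}.Finite := Set.finite_of_ncard_pos (by omega)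
        exact ⟨hfin.toFinset, by rw [← h, Set.ncard_eq_toFinset_card _ hfin], by simp⟩
      · rintro ⟨F, hF, h⟩
        rw [h, Set.ncard_coe_finset, hF]
    rw [this]
    exact MeasurableSet.biUnion (Set.to_countable _) fun F _ => key F
  refine measurable_to_countable' fun n => ?_
  rcases Nat.eq_zero_or_pos n with rfl | hn
  -- The level `0` also contains the sequences with infinitely many nonzero entries, by the default
  -- value of `ncard`; it is handled as a complement.
  · have : numWeights ⁻¹' {0} = (⋃ n : ℕ, numWeights ⁻¹' {n + 1})ᶜ := by
      ext t
      simp only [Set.mem_preimage, Set.mem_singleton_iff, Set.mem_compl_iff, Set.mem_iUnion,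
        not_exists]
      constructor
      · intro h n; omega
      · intro h
        by_contra h0
        exact h (numWeights t - 1) (by omega)
    rw [this]
    exact (MeasurableSet.iUnion fun n => hpos _ n.succ_pos).compl
  · exact hpos n hn

lemma measurable_sum_range_numWeights {f : ℕ → (ℕ → ℝ) × (ℕ → ℝ) → ℝ}
    (hf : ∀ k, Measurable (f k)) :
    Measurable fun q : (ℕ → ℝ) × (ℕ → ℝ) => ∑ k ∈ Finset.range (numWeights q.1), f k q := by
  have h : Measurable fun q : ℕ × ((ℕ → ℝ) × (ℕ → ℝ)) => ∑ k ∈ Finset.range q.1, f k q.2 :=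
    measurable_from_prod_countable_right fun n =>
      Finset.measurable_fun_sum (Finset.range n) fun k _ => hf k
  exact h.comp ((measurable_numWeights.comp measurable_fst).prodMk measurable_id)

lemma measurable_weightedSum : Measurable fun q : (ℕ → ℝ) × (ℕ → ℝ) => weightedSum q.1 q.2 :=
  measurable_sum_range_numWeights fun k => by fun_prop

lemma measurable_subtree (k : ℕ) : Measurable (subtree k) := by
  unfold subtree
  fun_prop

lemma measurable_powerSum (p : ℝ) : Measurable (powerSum p) := by
  have h := measurable_sum_range_numWeights (f := fun k q => |q.1 k| ^ p) fun k => by fun_prop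
  exact h.comp (f := fun t => (t, (0 : ℕ → ℝ))) (by fun_prop)

lemma measurable_lastWeight : Measurable lastWeight := by
  have h : Measurable fun q : ℕ × (ℕ → ℝ) => if q.1 = 0 then 0 else q.2 (q.1 - 1) :=
    measurable_from_prod_countable_right fun n => by
      by_cases hn : n = 0 <;> simp only [hn, if_true, if_false] <;> fun_prop
  exact h.comp (measurable_numWeights.prodMk measurable_id)

/-! ### The decomposition of a random tree at its root -/

section Law

variable {μ : Measure (ℝ × (ℕ → ℝ))} [IsProbabilityMeasure μ]

/-- The words `v ++ [k]` are distinct for distinct `(k, v)`, so the family of subtrees is a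
reindexed and curried i.i.d. family. -/
lemma map_subtree_family :
    (Measure.infinitePi fun _ : List ℕ => μ).map (fun y k => subtree k y) =
      Measure.infinitePi fun _ : ℕ => Measure.infinitePi fun _ : List ℕ => μ := by
  have hinj : Function.Injective fun q : ℕ × List ℕ => q.2 ++ [q.1] := by
    rintro ⟨k, v⟩ ⟨k', v'⟩ h
    simpa [and_comm, List.append_inj'] using h
  have h1 := Measure.map_infinitePi_infinitePi_of_inj (P := fun _ : List ℕ => μ) hinj
  have h2 := Measure.infinitePi_map_curry (fun (_ : ℕ) (_ : List ℕ) => μ)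
  rw [← h1, Measure.map_map (by fun_prop) (by fun_prop)] at h2
  exact h2

lemma map_subtree (k : ℕ) :
    (Measure.infinitePi fun _ : List ℕ => μ).map (subtree k) =
      Measure.infinitePi fun _ : List ℕ => μ := by
  have hinj : Function.Injective fun v : List ℕ => v ++ [k] := fun v v' h => by simpa using h
  exact Measure.map_infinitePi_infinitePi_of_inj (P := fun _ : List ℕ => μ) hinj

/-- The root mark and the subtrees read disjoint sets of vertices, hence are independent. -/
lemma map_root_subtree :
    (Measure.infinitePi fun _ : List ℕ => μ).map (fun y => (y [], fun k => subtree k y)) =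
      μ.prod (Measure.infinitePi fun _ : ℕ => Measure.infinitePi fun _ : List ℕ => μ) := by
  set Q := Measure.infinitePi fun _ : List ℕ => μ with hQ
  have hi : iIndepFun (fun (v : List ℕ) (y : List ℕ → ℝ × (ℕ → ℝ)) => y v) Q :=
    iIndepFun_infinitePi (X := fun _ ω => ω) (by fun_prop)
  have hind : IndepFun (fun y : List ℕ → ℝ × (ℕ → ℝ) => y []) (fun y k => subtree k y) Q := by
    have h := indep_iSup_of_disjoint (fun v => (measurable_pi_apply v).comap_le) hi
      (S := {[]}) (T := {[]}ᶜ) disjoint_compl_right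
    refine indep_of_indep_of_le_left (indep_of_indep_of_le_right h ?_) ?_
    · rw [← measurable_iff_comap_le]
      refine @measurable_pi_lambda _ _ _ (_) _ _ fun k =>
        @measurable_pi_lambda _ _ _ (_) _ _ fun v => ?_
      rw [measurable_iff_comap_le]
      exact le_iSup₂_of_le (v ++ [k]) (by simp) le_rfl
    · exact le_iSup₂_of_le (f := fun (v : List ℕ) (_ : v ∈ ({[]} : Set (List ℕ))) =>
        MeasurableSpace.comap (fun y : List ℕ → ℝ × (ℕ → ℝ) => y v) inferInstance) [] rfl le_rfl
  have hm : Measurable fun (y : List ℕ → ℝ × (ℕ → ℝ)) k => subtree k y :=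
    measurable_pi_iff.2 measurable_subtree
  rw [(indepFun_iff_map_prod_eq_prod_map_map (measurable_pi_apply _).aemeasurable hm.aemeasurable).1 hind,
    map_subtree_family]
  congr 1
  exact Measure.infinitePi_map_eval (fun _ => μ) []

/-- The law of `c + ∑ t k * x k` where `(c, t)` has law `μ` and is independent of the
sequence `x`, which is independent with common law `ν`. -/
def smoothingStep (μ : Measure (ℝ × (ℕ → ℝ))) (ν : Measure ℝ) : Measure ℝ :=
  (μ.prod (Measure.infinitePi fun _ : ℕ => ν)).map fun q => q.1.1 + weightedSum q.1.2 q.2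

lemma measurable_add_weightedSum :
    Measurable fun q : (ℝ × (ℕ → ℝ)) × (ℕ → ℝ) => q.1.1 + weightedSum q.1.2 q.2 := by
  have h := measurable_weightedSum.comp
    (f := fun q : (ℝ × (ℕ → ℝ)) × (ℕ → ℝ) => (q.1.2, q.2)) (by fun_prop)
  exact (by fun_prop : Measurable fun q : (ℝ × (ℕ → ℝ)) × (ℕ → ℝ) => q.1.1).add h

instance isProbabilityMeasure_smoothingStep (ν : Measure ℝ) [IsProbabilityMeasure ν] :
    IsProbabilityMeasure (smoothingStep μ ν) :=
  Measure.isProbabilityMeasure_map measurable_add_weightedSum.aemeasurable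

/-- The map `f` allows two uses: the identity for `W_n` and `W`, and deletion of the cost at the
root for generation sums. Since `X` is only a.e. measurable, a measurable version is used in every
subtree; this is harmless because each subtree has the law of the whole tree. -/
lemma map_eq_smoothingStep {X X' : (List ℕ → ℝ × (ℕ → ℝ)) → ℝ}
    (hX : AEMeasurable X (Measure.infinitePi fun _ => μ))
    (f : ℝ × (ℕ → ℝ) → ℝ × (ℕ → ℝ)) (hf : Measurable f)
    (h : ∀ᵐ y ∂(Measure.infinitePi fun _ => μ),
      X' y = (f (y [])).1 + weightedSum (f (y [])).2 fun k => X (subtree k y)) :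
    AEMeasurable X' (Measure.infinitePi fun _ => μ) ∧
    (Measure.infinitePi fun _ => μ).map X' =
      smoothingStep (μ.map f) ((Measure.infinitePi fun _ => μ).map X) := by
  set Q := Measure.infinitePi fun _ : List ℕ => μ with hQ
  have hsub : ∀ k, ∀ᵐ y ∂Q, X (subtree k y) = hX.mk X (subtree k y) := fun k => by
    refine ae_of_ae_map (p := fun y => X y = hX.mk X y) (measurable_subtree k).aemeasurable ?_
    rw [map_subtree]
    exact hX.ae_eq_mk
  set Xm := hX.mk X
  have hXm : Measurable Xm := hX.measurable_mk
  have hmap : Q.map X = Q.map Xm := Measure.map_congr hX.ae_eq_mk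
  have : IsProbabilityMeasure (Q.map Xm) := Measure.isProbabilityMeasure_map hXm.aemeasurable
  have hae : X' =ᵐ[Q] fun y => (f (y [])).1 + weightedSum (f (y [])).2
      fun k => Xm (subtree k y) := by
    filter_upwards [h, ae_all_iff.2 hsub] with y hy hs
    rw [hy]
    simp_rw [hs]
  have hg : Measurable fun z : ℕ → (List ℕ → ℝ × (ℕ → ℝ)) => fun k => Xm (z k) := by fun_prop
  have hm : Measurable fun (y : List ℕ → ℝ × (ℕ → ℝ)) k => subtree k y :=
    measurable_pi_iff.2 measurable_subtree
  have hroot : Measurable fun (y : List ℕ → ℝ × (ℕ → ℝ)) => (y [], fun k => subtree k y) :=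
    (measurable_pi_apply _).prodMk hm
  have hcomp : (fun y => (f (y [])).1 + weightedSum (f (y [])).2 fun k => Xm (subtree k y)) =
      (fun q : (ℝ × (ℕ → ℝ)) × (ℕ → ℝ) => q.1.1 + weightedSum q.1.2 q.2) ∘
      (Prod.map f (fun z : ℕ → (List ℕ → ℝ × (ℕ → ℝ)) => fun k => Xm (z k))) ∘
      (fun y => (y [], fun k => subtree k y)) := rfl
  have hmeas := measurable_add_weightedSum.comp ((hf.prodMap hg).comp hroot)
  refine ⟨⟨_, hmeas, hae⟩, ?_⟩
  have hpf : IsProbabilityMeasure (μ.map f) := Measure.isProbabilityMeasure_map hf.aemeasurable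
  rw [Measure.map_congr hae, hcomp, ← Measure.map_map measurable_add_weightedSum
    ((hf.prodMap hg).comp hroot), ← Measure.map_map (hf.prodMap hg) hroot, map_root_subtree,
    ← Measure.map_prod_map _ _ hf hg, hmap, smoothingStep,
    Measure.infinitePi_map_pi (fun _ => Q) (fun _ => hXm)]

end Law

/-! ### Weighted sums of independent identically distributed variables -/

section IidSums

variable {ν : Measure ℝ} [IsProbabilityMeasure ν]

lemma lintegral_sum_range_succ (t : ℕ → ℝ) (m : ℕ) {F : ℝ → ℝ≥0∞} (hF : Measurable F) :
    ∫⁻ x, F (∑ k ∈ Finset.range (m + 1), t k * x k) ∂(Measure.infinitePi fun _ : ℕ => ν) =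
      ∫⁻ x, ∫⁻ v, F (∑ k ∈ Finset.range m, t k * x k + t m * v) ∂ν
        ∂(Measure.infinitePi fun _ : ℕ => ν) := by
  set M := Measure.infinitePi fun _ : ℕ => ν with hM
  have hi : iIndepFun (fun (k : ℕ) (x : ℕ → ℝ) => t k * x k) M :=
    iIndepFun_infinitePi (X := fun k ω => t k * ω) (by fun_prop)
  have hind := hi.indepFun_finsetSum_of_notMem (fun k => by fun_prop)
    (s := Finset.range m) (i := m) (by simp)
  have hm1 : Measurable fun x : ℕ → ℝ => ∑ k ∈ Finset.range m, t k * x k := by fun_prop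
  have hm2 : Measurable fun x : ℕ → ℝ => t m * x m := by fun_prop
  have hpair := (indepFun_iff_map_prod_eq_prod_map_map hm1.aemeasurable hm2.aemeasurable).1
    (by simpa [Finset.sum_fn] using hind)
  have hmapm : M.map (fun x : ℕ → ℝ => t m * x m) = ν.map fun v => t m * v := by
    have h0 := Measure.infinitePi_map_eval (fun _ : ℕ => ν) m
    conv_rhs => rw [← h0]
    rw [Measure.map_map (by fun_prop) (by fun_prop)]
    rfl
  have hFm : Measurable fun q : ℝ × ℝ => F (q.1 + q.2) := by fun_prop
  have h1 : ∫⁻ x, F (∑ k ∈ Finset.range (m + 1), t k * x k) ∂M =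
      ∫⁻ q, F (q.1 + q.2) ∂(M.map fun x =>
        (∑ k ∈ Finset.range m, t k * x k, t m * x m)) := by
    rw [lintegral_map hFm (hm1.prodMk hm2)]
    simp only [Finset.sum_range_succ]
  have := Measure.isProbabilityMeasure_map (μ := M) hm1.aemeasurable
  have hν : IsProbabilityMeasure (ν.map fun v => t m * v) :=
    Measure.isProbabilityMeasure_map (by fun_prop)
  rw [h1, hpair, hmapm, lintegral_prod _ hFm.aemeasurable, lintegral_map _ hm1]
  · refine lintegral_congr fun x => ?_
    rw [lintegral_map (by fun_prop) (by fun_prop)]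
  · exact hFm.lintegral_prod_right'

/-- The moment generating function with values in `[0, ∞]`. -/
def expMoment (ν : Measure ℝ) (s : ℝ) : ℝ≥0∞ := ∫⁻ x, ENNReal.ofReal (Real.exp (s * x)) ∂ν

lemma lintegral_exp_sum_range (t : ℕ → ℝ) (s : ℝ) (m : ℕ) :
    ∫⁻ x, ENNReal.ofReal (Real.exp (s * ∑ k ∈ Finset.range m, t k * x k))
        ∂(Measure.infinitePi fun _ : ℕ => ν) =
      ∏ k ∈ Finset.range m, expMoment ν (s * t k) := by
  induction m with
  | zero => simp
  | succ m ih =>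
    have hF : Measurable fun u : ℝ => ENNReal.ofReal (Real.exp (s * u)) := by fun_prop
    rw [lintegral_sum_range_succ t m hF, Finset.prod_range_succ, ← ih, ← lintegral_mul_const]
    · refine lintegral_congr fun x => ?_
      rw [expMoment, ← lintegral_const_mul _ (by fun_prop)]
      refine lintegral_congr fun v => ?_
      rw [← ENNReal.ofReal_mul (Real.exp_pos _).le, ← Real.exp_add]
      ring_nf
    · fun_prop

lemma lintegral_smoothingStep {μ : Measure (ℝ × (ℕ → ℝ))} [IsProbabilityMeasure μ]
    {F : ℝ → ℝ≥0∞} (hF : Measurable F) :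
    ∫⁻ z, F z ∂(smoothingStep μ ν) =
      ∫⁻ e, ∫⁻ x, F (e.1 + weightedSum e.2 x) ∂(Measure.infinitePi fun _ : ℕ => ν) ∂μ := by
  rw [smoothingStep, lintegral_map hF measurable_add_weightedSum]
  exact lintegral_prod _ (hF.comp measurable_add_weightedSum).aemeasurable

lemma expMoment_smoothingStep {μ : Measure (ℝ × (ℕ → ℝ))} [IsProbabilityMeasure μ] (s : ℝ) :
    expMoment (smoothingStep μ ν) s =
      ∫⁻ e, ENNReal.ofReal (Real.exp (s * e.1)) *
        ∏ k ∈ Finset.range (numWeights e.2), expMoment ν (s * e.2 k) ∂μ := by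
  rw [expMoment, lintegral_smoothingStep (by fun_prop)]
  refine lintegral_congr fun e => ?_
  rw [← lintegral_exp_sum_range, ← lintegral_const_mul _ (by fun_prop)]
  refine lintegral_congr fun x => ?_
  rw [← ENNReal.ofReal_mul (Real.exp_pos _).le, ← Real.exp_add, weightedSum]
  ring_nf

/-! ### Convex order and moments of sums of symmetric variables -/

/-- The convex order of laws on the line, tested on nonnegative functions. -/
def ConvexLE (ν ν' : Measure ℝ) : Prop :=
  ∀ g : ℝ → ℝ, ConvexOn ℝ Set.univ g → (∀ x, 0 ≤ g x) →
    ∫⁻ x, ENNReal.ofReal (g x) ∂ν ≤ ∫⁻ x, ENNReal.ofReal (g x) ∂ν'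

lemma _root_.ConvexOn.measurable_of_univ {g : ℝ → ℝ} (hg : ConvexOn ℝ Set.univ g) :
    Measurable g :=
  (continuousOn_univ.1 (hg.continuousOn isOpen_univ)).measurable

lemma _root_.ConvexOn.comp_const_add_mul {g : ℝ → ℝ} (hg : ConvexOn ℝ Set.univ g) (u c : ℝ) :
    ConvexOn ℝ Set.univ fun v => g (u + c * v) := by
  refine ⟨convex_univ, fun x _ y _ a b ha hb hab => ?_⟩
  have h := hg.2 (Set.mem_univ (u + c * x)) (Set.mem_univ (u + c * y)) ha hb hab
  refine le_of_eq_of_le (congrArg g ?_) h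
  simp only [smul_eq_mul]
  linear_combination (-u) * hab

/-- Summands are exchanged one at a time: with the others frozen, the test function is convex in the
remaining variable, and Tonelli changes the order of integration. -/
lemma ConvexLE.sum_range {ν' : Measure ℝ} [IsProbabilityMeasure ν'] (h : ConvexLE ν ν')
    (t : ℕ → ℝ) (m : ℕ) {g : ℝ → ℝ} (hg : ConvexOn ℝ Set.univ g) (hg0 : ∀ x, 0 ≤ g x) :
    ∫⁻ x, ENNReal.ofReal (g (∑ k ∈ Finset.range m, t k * x k))
        ∂(Measure.infinitePi fun _ : ℕ => ν) ≤
      ∫⁻ x, ENNReal.ofReal (g (∑ k ∈ Finset.range m, t k * x k))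
        ∂(Measure.infinitePi fun _ : ℕ => ν') := by
  induction m generalizing g with
  | zero => simp
  | succ m ih =>
    have hgm := hg.measurable_of_univ
    have hF : Measurable fun x => ENNReal.ofReal (g x) := by fun_prop
    have hsw : ∀ (ρ : Measure ℝ) [IsProbabilityMeasure ρ],
        ∫⁻ x, ∫⁻ v, ENNReal.ofReal (g (∑ k ∈ Finset.range m, t k * x k + t m * v)) ∂ν'
          ∂(Measure.infinitePi fun _ : ℕ => ρ) =
        ∫⁻ v, ∫⁻ x, ENNReal.ofReal (g (t m * v + 1 * ∑ k ∈ Finset.range m, t k * x k))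
          ∂(Measure.infinitePi fun _ : ℕ => ρ) ∂ν' := by
      intro ρ _
      rw [lintegral_lintegral_swap]
      · simp only [add_comm, one_mul]
      · exact Measurable.aemeasurable (by fun_prop)
    rw [lintegral_sum_range_succ t m hF, lintegral_sum_range_succ t m hF]
    calc _ ≤ ∫⁻ x, ∫⁻ v, ENNReal.ofReal (g (∑ k ∈ Finset.range m, t k * x k + t m * v)) ∂ν'
          ∂(Measure.infinitePi fun _ : ℕ => ν) :=
        lintegral_mono fun x => h _ (hg.comp_const_add_mul _ _) fun _ => hg0 _
      _ ≤ _ := by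
        rw [hsw, hsw]
        exact lintegral_mono fun v => ih (hg.comp_const_add_mul _ _) fun _ => hg0 _

/-- With `|z|^p = (z²)^(p/2)`, this combines concavity and subadditivity of `u^(p/2)` with the
parallelogram identity. -/
lemma abs_add_rpow_add_abs_sub_rpow_le {p : ℝ} (hp1 : 1 ≤ p) (hp2 : p ≤ 2) (x y : ℝ) :
    |x + y| ^ p + |x - y| ^ p ≤ 2 * |x| ^ p + 2 * |y| ^ p := by
  have hsq : ∀ z : ℝ, |z| ^ p = (z ^ 2) ^ (p / 2) := fun z => by
    rw [← sq_abs, ← Real.rpow_natCast, ← Real.rpow_mul (abs_nonneg z)]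
    congr 1
    push_cast
    ring
  have hc := Real.concaveOn_rpow (p := p / 2) (by linarith) (by linarith)
  have h1 := hc.2 (Set.mem_Ici.2 (sq_nonneg (x + y))) (Set.mem_Ici.2 (sq_nonneg (x - y)))
    (by norm_num : (0 : ℝ) ≤ 1 / 2) (by norm_num : (0 : ℝ) ≤ 1 / 2) (by norm_num)
  have h2 := Real.rpow_add_le_add_rpow (p := p / 2) (sq_nonneg x) (sq_nonneg y) (by linarith)
    (by linarith)
  simp only [smul_eq_mul] at h1
  have h3 : 1 / 2 * (x + y) ^ 2 + 1 / 2 * (x - y) ^ 2 = x ^ 2 + y ^ 2 := by ring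
  rw [h3] at h1
  rw [hsq, hsq, hsq, hsq]
  linarith

/-- By symmetry the sign of the newest summand can be averaged over, and the two-point inequality
then adds its p-th moment with constant `1`. A larger constant would spoil the contraction over
generations. -/
lemma lintegral_abs_sum_range_rpow_le {p : ℝ} (hp1 : 1 ≤ p) (hp2 : p ≤ 2)
    (hsymm : ν.map (fun x => -x) = ν) (t : ℕ → ℝ) (m : ℕ) :
    ∫⁻ x, ENNReal.ofReal (|∑ k ∈ Finset.range m, t k * x k| ^ p)
        ∂(Measure.infinitePi fun _ : ℕ => ν) ≤
      ENNReal.ofReal (∑ k ∈ Finset.range m, |t k| ^ p) *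
        ∫⁻ x, ENNReal.ofReal (|x| ^ p) ∂ν := by
  induction m with
  | zero => simp [Real.zero_rpow (by linarith : p ≠ 0)]
  | succ m ih =>
    have hF : Measurable fun x : ℝ => ENNReal.ofReal (|x| ^ p) := by fun_prop
    rw [lintegral_sum_range_succ t m hF]
    have key : ∀ u : ℝ, ∫⁻ v, ENNReal.ofReal (|u + t m * v| ^ p) ∂ν ≤
        ENNReal.ofReal (|u| ^ p) + ENNReal.ofReal (|t m| ^ p) *
          ∫⁻ x, ENNReal.ofReal (|x| ^ p) ∂ν := by
      intro u
      have hneg : ∫⁻ v, ENNReal.ofReal (|u + t m * v| ^ p) ∂ν =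
          ∫⁻ v, ENNReal.ofReal (|u - t m * v| ^ p) ∂ν := by
        conv_lhs => rw [← hsymm]
        rw [lintegral_map (by fun_prop) (by fun_prop)]
        refine lintegral_congr fun v => ?_
        congr 3
        ring
      have h2 : 2 * ∫⁻ v, ENNReal.ofReal (|u + t m * v| ^ p) ∂ν ≤
          2 * (ENNReal.ofReal (|u| ^ p) + ENNReal.ofReal (|t m| ^ p) *
          ∫⁻ x, ENNReal.ofReal (|x| ^ p) ∂ν) := by
        calc _ = ∫⁻ v, (ENNReal.ofReal (|u + t m * v| ^ p) +
              ENNReal.ofReal (|u - t m * v| ^ p)) ∂ν := by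
              rw [two_mul]
              nth_rw 2 [hneg]
              rw [lintegral_add_left (by fun_prop)]
          _ ≤ ∫⁻ v, (2 * ENNReal.ofReal (|u| ^ p) + 2 * (ENNReal.ofReal (|t m| ^ p) *
                ENNReal.ofReal (|v| ^ p))) ∂ν := by
              refine lintegral_mono fun v => ?_
              have hh := abs_add_rpow_add_abs_sub_rpow_le hp1 hp2 u (t m * v)
              rw [abs_mul, Real.mul_rpow (abs_nonneg _) (abs_nonneg _)] at hh
              have h2' : (2 : ℝ≥0∞) = ENNReal.ofReal 2 := by simp
              rw [h2', ← ENNReal.ofReal_mul (by positivity), ← ENNReal.ofReal_mul (by positivity),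
                ← ENNReal.ofReal_mul (by positivity),
                ← ENNReal.ofReal_add (by positivity) (by positivity),
                ← ENNReal.ofReal_add (by positivity) (by positivity)]
              exact ENNReal.ofReal_le_ofReal hh
          _ = _ := by
              rw [lintegral_add_left (by fun_prop), lintegral_const, lintegral_const_mul _
                (by fun_prop), lintegral_const_mul _ (by fun_prop)]
              simp [mul_add]
      exact (ENNReal.mul_le_mul_iff_right (by simp) (by simp)).1 h2
    calc _ ≤ ∫⁻ x, (ENNReal.ofReal (|∑ k ∈ Finset.range m, t k * x k| ^ p) +
          ENNReal.ofReal (|t m| ^ p) * ∫⁻ x, ENNReal.ofReal (|x| ^ p) ∂ν)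
          ∂(Measure.infinitePi fun _ : ℕ => ν) := lintegral_mono fun x => key _
      _ ≤ _ := by
        rw [lintegral_add_left (by fun_prop), lintegral_const, measure_univ, mul_one,
          Finset.sum_range_succ, ENNReal.ofReal_add
            (Finset.sum_nonneg fun _ _ => by positivity) (by positivity), add_mul]
        gcongr

/-- `ν` is dominated in the convex order by a symmetric law with `p`-th moment at most `K`. -/
def SymmDominated (p : ℝ) (ν : Measure ℝ) (K : ℝ≥0∞) : Prop :=
  ∃ ν' : Measure ℝ, IsProbabilityMeasure ν' ∧ ν'.map (fun x => -x) = ν' ∧ ConvexLE ν ν' ∧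
    ∫⁻ x, ENNReal.ofReal (|x| ^ p) ∂ν' ≤ K

lemma convexOn_abs_rpow {p : ℝ} (hp1 : 1 ≤ p) :
    ConvexOn ℝ Set.univ fun x : ℝ => |x| ^ p := by
  refine ⟨convex_univ, fun x _ y _ a b ha hb hab => ?_⟩
  have h := (convexOn_rpow hp1).2 (Set.mem_Ici.2 (abs_nonneg x)) (Set.mem_Ici.2 (abs_nonneg y))
    ha hb hab
  refine le_trans (Real.rpow_le_rpow (abs_nonneg _) ?_ (by linarith)) h
  simp only [smul_eq_mul]
  refine (abs_add_le _ _).trans_eq ?_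
  rw [abs_mul, abs_mul, abs_of_nonneg ha, abs_of_nonneg hb]

/-- Symmetry and convex domination both survive a step without cost, so symmetrisation is paid for
once, at the start, and not in every generation. -/
lemma SymmDominated.smoothingStep {p : ℝ} (hp1 : 1 ≤ p) (hp2 : p ≤ 2)
    {μ : Measure (ℝ × (ℕ → ℝ))} [IsProbabilityMeasure μ] (hμ : ∀ᵐ e ∂μ, e.1 = 0)
    {K : ℝ≥0∞} (h : SymmDominated p ν K) :
    SymmDominated p (smoothingStep μ ν) ((∫⁻ e, ENNReal.ofReal (powerSum p e.2) ∂μ) * K) := by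
  obtain ⟨ν', hν', hsymm, hle, hK⟩ := h
  refine ⟨SmoothingTransform.smoothingStep μ ν', inferInstance, ?_, ?_, ?_⟩
  · have hneg : (Measure.infinitePi fun _ : ℕ => ν').map (fun (x : ℕ → ℝ) k => -x k) =
        Measure.infinitePi fun _ : ℕ => ν' := by
      have h := Measure.infinitePi_map_pi (fun _ : ℕ => ν') (f := fun _ x => -x)
        (fun _ => measurable_neg)
      rw [h, hsymm]
    refine Measure.ext_of_lintegral _ fun F hF => ?_
    rw [lintegral_map hF measurable_neg, lintegral_smoothingStep (by fun_prop),
      lintegral_smoothingStep hF]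
    refine lintegral_congr_ae (hμ.mono fun e he => ?_)
    have hm : Measurable fun x => F (e.1 + weightedSum e.2 x) :=
      hF.comp (measurable_add_weightedSum.comp (measurable_const.prodMk measurable_id))
    simp only
    conv_rhs => rw [← hneg]
    rw [lintegral_map hm (by fun_prop)]
    refine lintegral_congr fun x => ?_
    simp [he, weightedSum]
  · intro g hg hg0
    have hF : Measurable fun x => ENNReal.ofReal (g x) := by
      have := hg.measurable_of_univ
      fun_prop
    rw [lintegral_smoothingStep hF, lintegral_smoothingStep hF]
    refine lintegral_mono fun e => ?_
    have h2 := hle.sum_range e.2 (numWeights e.2) (hg.comp_const_add_mul e.1 1) fun _ => hg0 _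
    simpa [weightedSum] using h2
  · have hm : Measurable fun e : ℝ × (ℕ → ℝ) => ENNReal.ofReal (powerSum p e.2) :=
      ((measurable_powerSum p).comp measurable_snd).ennreal_ofReal
    rw [lintegral_smoothingStep (by fun_prop), ← lintegral_mul_const _ hm]
    · refine lintegral_mono_ae (hμ.mono fun e he => ?_)
      have h2 := lintegral_abs_sum_range_rpow_le hp1 hp2 hsymm e.2 (numWeights e.2)
      simp only [he, zero_add, weightedSum]
      exact h2.trans (mul_le_mul' le_rfl hK)

/-- The dominating law is that of `X - X'` with `X'` an independent copy: as `X'` has mean zero,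
Jensen gives `g(x) ≤ E g(x - X')`. -/
lemma SymmDominated.of_integral_eq_zero {p : ℝ} (hp1 : 1 ≤ p) (hp2 : p ≤ 2)
    (hint : Integrable (fun x => x) ν) (hmean : ∫ x, x ∂ν = 0)
    (hmom : ∫⁻ x, ENNReal.ofReal (|x| ^ p) ∂ν ≠ ∞) :
    ∃ K : ℝ≥0∞, K ≠ ∞ ∧ SymmDominated p ν K := by
  have hsub : Measurable fun q : ℝ × ℝ => q.1 - q.2 := by fun_prop
  refine ⟨∫⁻ x, ENNReal.ofReal (|x| ^ p) ∂((ν.prod ν).map fun q => q.1 - q.2), ?_,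
    (ν.prod ν).map fun q => q.1 - q.2,
    Measure.isProbabilityMeasure_map hsub.aemeasurable, ?_, ?_, le_rfl⟩
  · rw [lintegral_map (by fun_prop) hsub, lintegral_prod _ (by fun_prop)]
    have hb : ∀ x y : ℝ, ENNReal.ofReal (|x - y| ^ p) ≤
        2 * ENNReal.ofReal (|x| ^ p) + 2 * ENNReal.ofReal (|y| ^ p) := by
      intro x y
      have hh := abs_add_rpow_add_abs_sub_rpow_le hp1 hp2 x y
      have h0 : 0 ≤ |x + y| ^ p := by positivity
      have h2' : (2 : ℝ≥0∞) = ENNReal.ofReal 2 := by simp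
      rw [h2', ← ENNReal.ofReal_mul (by positivity), ← ENNReal.ofReal_mul (by positivity),
        ← ENNReal.ofReal_add (by positivity) (by positivity)]
      exact ENNReal.ofReal_le_ofReal (by linarith)
    refine ne_top_of_le_ne_top ?_
      (lintegral_mono fun x => lintegral_mono fun y => hb x y)
    have h1 : ∀ x : ℝ, ∫⁻ y, (2 * ENNReal.ofReal (|x| ^ p) + 2 * ENNReal.ofReal (|y| ^ p)) ∂ν =
        2 * ENNReal.ofReal (|x| ^ p) + 2 * ∫⁻ y, ENNReal.ofReal (|y| ^ p) ∂ν := fun x => by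
      rw [lintegral_add_left (by fun_prop), lintegral_const_mul (2 : ℝ≥0∞)
        (by fun_prop : Measurable fun y : ℝ => ENNReal.ofReal (|y| ^ p)), lintegral_const]
      simp
    simp_rw [h1]
    rw [lintegral_add_left (by fun_prop), lintegral_const_mul _ (by fun_prop), lintegral_const]
    simp only [measure_univ, mul_one]
    finiteness
  · rw [Measure.map_map (by fun_prop) hsub]
    conv_rhs => rw [← Measure.prod_swap, Measure.map_map hsub measurable_swap]
    congr 1
    ext q
    simp
  · intro g hg hg0
    have hgm := hg.measurable_of_univ
    rw [lintegral_map (by fun_prop) hsub, lintegral_prod _ (by fun_prop)]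
    refine lintegral_mono fun x => ?_
    by_cases hi : Integrable (fun y => g (x - y)) ν
    · have hcx := hg.comp_const_add_mul x (-1)
      have hj := hcx.map_integral_le (μ := ν) (f := fun y => y)
        (continuousOn_univ.1 (hcx.continuousOn isOpen_univ)).continuousOn isClosed_univ
        (by simp) hint (by simpa [Function.comp_def, sub_eq_add_neg] using hi)
      rw [hmean] at hj
      rw [← ofReal_integral_eq_lintegral_ofReal hi (ae_of_all _ fun _ => hg0 _)]
      refine ENNReal.ofReal_le_ofReal ?_
      simpa [sub_eq_add_neg] using hj
    · have htop : ∫⁻ y, ENNReal.ofReal (g (x - y)) ∂ν = ∞ := by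
        by_contra hne
        exact hi ⟨(by fun_prop : Measurable fun y => g (x - y)).aestronglyMeasurable, (hasFiniteIntegral_iff_ofReal (ae_of_all _ fun _ => hg0 _)).2
          (lt_top_iff_ne_top.2 hne)⟩
      rw [htop]
      exact le_top

end IidSums

/-! ### Convergence of the partial solutions and the fixed point equation -/

section Convergence

lemma ae_fst_eq_zero_map (μ : Measure (ℝ × (ℕ → ℝ))) :
    ∀ᵐ e ∂(μ.map fun e : ℝ × (ℕ → ℝ) => ((0 : ℝ), e.2)), e.1 = 0 := by
  have hs : MeasurableSet {e : ℝ × (ℕ → ℝ) | e.1 = 0} :=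
    measurable_fst (measurableSet_singleton 0)
  rw [ae_map_iff (by fun_prop) hs]
  simp

variable {μ : Measure (ℝ × (ℕ → ℝ))} [IsProbabilityMeasure μ]

lemma ae_forall_isOrdered (hord : ∀ᵐ e ∂μ, IsOrdered e.2) :
    ∀ᵐ y ∂(Measure.infinitePi fun _ : List ℕ => μ), ∀ v, IsOrdered (y v).2 :=
  ae_all_iff.2 fun v =>
    (measurePreserving_eval_infinitePi (fun _ : List ℕ => μ) v).quasiMeasurePreserving.ae hord

lemma map_generationSum_succ (hord : ∀ᵐ e ∂μ, IsOrdered e.2) (n : ℕ)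
    (hn : AEMeasurable (fun y => generationSum y n) (Measure.infinitePi fun _ => μ)) :
    AEMeasurable (fun y => generationSum y (n + 1)) (Measure.infinitePi fun _ => μ) ∧
    (Measure.infinitePi fun _ => μ).map (fun y => generationSum y (n + 1)) =
      smoothingStep (μ.map fun e => (0, e.2))
        ((Measure.infinitePi fun _ => μ).map fun y => generationSum y n) := by
  refine map_eq_smoothingStep hn (fun e => (0, e.2)) (by fun_prop) ?_
  filter_upwards [ae_forall_isOrdered hord] with y hy
  simp [generationSum_succ hy]

lemma aemeasurable_generationSum (hord : ∀ᵐ e ∂μ, IsOrdered e.2) (n : ℕ) :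
    AEMeasurable (fun y => generationSum y n) (Measure.infinitePi fun _ => μ) := by
  induction n with
  | zero =>
    simp only [generationSum_zero]
    exact Measurable.aemeasurable (measurable_fst.comp (measurable_pi_apply _))
  | succ n ih => exact (map_generationSum_succ hord n ih).1

lemma aemeasurable_partialSolution (hord : ∀ᵐ e ∂μ, IsOrdered e.2) (n : ℕ) :
    AEMeasurable (fun y => partialSolution y n) (Measure.infinitePi fun _ => μ) :=
  Finset.aemeasurable_fun_sum _ fun k _ => aemeasurable_generationSum hord k

lemma smoothingStep_dirac_zero : smoothingStep μ (Measure.dirac 0) = μ.map Prod.fst := by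
  refine Measure.ext_of_lintegral _ fun F hF => ?_
  rw [lintegral_smoothingStep hF, lintegral_map hF measurable_fst]
  refine lintegral_congr fun e => ?_
  have hm : Measurable fun x => F (e.1 + weightedSum e.2 x) :=
    hF.comp (measurable_add_weightedSum.comp (measurable_const.prodMk measurable_id))
  rw [Measure.infinitePi_dirac (fun _ : ℕ => (0 : ℝ)), lintegral_dirac' _ hm]
  simp [weightedSum]

lemma map_root_fst :
    (Measure.infinitePi fun _ : List ℕ => μ).map (fun y => (y []).1) = μ.map Prod.fst := by
  conv_rhs => rw [← Measure.infinitePi_map_eval (fun _ : List ℕ => μ) []]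
  rw [Measure.map_map measurable_fst (by fun_prop)]
  rfl

/-- The iteration starts at the unit mass at `0`, whose transform is constantly `1`; the first step
produces the law of `C`, whence the shift by one. -/
lemma map_partialSolution (hord : ∀ᵐ e ∂μ, IsOrdered e.2) (n : ℕ) :
    (Measure.infinitePi fun _ => μ).map (fun y => partialSolution y n) =
      (smoothingStep μ)^[n + 1] (Measure.dirac 0) := by
  induction n with
  | zero =>
    simp only [partialSolution_zero, zero_add, Function.iterate_one]
    rw [smoothingStep_dirac_zero, map_root_fst]
  | succ n ih =>
    have h := map_eq_smoothingStep (X' := fun y => partialSolution y (n + 1))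
      (aemeasurable_partialSolution hord n) id measurable_id
      (by filter_upwards [ae_forall_isOrdered hord] with y hy using partialSolution_succ hy n)
    rw [h.2, ih, Measure.map_id, Function.iterate_succ_apply' _ (n + 1)]

lemma symmDominated_generationSum (hord : ∀ᵐ e ∂μ, IsOrdered e.2) {p : ℝ} (hp1 : 1 ≤ p)
    (hp2 : p ≤ 2) {K : ℝ≥0∞} (hK : SymmDominated p (μ.map Prod.fst) K) (n : ℕ) :
    SymmDominated p ((Measure.infinitePi fun _ => μ).map fun y => generationSum y n)
      ((∫⁻ e, ENNReal.ofReal (powerSum p e.2) ∂μ) ^ n * K) := by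
  induction n with
  | zero =>
    have h0 : (Measure.infinitePi fun _ : List ℕ => μ).map (fun y => generationSum y 0) =
        μ.map Prod.fst := by
      simp only [generationSum_zero]
      exact map_root_fst
    simpa [h0] using hK
  | succ n ih =>
    rw [(map_generationSum_succ hord n (aemeasurable_generationSum hord n)).2]
    have hpm : IsProbabilityMeasure (μ.map fun e : ℝ × (ℕ → ℝ) => ((0 : ℝ), e.2)) :=
      Measure.isProbabilityMeasure_map (by fun_prop)
    have := Measure.isProbabilityMeasure_map (aemeasurable_generationSum hord n)
    have h := ih.smoothingStep hp1 hp2 (ae_fst_eq_zero_map μ)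
    have hps : Measurable fun e : ℝ × (ℕ → ℝ) => ENNReal.ofReal (powerSum p e.2) :=
      ((measurable_powerSum p).comp measurable_snd).ennreal_ofReal
    rw [lintegral_map hps (by fun_prop)] at h
    rwa [pow_succ', mul_assoc]

/-- Testing the convex order on `|x|^p` bounds the p-th moment, and the `L¹` norm is at most the
`L^p` norm; the p-th root keeps the rate geometric. -/
lemma lintegral_abs_generationSum_le (hord : ∀ᵐ e ∂μ, IsOrdered e.2) {p : ℝ} (hp1 : 1 ≤ p)
    (hp2 : p ≤ 2) {K : ℝ≥0∞} (hK : SymmDominated p (μ.map Prod.fst) K) (n : ℕ) :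
    ∫⁻ y, ‖generationSum y n‖ₑ ∂(Measure.infinitePi fun _ : List ℕ => μ) ≤
      ((∫⁻ e, ENNReal.ofReal (powerSum p e.2) ∂μ) ^ p⁻¹) ^ n * K ^ p⁻¹ := by
  obtain ⟨ν', -, -, hle, hK'⟩ := symmDominated_generationSum hord hp1 hp2 hK n
  have hm := aemeasurable_generationSum hord n (μ := μ)
  have h1 := hle _ (convexOn_abs_rpow hp1) fun x => by positivity
  rw [lintegral_map' (by fun_prop) hm] at h1
  have hp0 : 0 < p := by linarith
  have h2 := eLpNorm_le_eLpNorm_of_exponent_le (p := 1) (q := ENNReal.ofReal p)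
    (by simpa using hp1) hm.aestronglyMeasurable
  rw [eLpNorm_one_eq_lintegral_enorm, eLpNorm_eq_lintegral_rpow_enorm_toReal (by simpa using hp0)
    (by simp), ENNReal.toReal_ofReal hp0.le] at h2
  refine h2.trans ?_
  have h3 : ∫⁻ y, ‖generationSum y n‖ₑ ^ p ∂(Measure.infinitePi fun _ : List ℕ => μ) ≤
      (∫⁻ e, ENNReal.ofReal (powerSum p e.2) ∂μ) ^ n * K := by
    refine le_trans (le_of_eq (lintegral_congr fun y => ?_)) (h1.trans hK')
    rw [← ENNReal.ofReal_rpow_of_nonneg (abs_nonneg _) hp0.le, Real.enorm_eq_ofReal_abs]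
  rw [one_div]
  refine (ENNReal.rpow_le_rpow h3 (by positivity)).trans_eq ?_
  rw [ENNReal.mul_rpow_of_nonneg _ _ (by positivity), ← ENNReal.rpow_natCast,
    ← ENNReal.rpow_natCast, ← ENNReal.rpow_mul, ← ENNReal.rpow_mul,
    mul_comm (n : ℝ)]

lemma integral_weightedSum_eq_zero {ν : Measure ℝ} [IsProbabilityMeasure ν]
    (hint : Integrable (fun x => x) ν) (hmean : ∫ x, x ∂ν = 0) (t : ℕ → ℝ) :
    ∫ x, weightedSum t x ∂(Measure.infinitePi fun _ : ℕ => ν) = 0 := by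
  have hmp := fun k => measurePreserving_eval_infinitePi (fun _ : ℕ => ν) k
  unfold weightedSum
  rw [integral_finsetSum]
  · refine Finset.sum_eq_zero fun k _ => ?_
    have h : ∫ x : ℕ → ℝ, x k ∂(Measure.infinitePi fun _ : ℕ => ν) = 0 := by
      have h2 := integral_map (hmp k).aemeasurable
        (f := fun x : ℝ => x) (by fun_prop)
      rw [(hmp k).map_eq, hmean] at h2
      exact h2.symm
    rw [integral_const_mul, h, mul_zero]
  · intro k _
    exact ((hmp k).integrable_comp_of_integrable hint).const_mul _

lemma integral_smoothingStep_eq_zero {ν : Measure ℝ} [IsProbabilityMeasure ν]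
    (hμ : ∀ᵐ e ∂μ, e.1 = 0)
    (hint : Integrable (fun x => x) ν) (hmean : ∫ x, x ∂ν = 0)
    (hint' : Integrable (fun x => x) (smoothingStep μ ν)) :
    ∫ x, x ∂(smoothingStep μ ν) = 0 := by
  rw [smoothingStep] at hint' ⊢
  rw [integral_map measurable_add_weightedSum.aemeasurable (by fun_prop)]
  rw [integrable_map_measure (by fun_prop) measurable_add_weightedSum.aemeasurable] at hint'
  refine (integral_prod _ hint').trans ?_
  refine integral_eq_zero_of_ae (hμ.mono fun e he => ?_)
  simpa [he] using integral_weightedSum_eq_zero hint hmean e.2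

/-- The limit of the partial solutions: almost sure convergence, integrability with mean zero,
and the law as a fixed point. -/
theorem canonicalSolution_spec (hord : ∀ᵐ e ∂μ, IsOrdered e.2) {p : ℝ} (hp1 : 1 ≤ p)
    (hp2 : p ≤ 2) (hint : Integrable (fun e => e.1) μ) (hmean : ∫ e, e.1 ∂μ = 0)
    (hmom : ∫⁻ e, ENNReal.ofReal (|e.1| ^ p) ∂μ ≠ ∞)
    (hcontr : ∫⁻ e, ENNReal.ofReal (powerSum p e.2) ∂μ < 1) :
    (∀ᵐ y ∂(Measure.infinitePi fun _ : List ℕ => μ),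
      Tendsto (partialSolution y) atTop (𝓝 (canonicalSolution y))) ∧
    Integrable canonicalSolution (Measure.infinitePi fun _ : List ℕ => μ) ∧
    ∫ y, canonicalSolution y ∂(Measure.infinitePi fun _ : List ℕ => μ) = 0 ∧
    (Measure.infinitePi fun _ => μ).map canonicalSolution =
      smoothingStep μ ((Measure.infinitePi fun _ => μ).map canonicalSolution) := by
  set Q := Measure.infinitePi fun _ : List ℕ => μ with hQ
  have hfst : IsProbabilityMeasure (μ.map Prod.fst) :=
    Measure.isProbabilityMeasure_map (by fun_prop)
  obtain ⟨K, hKtop, hK⟩ := SymmDominated.of_integral_eq_zero (ν := μ.map Prod.fst) hp1 hp2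
    ((integrable_map_measure (by fun_prop) (by fun_prop)).2 hint)
    (by rwa [integral_map (by fun_prop) (by fun_prop)])
    (by rwa [lintegral_map (by fun_prop) (by fun_prop)])
  set r := (∫⁻ e, ENNReal.ofReal (powerSum p e.2) ∂μ) ^ p⁻¹ with hr
  have hr1 : r < 1 := ENNReal.rpow_lt_one hcontr (by positivity)
  have hbound := lintegral_abs_generationSum_le hord hp1 hp2 hK
  have hKp : K ^ p⁻¹ ≠ ∞ := ENNReal.rpow_ne_top_of_nonneg (by positivity) hKtop
  have hsum : ∑' n, ∫⁻ y, ‖generationSum y n‖ₑ ∂Q ≠ ∞ := by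
    refine ne_top_of_le_ne_top ?_ (ENNReal.tsum_le_tsum hbound)
    rw [ENNReal.tsum_mul_right, ENNReal.tsum_geometric]
    exact ENNReal.mul_ne_top (ENNReal.inv_ne_top.2 (tsub_pos_of_lt hr1).ne') hKp
  have hmeas := aemeasurable_generationSum hord (μ := μ)
  have hgint : ∀ n, Integrable (fun y => generationSum y n) Q := fun n =>
    ⟨(hmeas n).aestronglyMeasurable, lt_top_iff_ne_top.2 (ENNReal.ne_top_of_tsum_ne_top hsum n)⟩
  have hae : ∀ᵐ y ∂Q, Summable fun n => generationSum y n := by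
    rw [← lintegral_tsum fun n => (hmeas n).enorm] at hsum
    filter_upwards [ae_lt_top' (AEMeasurable.tsum fun n => (hmeas n).enorm) hsum] with y hy
    refine Summable.of_norm ?_
    have h := ENNReal.summable_toReal hy.ne
    simpa using h
  have hlim : ∀ᵐ y ∂Q, Tendsto (partialSolution y) atTop (𝓝 (∑' n, generationSum y n)) := by
    filter_upwards [hae] with y hy
    exact (tendsto_add_atTop_iff_nat 1).2 hy.hasSum.tendsto_sum_nat
  have hcan : canonicalSolution =ᵐ[Q] fun y => ∑' n, generationSum y n := by
    filter_upwards [hlim] with y hy using hy.limUnder_eq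
  have hconv : ∀ᵐ y ∂Q, Tendsto (partialSolution y) atTop (𝓝 (canonicalSolution y)) := by
    filter_upwards [hlim, hcan] with y h1 h2
    rwa [h2]
  -- Every generation is centred, so the `L¹` limit is; this mean zero is what later gives `Ψ ≥ 1`.
  have hzero : ∀ n, ∫ y, generationSum y n ∂Q = 0 := by
    intro n
    induction n with
    | zero =>
      simp only [generationSum_zero]
      have h1 := integral_map (μ := Q) (φ := fun y => (y []).1) (f := fun x : ℝ => x)
        (Measurable.aemeasurable (measurable_fst.comp (measurable_pi_apply _))) (by fun_prop)
      rw [map_root_fst, integral_map (by fun_prop) (by fun_prop), hmean] at h1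
      exact h1.symm
    | succ n ih =>
      obtain ⟨hm1, hmap⟩ := map_generationSum_succ hord n (hmeas n)
      have hpm : IsProbabilityMeasure (μ.map fun e : ℝ × (ℕ → ℝ) => ((0 : ℝ), e.2)) :=
        Measure.isProbabilityMeasure_map (by fun_prop)
      have := Measure.isProbabilityMeasure_map (hmeas n)
      have hi' := (integrable_map_measure (g := fun x : ℝ => x) (by fun_prop) hm1).2 (hgint (n + 1))
      have h1 : ∫ y, generationSum y (n + 1) ∂Q =
          ∫ x, x ∂(Q.map fun y => generationSum y (n + 1)) :=
        (integral_map (f := fun x : ℝ => x) hm1 (by fun_prop)).symm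
      rw [h1, hmap]
      rw [hmap] at hi'
      refine integral_smoothingStep_eq_zero (ae_fst_eq_zero_map μ) ?_ ?_ hi'
      · exact (integrable_map_measure (by fun_prop) (hmeas n)).2 (hgint n)
      · rw [integral_map (hmeas n) (by fun_prop)]
        exact ih
  have hcanm : AEMeasurable canonicalSolution Q :=
    aemeasurable_of_tendsto_metrizable_ae _ (aemeasurable_partialSolution hord) hconv
  have hcint : Integrable canonicalSolution Q := by
    refine ⟨hcanm.aestronglyMeasurable, ?_⟩
    refine lt_of_le_of_lt ?_ (lt_top_iff_ne_top.2 hsum)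
    rw [← lintegral_tsum fun n => (hmeas n).enorm]
    refine lintegral_mono_ae ?_
    filter_upwards [hcan] with y h2
    rw [h2]
    exact enorm_tsum_le_tsum_enorm
  refine ⟨hconv, hcint, ?_, ?_⟩
  · rw [integral_congr_ae hcan]
    have hs : Summable fun n => ∫ y, ‖generationSum y n‖ ∂Q := by
      have h := ENNReal.summable_toReal hsum
      refine h.congr fun n => ?_
      rw [integral_norm_eq_lintegral_enorm (hgint n).1]
    have h := hasSum_integral_of_summable_integral_norm hgint hs
    simp only [hzero] at h
    exact h.unique hasSum_zero
  · have hsub : ∀ k, ∀ᵐ y ∂Q, Tendsto (partialSolution (subtree k y)) atTop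
        (𝓝 (canonicalSolution (subtree k y))) := fun k => by
      refine ae_of_ae_map (p := fun y => Tendsto (partialSolution y) atTop
        (𝓝 (canonicalSolution y))) (measurable_subtree k).aemeasurable ?_
      rw [map_subtree]
      exact hconv
    have h := (map_eq_smoothingStep (X' := canonicalSolution) hcanm id measurable_id ?_).2
    · rwa [Measure.map_id] at h
    · filter_upwards [ae_forall_isOrdered hord, hconv, ae_all_iff.2 hsub] with y hy h1 h2
      -- The recursion passes to the limit because the sum over the children of the root is finite.
      refine tendsto_nhds_unique ((tendsto_add_atTop_iff_nat 1).2 h1) ?_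
      simp_rw [partialSolution_succ hy]
      exact tendsto_const_nhds.add (tendsto_finsetSum _ fun k _ => (h2 k).const_mul _)

/-- Fatou's lemma along `W_n → W`; this reduces sufficiency to uniform bounds on the iterates. -/
lemma expMoment_canonicalSolution_le (hord : ∀ᵐ e ∂μ, IsOrdered e.2)
    (hconv : ∀ᵐ y ∂(Measure.infinitePi fun _ : List ℕ => μ),
      Tendsto (partialSolution y) atTop (𝓝 (canonicalSolution y))) {s : ℝ} {K : ℝ≥0∞}
    (hK : ∀ n, expMoment ((smoothingStep μ)^[n] (Measure.dirac 0)) s ≤ K) :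
    expMoment ((Measure.infinitePi fun _ => μ).map canonicalSolution) s ≤ K := by
  have hm := aemeasurable_partialSolution hord (μ := μ)
  have hcanm := aemeasurable_of_tendsto_metrizable_ae _ hm hconv
  rw [expMoment, lintegral_map' (by fun_prop) hcanm]
  have hle : ∀ n, ∫⁻ y, ENNReal.ofReal (Real.exp (s * partialSolution y n))
      ∂(Measure.infinitePi fun _ : List ℕ => μ) ≤ K := fun n => by
    have h := hK (n + 1)
    rwa [← map_partialSolution hord n, expMoment, lintegral_map' (by fun_prop) (hm n)] at h
  calc _ ≤ ∫⁻ y, liminf (fun n => ENNReal.ofReal (Real.exp (s * partialSolution y n))) atTop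
        ∂(Measure.infinitePi fun _ : List ℕ => μ) := by
        refine lintegral_mono_ae ?_
        filter_upwards [hconv] with y hy
        refine (Tendsto.liminf_eq ?_).ge
        exact ENNReal.tendsto_ofReal ((Real.continuous_exp.tendsto _).comp (hy.const_mul s))
    _ ≤ liminf (fun n => ∫⁻ y, ENNReal.ofReal (Real.exp (s * partialSolution y n))
        ∂(Measure.infinitePi fun _ : List ℕ => μ)) atTop :=
        lintegral_liminf_le' fun n => by
          have := hm n
          fun_prop
    _ ≤ K := by
      refine (liminf_le_liminf (v := fun _ => K) (Eventually.of_forall hle)).trans ?_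
      simp

end Convergence

/-! ### The functional equation of the moment generating function -/

lemma measurable_expMoment (ν : Measure ℝ) [SFinite ν] : Measurable (expMoment ν) := by
  have h : Measurable fun q : ℝ × ℝ => ENNReal.ofReal (Real.exp (q.1 * q.2)) := by fun_prop
  exact h.lintegral_prod_right'

lemma measurable_prod_range_numWeights {f : ℝ → ℝ≥0∞} (hf : Measurable f) :
    Measurable fun t : ℕ → ℝ => ∏ k ∈ Finset.range (numWeights t), f (t k) := by
  have h : Measurable fun q : ℕ × (ℕ → ℝ) => ∏ k ∈ Finset.range q.1, f (q.2 k) :=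
    measurable_from_prod_countable_right fun n =>
      Finset.measurable_fun_prod (Finset.range n) fun k _ => hf.comp (measurable_pi_apply k)
  exact h.comp (measurable_numWeights.prodMk measurable_id)

lemma expMoment_smoothingStep_map {Ω : Type*} [MeasurableSpace Ω] {P : Measure Ω}
    [IsProbabilityMeasure P] {C : Ω → ℝ} {T : Ω → ℕ → ℝ} (hCT : AEMeasurable (fun ω => (C ω, T ω)) P)
    (ν : Measure ℝ) [IsProbabilityMeasure ν] (s : ℝ) :
    expMoment (smoothingStep (P.map fun ω => (C ω, T ω)) ν) s =
      ∫⁻ ω, ENNReal.ofReal (Real.exp (s * C ω)) *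
        ∏ k ∈ Finset.range (numWeights (T ω)), expMoment ν (s * T ω k) ∂P := by
  have := Measure.isProbabilityMeasure_map hCT
  have hm : Measurable fun e : ℝ × (ℕ → ℝ) => ENNReal.ofReal (Real.exp (s * e.1)) *
      ∏ k ∈ Finset.range (numWeights e.2), expMoment ν (s * e.2 k) := by
    have h1 : Measurable fun u => expMoment ν (s * u) :=
      (measurable_expMoment ν).comp (measurable_const_mul s)
    exact (by fun_prop : Measurable fun e : ℝ × (ℕ → ℝ) =>
      ENNReal.ofReal (Real.exp (s * e.1))).mul
      ((measurable_prod_range_numWeights h1).comp measurable_snd)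
  rw [expMoment_smoothingStep, lintegral_map' hm.aemeasurable hCT]

/-- Integrate `exp(s x) ≥ 1 + s x`; the linear term has mean zero. -/
lemma one_le_expMoment {ν : Measure ℝ} [IsProbabilityMeasure ν]
    (hint : Integrable (fun x => x) ν) (hmean : ∫ x, x ∂ν = 0) (s : ℝ) : 1 ≤ expMoment ν s := by
  have h1 : ∫ x, (1 + s * x) ∂ν = 1 := by
    rw [integral_add (integrable_const 1) (hint.const_mul s), integral_const_mul, hmean]
    simp
  by_cases htop : expMoment ν s = ∞
  · simp [htop]
  have hi : Integrable (fun x => Real.exp (s * x)) ν := ⟨by fun_prop,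
    (hasFiniteIntegral_iff_ofReal (ae_of_all _ fun _ => (Real.exp_pos _).le)).2
      (lt_top_iff_ne_top.2 htop)⟩
  rw [expMoment, ← ofReal_integral_eq_lintegral_ofReal hi (ae_of_all _ fun _ => (Real.exp_pos _).le),
    ENNReal.one_le_ofReal, ← h1]
  refine integral_mono ((integrable_const 1).add (hint.const_mul s)) hi fun x => ?_
  have := Real.add_one_le_exp (s * x)
  simp only
  linarith

lemma expMoment_lt_top_iff {Ω : Type*} [MeasurableSpace Ω] {P : Measure Ω} {X : Ω → ℝ}
    (hX : AEMeasurable X P) (s : ℝ) : expMoment (P.map X) s < ∞ ↔ s ∈ integrableExpSet X P := by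
  rw [expMoment, lintegral_map' (by fun_prop) hX, integrableExpSet, Set.mem_ofPred_eq,
    Integrable, hasFiniteIntegral_iff_ofReal (ae_of_all _ fun _ => (Real.exp_pos _).le)]
  exact ⟨fun h => ⟨by fun_prop, h⟩, fun h => h.2⟩

/-- The pointwise properties of the weights: ordering, bounds, and separation. -/
structure Admissible (β δ S : ℝ) (t : ℕ → ℝ) : Prop where
  ordered : IsOrdered t
  abs_le_one : ∀ k, |t k| ≤ 1
  neg_le_last : -β ≤ lastWeight t
  sq_le : powerSum 2 t ≤ S
  upper : ∀ k, 1 ≤ k → k < numWeights t → t k ≤ 1 - δ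
  lower : ∀ k, k + 1 < numWeights t → -β * (1 - δ) ≤ t k
  excl : ¬(firstWeight t > 1 - δ ∧ lastWeight t < -β * (1 - δ))
  first_eq : firstWeight t = 1 → numWeights t < 2
  last_eq : lastWeight t = -β → numWeights t < 2

namespace Admissible

variable {β δ S : ℝ} {t : ℕ → ℝ}

lemma numWeights_pos_of_first_ne (h : Admissible β δ S t) (h0 : firstWeight t ≠ 0) :
    0 < numWeights t := by
  by_contra hn
  exact h0 (h.ordered.2.1 0 (by omega))

lemma numWeights_eq_one_of_first (h : Admissible β δ S t) (h1 : firstWeight t = 1) :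
    numWeights t = 1 := by
  have := h.numWeights_pos_of_first_ne (by rw [h1]; exact one_ne_zero)
  have := h.first_eq h1
  omega

lemma numWeights_eq_one_of_last (h : Admissible β δ S t) (hβ : 0 < β)
    (h1 : lastWeight t = -β) : numWeights t = 1 := by
  have h2 := h.last_eq h1
  have h3 : numWeights t ≠ 0 := fun h0 => by
    rw [lastWeight, if_pos h0] at h1
    linarith
  omega

end Admissible

/-! ### Necessary conditions for a solution of the functional equation to be finite -/

section Necessity

variable {Ω : Type*} [MeasurableSpace Ω] {P : Measure Ω}
  {C : Ω → ℝ} {T : Ω → ℕ → ℝ} {β δ S : ℝ} {Ψ : ℝ → ℝ≥0∞}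

lemma aemeasurable_firstWeight (hT : AEMeasurable T P) :
    AEMeasurable (fun ω => firstWeight (T ω)) P :=
  (measurable_pi_apply 0).comp_aemeasurable hT

lemma aemeasurable_lastWeight (hT : AEMeasurable T P) :
    AEMeasurable (fun ω => lastWeight (T ω)) P :=
  measurable_lastWeight.comp_aemeasurable hT

lemma nullMeasurableSet_first (hT : AEMeasurable T P) (c : ℝ) :
    NullMeasurableSet {ω | firstWeight (T ω) = c} P :=
  (aemeasurable_firstWeight hT).nullMeasurableSet_preimage (measurableSet_singleton c)

lemma nullMeasurableSet_last (hT : AEMeasurable T P) (c : ℝ) :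
    NullMeasurableSet {ω | lastWeight (T ω) = c} P :=
  (aemeasurable_lastWeight hT).nullMeasurableSet_preimage (measurableSet_singleton c)

lemma ofReal_setIntegral_exp {s : ℝ} (hs : s ∈ integrableExpSet C P) (A : Set Ω) :
    ENNReal.ofReal (∫ ω in A, Real.exp (s * C ω) ∂P) =
      ∫⁻ ω in A, ENNReal.ofReal (Real.exp (s * C ω)) ∂P :=
  ofReal_integral_eq_lintegral_ofReal (Integrable.integrableOn hs)
    (ae_of_all _ fun _ => (Real.exp_pos _).le)

lemma mem_integrableExpSet_of_lintegral (hC : AEMeasurable C P) {s : ℝ}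
    (h : ∫⁻ ω, ENNReal.ofReal (Real.exp (s * C ω)) ∂P < ∞) : s ∈ integrableExpSet C P :=
  ⟨by fun_prop, (hasFiniteIntegral_iff_ofReal (ae_of_all _ fun _ => (Real.exp_pos _).le)).2 h⟩

lemma setLIntegral_exp_pos (hC : AEMeasurable C P) (s : ℝ) {A : Set Ω} (hA : P A ≠ 0) :
    0 < ∫⁻ ω in A, ENNReal.ofReal (Real.exp (s * C ω)) ∂P := by
  rw [pos_iff_ne_zero]
  intro h
  rw [lintegral_eq_zero_iff' (by fun_prop)] at h
  have h2 : ∀ᵐ ω ∂(P.restrict A), False := h.mono fun ω hω => by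
    simp only [Pi.zero_apply, ENNReal.ofReal_eq_zero] at hω
    exact absurd hω (not_le.2 (Real.exp_pos _))
  rw [eventually_false_iff_eq_bot, ae_eq_bot, Measure.restrict_eq_zero] at h2
  exact hA h2

lemma lintegral_exp_le_of_functional_eq (hΨ1 : ∀ s, 1 ≤ Ψ s)
    (hΨ : ∀ s, Ψ s = ∫⁻ ω, ENNReal.ofReal (Real.exp (s * C ω)) *
        ∏ k ∈ Finset.range (numWeights (T ω)), Ψ (s * T ω k) ∂P) (s : ℝ) :
    ∫⁻ ω, ENNReal.ofReal (Real.exp (s * C ω)) ∂P ≤ Ψ s := by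
  rw [hΨ s]
  exact lintegral_mono fun ω => le_mul_of_one_le_right zero_le
    (Finset.one_le_prod' fun k _ => hΨ1 _)

/-- The lower bound for a solution of the functional equation that comes from the events
`T_1 = 1`, `T_N = -β` and their complement. -/
lemma lintegral_add_le_of_functional_eq (hC : AEMeasurable C P) (hT : AEMeasurable T P)
    (hβ : 0 < β) (hadm : ∀ᵐ ω ∂P, Admissible β δ S (T ω)) (hΨ1 : ∀ s, 1 ≤ Ψ s)
    (hΨ : ∀ s, Ψ s = ∫⁻ ω, ENNReal.ofReal (Real.exp (s * C ω)) *
        ∏ k ∈ Finset.range (numWeights (T ω)), Ψ (s * T ω k) ∂P) (s : ℝ) :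
    (∫⁻ ω in {ω | firstWeight (T ω) = 1}, ENNReal.ofReal (Real.exp (s * C ω)) ∂P) * Ψ s +
    (∫⁻ ω in {ω | lastWeight (T ω) = -β}, ENNReal.ofReal (Real.exp (s * C ω)) ∂P) * Ψ (-β * s) +
    ∫⁻ ω in ({ω | firstWeight (T ω) = 1} ∪ {ω | lastWeight (T ω) = -β})ᶜ,
      ENNReal.ofReal (Real.exp (s * C ω)) ∂P ≤ Ψ s := by
  have hA := nullMeasurableSet_first hT 1
  have hB := nullMeasurableSet_last hT (-β)
  set A := {ω | firstWeight (T ω) = 1} with hAdef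
  set B := {ω | lastWeight (T ω) = -β} with hBdef
  have hexp : AEMeasurable (fun ω => ENNReal.ofReal (Real.exp (s * C ω))) P := by fun_prop
  rw [← lintegral_indicator₀ hA, ← lintegral_indicator₀ hB, ← lintegral_indicator₀ (hA.union hB).compl,
    ← lintegral_mul_const'' _ (hexp.indicator₀ hA), ← lintegral_mul_const'' _ (hexp.indicator₀ hB),
    ← lintegral_add_left' ((hexp.indicator₀ hA).mul_const _),
    ← lintegral_add_right' _ (hexp.indicator₀ (hA.union hB).compl)]
  refine le_of_le_of_eq ?_ (hΨ s).symm
  refine lintegral_mono_ae (hadm.mono fun ω h => ?_)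
  have hprod : (1 : ℝ≥0∞) ≤ ∏ k ∈ Finset.range (numWeights (T ω)), Ψ (s * T ω k) :=
    Finset.one_le_prod' fun k _ => hΨ1 _
  by_cases h1 : ω ∈ A
  · have hN := h.numWeights_eq_one_of_first h1
    -- Here `N = 1`, so the first weight is also the last, and `1 ≠ -β`.
    have h2 : ω ∉ B := by
      intro h2
      have h1' : T ω 0 = 1 := h1
      have h2' : lastWeight (T ω) = -β := h2
      simp only [lastWeight, hN, one_ne_zero, if_false, tsub_self] at h2'
      linarith
    have h1' : T ω 0 = 1 := h1
    simp [h1, h2, hN, h1']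
  · by_cases h2 : ω ∈ B
    · have hN := h.numWeights_eq_one_of_last hβ h2
      have h2' : lastWeight (T ω) = -β := h2
      simp only [lastWeight, hN, one_ne_zero, if_false, tsub_self] at h2'
      simp [h1, h2, hN, h2', mul_comm]
    · simp only [h1, h2, Set.indicator_of_notMem, not_false_eq_true, zero_mul, zero_add,
        Set.indicator_of_mem, Set.mem_compl_iff, Set.mem_union, or_self]
      exact le_mul_of_one_le_right zero_le hprod

/-- Finiteness propagates from `s` to `-β s` if `T_N = -β` has positive probability. -/
lemma lt_top_neg_of_functional_eq (hC : AEMeasurable C P) (hT : AEMeasurable T P)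
    (hβ : 0 < β) (hadm : ∀ᵐ ω ∂P, Admissible β δ S (T ω)) (hΨ1 : ∀ s, 1 ≤ Ψ s)
    (hΨ : ∀ s, Ψ s = ∫⁻ ω, ENNReal.ofReal (Real.exp (s * C ω)) *
        ∏ k ∈ Finset.range (numWeights (T ω)), Ψ (s * T ω k) ∂P)
    (hP : 0 < P {ω | lastWeight (T ω) = -β}) {s : ℝ} (hs : Ψ s < ∞) : Ψ (-β * s) < ∞ := by
  have hmain := lintegral_add_le_of_functional_eq hC hT hβ hadm hΨ1 hΨ s
  have h1 := (le_add_self.trans le_self_add).trans hmain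
  have h2 := setLIntegral_exp_pos hC s hP.ne'
  exact ENNReal.lt_top_of_mul_ne_top_right (h1.trans_lt hs).ne h2.ne'

variable [IsProbabilityMeasure P]

/-- Finiteness of the solution at `s` forces `s` into the domain of `C` and `a(s) < 1`. -/
lemma necessary_of_functional_eq (hC : AEMeasurable C P) (hT : AEMeasurable T P)
    (hβ : 0 < β) (hadm : ∀ᵐ ω ∂P, Admissible β δ S (T ω)) (hΨ1 : ∀ s, 1 ≤ Ψ s)
    (hΨ : ∀ s, Ψ s = ∫⁻ ω, ENNReal.ofReal (Real.exp (s * C ω)) *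
        ∏ k ∈ Finset.range (numWeights (T ω)), Ψ (s * T ω k) ∂P)
    (hP : P {ω | firstWeight (T ω) = 1} < 1) {s : ℝ} (hs : Ψ s < ∞) :
    s ∈ integrableExpSet C P ∧ ∫ ω in {ω | firstWeight (T ω) = 1}, Real.exp (s * C ω) ∂P < 1 := by
  have hdom : s ∈ integrableExpSet C P := mem_integrableExpSet_of_lintegral hC
    ((lintegral_exp_le_of_functional_eq hΨ1 hΨ s).trans_lt hs)
  refine ⟨hdom, ?_⟩
  by_contra hge
  have hge' : 1 ≤ ∫⁻ ω in {ω | firstWeight (T ω) = 1}, ENNReal.ofReal (Real.exp (s * C ω)) ∂P := by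
    rw [← ofReal_setIntegral_exp hdom]
    exact ENNReal.one_le_ofReal.2 (not_lt.1 hge)
  have hmain := lintegral_add_le_of_functional_eq hC hT hβ hadm hΨ1 hΨ s
  rw [add_assoc] at hmain
  -- Cancelling the finite `Ψ(s)` forces both remaining terms to vanish. All mass then lies on `T_1
  -- = 1`, which was excluded.
  have h1 : Ψ s + _ ≤ Ψ s + 0 :=
    (add_le_add_left (le_mul_of_one_le_left zero_le hge') _).trans
      (hmain.trans_eq (add_zero _).symm)
  have h2 := (ENNReal.add_le_add_iff_left hs.ne).1 h1
  rw [nonpos_iff_eq_zero, add_eq_zero, mul_eq_zero] at h2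
  have hB : P {ω | lastWeight (T ω) = -β} = 0 := by
    by_contra hne
    rcases h2.1 with h | h
    · exact (setLIntegral_exp_pos hC s hne).ne' h
    · have := hΨ1 (-β * s)
      rw [h] at this
      exact absurd this (by simp)
  have hrest : P ({ω | firstWeight (T ω) = 1} ∪ {ω | lastWeight (T ω) = -β})ᶜ = 0 := by
    by_contra hne
    exact (setLIntegral_exp_pos hC s hne).ne' h2.2
  refine hP.ne ((prob_compl_eq_zero_iff₀ (nullMeasurableSet_first hT 1)).1 ?_)
  refine measure_mono_null (t := ({ω | firstWeight (T ω) = 1} ∪ {ω | lastWeight (T ω) = -β})ᶜ ∪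
    {ω | lastWeight (T ω) = -β}) ?_ (measure_union_null hrest hB)
  intro ω hω
  by_cases h : lastWeight (T ω) = -β
  · exact Or.inr h
  · exact Or.inl fun h' => h'.elim hω h

/-- Strictness comes from the event where neither extreme value is taken: it has positive
probability, so its contribution is positive. -/
lemma mul_lt_mul_of_functional_eq (hC : AEMeasurable C P) (hT : AEMeasurable T P)
    (hadm : ∀ᵐ ω ∂P, Admissible 1 δ S (T ω)) (hΨ1 : ∀ s, 1 ≤ Ψ s)
    (hΨ : ∀ s, Ψ s = ∫⁻ ω, ENNReal.ofReal (Real.exp (s * C ω)) *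
        ∏ k ∈ Finset.range (numWeights (T ω)), Ψ (s * T ω k) ∂P)
    (hP : P ({ω | firstWeight (T ω) = 1} ∪ {ω | lastWeight (T ω) = -1}) < 1) {s : ℝ}
    (hs : Ψ s < ∞) (hs' : Ψ (-s) < ∞) (hd : s ∈ integrableExpSet C P) :
    (∫ ω in {ω | lastWeight (T ω) = -1}, Real.exp (s * C ω) ∂P) * (Ψ (-s)).toReal <
      (1 - ∫ ω in {ω | firstWeight (T ω) = 1}, Real.exp (s * C ω) ∂P) * (Ψ s).toReal := by
  have hmain := lintegral_add_le_of_functional_eq hC hT one_pos hadm hΨ1 hΨ s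
  have hne : P ({ω | firstWeight (T ω) = 1} ∪ {ω | lastWeight (T ω) = -1})ᶜ ≠ 0 := by
    intro h
    exact hP.ne ((prob_compl_eq_zero_iff₀
      ((nullMeasurableSet_first hT 1).union (nullMeasurableSet_last hT (-1)))).1 h)
  have hpos := setLIntegral_exp_pos hC s hne
  rw [← ofReal_setIntegral_exp hd, ← ofReal_setIntegral_exp hd, ← ofReal_setIntegral_exp hd,
    neg_one_mul] at hmain
  rw [← ofReal_setIntegral_exp hd, ENNReal.ofReal_pos] at hpos
  have h2 := ENNReal.toReal_mono hs.ne hmain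
  have hnn : ∀ A : Set Ω, 0 ≤ ∫ ω in A, Real.exp (s * C ω) ∂P := fun A =>
    integral_nonneg fun _ => (Real.exp_pos _).le
  rw [ENNReal.toReal_add (by finiteness) (by finiteness),
    ENNReal.toReal_add (by finiteness) (by finiteness), ENNReal.toReal_mul, ENNReal.toReal_mul,
    ENNReal.toReal_ofReal (hnn _), ENNReal.toReal_ofReal (hnn _),
    ENNReal.toReal_ofReal (hnn _)] at h2
  linarith

end Necessity

/-! ### A Gaussian bound near the origin -/

lemma exp_le_one_add_add_sq_mul_exp_abs (x : ℝ) :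
    Real.exp x ≤ 1 + x + x ^ 2 * Real.exp |x| := by
  have h0 : 0 ≤ x ^ 2 := sq_nonneg x
  have h1 : 1 ≤ Real.exp |x| := Real.one_le_exp (abs_nonneg x)
  rcases le_or_gt |x| 1 with h | h
  · have := (abs_le.1 (Real.abs_exp_sub_one_sub_id_le h)).2
    nlinarith
  · rcases le_or_gt 0 x with hx | hx
    · rw [abs_of_nonneg hx] at h ⊢
      have h2 : (x ^ 2 - 1) * Real.exp x ≥ 0 :=
        mul_nonneg (by nlinarith) (Real.exp_pos x).le
      nlinarith
    · rw [abs_of_neg hx] at h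
      have h2 : Real.exp x ≤ 1 := Real.exp_le_one_iff.2 hx.le
      nlinarith

/-- Second-order expansion with a remainder that is integrable when `z` is replaced by `C`. The
factor `|z| ^ 0` puts both remainder terms into one family of moments. -/
lemma exp_le_of_abs_sub_one_le {K s z v R c : ℝ} (hK0 : 0 ≤ K) (hZ : |v - 1| ≤ R) (hsc : |s| ≤ c)
    (hq1 : K * s ^ 2 * R ≤ 1) :
    Real.exp (s * z + K * s ^ 2 * (v - 1)) ≤ 1 + (s * z + K * s ^ 2 * (v - 1)) +
      (2 * Real.exp 1 * s ^ 2 * (|z| ^ 2 * Real.exp (c * |z|)) +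
        2 * Real.exp 1 * K ^ 2 * s ^ 4 * R ^ 2 * (|z| ^ 0 * Real.exp (c * |z|))) := by
  set x := s * z + K * s ^ 2 * (v - 1) with hx
  have hx2 : x ^ 2 ≤ 2 * s ^ 2 * |z| ^ 2 + 2 * K ^ 2 * s ^ 4 * R ^ 2 := by
    have h3 : (v - 1) ^ 2 ≤ R ^ 2 := sq_le_sq' (abs_le.1 hZ).1 (abs_le.1 hZ).2
    have h4 : x ^ 2 ≤ 2 * (s * z) ^ 2 + 2 * (K * s ^ 2 * (v - 1)) ^ 2 := by
      nlinarith [sq_nonneg (s * z - K * s ^ 2 * (v - 1))]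
    have h5 : K ^ 2 * s ^ 4 * (v - 1) ^ 2 ≤ K ^ 2 * s ^ 4 * R ^ 2 := by gcongr
    rw [sq_abs]
    nlinarith
  have hxa : |x| ≤ c * |z| + 1 := by
    calc |x| ≤ |s * z| + |K * s ^ 2 * (v - 1)| := abs_add_le _ _
      _ = |s| * |z| + K * s ^ 2 * |v - 1| := by
        rw [abs_mul, abs_mul, abs_of_nonneg (by positivity : 0 ≤ K * s ^ 2)]
      _ ≤ c * |z| + K * s ^ 2 * R := by gcongr
      _ ≤ _ := by linarith
  have h6 : Real.exp |x| ≤ Real.exp 1 * Real.exp (c * |z|) := by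
    rw [← Real.exp_add]
    exact Real.exp_le_exp.2 (by linarith)
  have h7 : x ^ 2 * Real.exp |x| ≤ (2 * s ^ 2 * |z| ^ 2 + 2 * K ^ 2 * s ^ 4 * R ^ 2) *
      (Real.exp 1 * Real.exp (c * |z|)) := by gcongr
  have h8 := exp_le_one_add_add_sq_mul_exp_abs x
  rw [pow_zero]
  linarith

section Small

variable {Ω : Type*} [MeasurableSpace Ω] {P : Measure Ω} [IsProbabilityMeasure P] {C : Ω → ℝ}

/-- After division by `exp(K s²)` the exponent has mean `-K s² (1 - E V) ≤ 0`. For `K` large and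
then `s` small this drift pays for the remainder of the expansion. With `V = Σ_2` it is the
induction step for Gaussian bounds. -/
lemma exists_gaussian_bound {s₁ : ℝ} (hs₁ : 0 < s₁)
    (hpos : s₁ ∈ integrableExpSet C P) (hneg : -s₁ ∈ integrableExpSet C P)
    (hmean : ∫ ω, C ω ∂P = 0) {V : Ω → ℝ} (hV : AEMeasurable V P) {S : ℝ}
    (hV0 : ∀ᵐ ω ∂P, 0 ≤ V ω) (hVS : ∀ᵐ ω ∂P, V ω ≤ S) (hV1 : ∫ ω, V ω ∂P < 1) :
    ∃ K s₀ : ℝ, 0 ≤ K ∧ 0 < s₀ ∧ ∀ s, |s| ≤ s₀ →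
      ∫⁻ ω, ENNReal.ofReal (Real.exp (s * C ω + K * s ^ 2 * V ω)) ∂P ≤
        ENNReal.ofReal (Real.exp (K * s ^ 2)) := by
  set c := s₁ / 2 with hc
  have hc0 : 0 < c := by positivity
  have hpos' : Integrable (fun ω => Real.exp ((0 + s₁) * C ω)) P := by rwa [zero_add]
  have hneg' : Integrable (fun ω => Real.exp ((0 - s₁) * C ω)) P := by rwa [zero_sub]
  have hint : ∀ n : ℕ, Integrable (fun ω => |C ω| ^ n * Real.exp (c * |C ω|)) P := fun n => by
    have h := integrable_pow_abs_mul_exp_add_of_integrable_exp_mul (X := C) (μ := P) (v := 0)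
      (t := s₁) (x := c) hpos' hneg' hc0.le
      (by rw [abs_of_pos hs₁]; linarith) n
    simpa using h
  have hCint : Integrable C P := by
    have h := integrable_pow_of_integrable_exp_mul hs₁.ne' hpos hneg 1
    simpa using h
  have hVint : Integrable V P := by
    refine Integrable.of_bound hV.aestronglyMeasurable S ?_
    filter_upwards [hV0, hVS] with ω h1 h2
    rwa [Real.norm_of_nonneg h1]
  set J₁ := ∫ ω, |C ω| ^ 2 * Real.exp (c * |C ω|) ∂P with hJ₁
  set J₂ := ∫ ω, |C ω| ^ 0 * Real.exp (c * |C ω|) ∂P with hJ₂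
  have hJ₁0 : 0 ≤ J₁ := integral_nonneg fun ω => by positivity
  have hJ₂0 : 0 ≤ J₂ := integral_nonneg fun ω => by positivity
  set η := 1 - ∫ ω, V ω ∂P with hη
  have hη0 : 0 < η := by linarith
  set R := |S| + 1 with hR
  have hR1 : 1 ≤ R := by linarith [abs_nonneg S]
  set e := Real.exp 1 with he
  have he0 : 0 < e := Real.exp_pos 1
  -- This choice lets the `s²` part of the remainder use exactly half of the drift `K η s²`.
  set K := 4 * e * J₁ / η with hK
  have hK0 : 0 ≤ K := by positivity
  have hKη : 2 * e * J₁ = K * η / 2 := by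
    rw [hK]; field_simp; ring
  -- The first bound gives `K s² R ≤ 1`, as the expansion requires; the second fits the `s⁴` part
  -- into the other half of the drift. Adding `1` keeps the denominators positive.
  set q := min (1 / (K * R + 1)) (η / (4 * e * K * R ^ 2 * J₂ + 1)) with hq
  have hq0 : 0 < q := by positivity
  refine ⟨K, min (min c 1) q, hK0, by positivity, fun s hs => ?_⟩
  have hsc : |s| ≤ c := hs.trans ((min_le_left _ _).trans (min_le_left _ _))
  have hs1 : |s| ≤ 1 := hs.trans ((min_le_left _ _).trans (min_le_right _ _))
  have hsq : s ^ 2 ≤ q := by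
    rw [← sq_abs]
    have h1 : |s| ≤ q := hs.trans (min_le_right _ _)
    nlinarith [abs_nonneg s]
  have hq1 : K * s ^ 2 * R ≤ 1 := by
    have h1 : s ^ 2 ≤ 1 / (K * R + 1) := hsq.trans (min_le_left _ _)
    rw [le_div_iff₀ (by positivity)] at h1
    nlinarith [sq_nonneg s]
  have hq2 : 4 * e * K * R ^ 2 * J₂ * s ^ 2 ≤ η := by
    have h1 : s ^ 2 ≤ η / (4 * e * K * R ^ 2 * J₂ + 1) := hsq.trans (min_le_right _ _)
    rw [le_div_iff₀ (by positivity)] at h1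
    nlinarith [sq_nonneg s]
  set B : Ω → ℝ := fun ω => 1 + (s * C ω + K * s ^ 2 * (V ω - 1)) +
    (2 * e * s ^ 2 * (|C ω| ^ 2 * Real.exp (c * |C ω|)) +
      2 * e * K ^ 2 * s ^ 4 * R ^ 2 * (|C ω| ^ 0 * Real.exp (c * |C ω|))) with hB
  have hVi : Integrable (fun ω => K * s ^ 2 * (V ω - 1)) P :=
    (hVint.sub (integrable_const 1)).const_mul _
  have hVC : Integrable (fun ω => s * C ω + K * s ^ 2 * (V ω - 1)) P := (hCint.const_mul s).add hVi
  have hBint : Integrable B P :=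
    ((integrable_const 1).add hVC).add (((hint 2).const_mul _).add ((hint 0).const_mul _))
  have hpt : ∀ᵐ ω ∂P, Real.exp (s * C ω + K * s ^ 2 * (V ω - 1)) ≤ B ω := by
    filter_upwards [hV0, hVS] with ω h1 h2
    have hZ : |V ω - 1| ≤ R := by
      rw [abs_le]
      constructor
      · linarith [abs_nonneg S]
      · linarith [le_abs_self S]
    exact exp_le_of_abs_sub_one_le hK0 hZ hsc hq1
  have hBle : ∫ ω, B ω ∂P ≤ 1 := by
    have h1 : ∫ ω, B ω ∂P = 1 + (s * 0 + K * s ^ 2 * (-η)) +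
        (2 * e * s ^ 2 * J₁ + 2 * e * K ^ 2 * s ^ 4 * R ^ 2 * J₂) := by
      have e₁ : ∫ ω, K * s ^ 2 * (V ω - 1) ∂P = K * s ^ 2 * (-η) := by
        rw [integral_const_mul, integral_sub hVint (integrable_const _)]
        simp [hη]
      have e₂ : ∫ ω, (s * C ω + K * s ^ 2 * (V ω - 1)) ∂P = s * 0 + K * s ^ 2 * (-η) := by
        rw [integral_add (hCint.const_mul s) hVi, e₁,
          integral_const_mul, hmean]
      have e₃ : ∫ ω, (1 + (s * C ω + K * s ^ 2 * (V ω - 1))) ∂P =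
          1 + (s * 0 + K * s ^ 2 * (-η)) := by
        rw [integral_add (integrable_const 1) hVC, e₂]
        simp
      rw [hJ₁, hJ₂, ← e₃, ← integral_const_mul, ← integral_const_mul,
        ← integral_add ((hint 2).const_mul _) ((hint 0).const_mul _)]
      exact integral_add ((integrable_const 1).add hVC)
        (((hint 2).const_mul _).add ((hint 0).const_mul _))
    rw [h1]
    have h2 : 2 * e * K ^ 2 * s ^ 4 * R ^ 2 * J₂ ≤ K * s ^ 2 * η / 2 := by
      have h3 : K * s ^ 2 * (4 * e * K * R ^ 2 * J₂ * s ^ 2) ≤ K * s ^ 2 * η :=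
        mul_le_mul_of_nonneg_left hq2 (by positivity)
      nlinarith
    have h4 : 2 * e * s ^ 2 * J₁ = K * s ^ 2 * η / 2 := by
      linear_combination s ^ 2 * hKη
    linarith
  have hfac : ∀ ω, ENNReal.ofReal (Real.exp (s * C ω + K * s ^ 2 * V ω)) =
      ENNReal.ofReal (Real.exp (K * s ^ 2)) *
        ENNReal.ofReal (Real.exp (s * C ω + K * s ^ 2 * (V ω - 1))) := fun ω => by
    rw [← ENNReal.ofReal_mul (Real.exp_pos _).le, ← Real.exp_add]
    ring_nf
  simp_rw [hfac]
  rw [lintegral_const_mul' _ _ ENNReal.ofReal_ne_top]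
  refine mul_le_of_le_one_right zero_le ?_
  calc _ ≤ ∫⁻ ω, ENNReal.ofReal (B ω) ∂P :=
        lintegral_mono_ae (hpt.mono fun ω h => ENNReal.ofReal_le_ofReal h)
    _ = ENNReal.ofReal (∫ ω, B ω ∂P) := (ofReal_integral_eq_lintegral_ofReal hBint
        (hpt.mono fun ω h => (Real.exp_pos _).le.trans h)).symm
    _ ≤ 1 := by rwa [ENNReal.ofReal_le_one]

lemma prod_ofReal_exp_sq (t : ℕ → ℝ) (κ : ℝ) (N : ℕ) :
    ∏ k ∈ Finset.range N, ENNReal.ofReal (Real.exp (κ * t k ^ 2)) =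
      ENNReal.ofReal (Real.exp (κ * ∑ k ∈ Finset.range N, t k ^ 2)) := by
  rw [Finset.mul_sum, Real.exp_sum, ENNReal.ofReal_prod_of_nonneg fun _ _ => (Real.exp_pos _).le]

lemma powerSum_two (t : ℕ → ℝ) : powerSum 2 t = ∑ k ∈ Finset.range (numWeights t), t k ^ 2 := by
  simp [powerSum]

lemma powerSum_nonneg (p : ℝ) (t : ℕ → ℝ) : 0 ≤ powerSum p t :=
  Finset.sum_nonneg fun _ _ => by positivity

/-- The iterates of the functional equation are bounded by a Gaussian near the origin. -/
lemma exists_gaussian_bound_iterates {T : Ω → ℕ → ℝ} {β δ S : ℝ} (hT : AEMeasurable T P)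
    (hadm : ∀ᵐ ω ∂P, Admissible β δ S (T ω)) {s₁ : ℝ} (hs₁ : 0 < s₁)
    (hpos : s₁ ∈ integrableExpSet C P) (hneg : -s₁ ∈ integrableExpSet C P)
    (hmean : ∫ ω, C ω ∂P = 0) (hV1 : ∫ ω, powerSum 2 (T ω) ∂P < 1) {Ψ : ℕ → ℝ → ℝ≥0∞}
    (hΨ0 : ∀ s, Ψ 0 s = 1)
    (hΨ : ∀ n s, Ψ (n + 1) s = ∫⁻ ω, ENNReal.ofReal (Real.exp (s * C ω)) *
        ∏ k ∈ Finset.range (numWeights (T ω)), Ψ n (s * T ω k) ∂P) :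
    ∃ K s₀ : ℝ, 0 ≤ K ∧ 0 < s₀ ∧ ∀ n s, |s| ≤ s₀ →
      Ψ n s ≤ ENNReal.ofReal (Real.exp (K * s ^ 2)) := by
  obtain ⟨K, s₀, hK, hs₀, h⟩ := exists_gaussian_bound hs₁ hpos hneg hmean
    ((measurable_powerSum 2).comp_aemeasurable hT) (S := S)
    (ae_of_all _ fun ω => powerSum_nonneg 2 (T ω)) (hadm.mono fun ω h => h.sq_le) hV1
  refine ⟨K, s₀, hK, hs₀, fun n => ?_⟩
  induction n with
  | zero =>
    intro s _
    rw [hΨ0]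
    exact ENNReal.one_le_ofReal.2 (Real.one_le_exp (by positivity))
  | succ n ih =>
    intro s hs
    rw [hΨ]
    refine le_trans (lintegral_mono_ae (hadm.mono fun ω hω => ?_)) (h s hs)
    have h1 : ∏ k ∈ Finset.range (numWeights (T ω)), Ψ n (s * T ω k) ≤
        ∏ k ∈ Finset.range (numWeights (T ω)),
          ENNReal.ofReal (Real.exp (K * s ^ 2 * T ω k ^ 2)) := by
      refine Finset.prod_le_prod' fun k _ => ?_
      have h2 := ih (s * T ω k) (by
        rw [abs_mul]
        exact (mul_le_of_le_one_right (abs_nonneg s) (hω.abs_le_one k)).trans hs)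
      rwa [mul_pow, ← mul_assoc] at h2
    rw [prod_ofReal_exp_sq, ← powerSum_two] at h1
    rw [Real.exp_add, ENNReal.ofReal_mul (Real.exp_pos _).le]
    gcongr
    exact h1

end Small

/-! ### Extension of exponential bounds away from the origin -/

namespace Admissible

variable {β δ S : ℝ} {t : ℕ → ℝ}

lemma prod_le_of_subset (h : Admissible β δ S t) {Ψ : ℝ → ℝ≥0∞} {κ M s : ℝ} (hκ : 0 ≤ κ)
    (hM : Real.exp (κ * S) ≤ M) {F : Finset ℕ} (hF : F ⊆ Finset.range (numWeights t))
    (hin : ∀ k ∈ F, Ψ (s * t k) ≤ ENNReal.ofReal (Real.exp (κ * t k ^ 2))) :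
    ∏ k ∈ F, Ψ (s * t k) ≤ ENNReal.ofReal M := by
  refine (Finset.prod_le_prod' hin).trans ?_
  rw [← ENNReal.ofReal_prod_of_nonneg fun _ _ => (Real.exp_pos _).le, ← Real.exp_sum,
    ← Finset.mul_sum]
  refine ENNReal.ofReal_le_ofReal (le_trans (Real.exp_le_exp.2 ?_) hM)
  refine mul_le_mul_of_nonneg_left ?_ hκ
  refine (Finset.sum_le_sum_of_subset_of_nonneg hF fun _ _ _ => sq_nonneg _).trans ?_
  rw [← powerSum_two]
  exact h.sq_le

/-- At most one weight lies close to `1` or to `-β`; the product over the others is bounded. -/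
lemma prod_cases (h : Admissible β δ S t) (hβ : 0 < β) (hδ1 : δ < 1) {Ψ : ℝ → ℝ≥0∞}
    {κ M s : ℝ} (hκ : 0 ≤ κ) (hM : Real.exp (κ * S) ≤ M)
    (hin : ∀ u, -β * (1 - δ) ≤ u → u ≤ 1 - δ →
      Ψ (s * u) ≤ ENNReal.ofReal (Real.exp (κ * u ^ 2))) :
    ∏ k ∈ Finset.range (numWeights t), Ψ (s * t k) ≤ ENNReal.ofReal M ∨
    (firstWeight t = 1 ∧ ∏ k ∈ Finset.range (numWeights t), Ψ (s * t k) = Ψ s) ∨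
    (1 - δ < firstWeight t ∧ firstWeight t < 1 ∧
      ∏ k ∈ Finset.range (numWeights t), Ψ (s * t k) ≤
        Ψ (s * firstWeight t) * ENNReal.ofReal M) ∨
    (lastWeight t = -β ∧ ∏ k ∈ Finset.range (numWeights t), Ψ (s * t k) = Ψ (s * -β)) ∨
    (-β < lastWeight t ∧ lastWeight t < -β * (1 - δ) ∧
      ∏ k ∈ Finset.range (numWeights t), Ψ (s * t k) ≤
        Ψ (s * lastWeight t) * ENNReal.ofReal M) := by
  have hsplit : ∀ j < numWeights t, (∀ k < numWeights t, k ≠ j → -β * (1 - δ) ≤ t k ∧ t k ≤ 1 - δ) →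
      ∏ k ∈ Finset.range (numWeights t), Ψ (s * t k) ≤ Ψ (s * t j) * ENNReal.ofReal M := by
    intro j hj hgood
    rw [← Finset.mul_prod_erase _ _ (Finset.mem_range.2 hj)]
    gcongr
    refine h.prod_le_of_subset hκ hM (Finset.erase_subset _ _) fun k hk => ?_
    have hk' := Finset.mem_erase.1 hk
    obtain ⟨h1, h2⟩ := hgood k (Finset.mem_range.1 hk'.2) hk'.1
    exact hin _ h1 h2
  have hneg : -β * (1 - δ) < 0 := by nlinarith
  by_cases hf : 1 - δ < firstWeight t
  · have hN := h.numWeights_pos_of_first_ne (by linarith)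
    by_cases hf1 : firstWeight t = 1
    · have hN1 := h.numWeights_eq_one_of_first hf1
      have h0 : t 0 = 1 := hf1
      exact Or.inr (Or.inl ⟨hf1, by simp [hN1, h0]⟩)
    · refine Or.inr (Or.inr (Or.inl ⟨hf,
        lt_of_le_of_ne ((le_abs_self _).trans (h.abs_le_one 0)) hf1, ?_⟩))
      refine hsplit 0 hN fun k hk hk0 => ⟨?_, h.upper k (by omega) hk⟩
      rcases lt_or_ge (k + 1) (numWeights t) with hlt | hge
      · exact h.lower k hlt
      -- The final index is not covered by `lower`; there the ban on simultaneous extremes is used.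
      · have hl : lastWeight t = t k := by
          rw [lastWeight, if_neg (by omega)]
          congr
          omega
        by_contra hcon
        exact h.excl ⟨hf, by rw [hl]; linarith⟩
  · by_cases hl : lastWeight t < -β * (1 - δ)
    · have hN : numWeights t ≠ 0 := fun h0 => by
        rw [lastWeight, if_pos h0] at hl
        linarith
      by_cases hl1 : lastWeight t = -β
      · have hN1 := h.numWeights_eq_one_of_last hβ hl1
        have h0 := hl1
        simp only [lastWeight, hN1, one_ne_zero, if_false, tsub_self] at h0
        exact Or.inr (Or.inr (Or.inr (Or.inl ⟨hl1, by simp [hN1, h0]⟩)))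
      · refine Or.inr (Or.inr (Or.inr (Or.inr ⟨lt_of_le_of_ne h.neg_le_last (Ne.symm hl1), hl, ?_⟩)))
        have hl2 : lastWeight t = t (numWeights t - 1) := by rw [lastWeight, if_neg hN]
        rw [hl2]
        refine hsplit _ (by omega) fun k hk hkn => ⟨h.lower k (by omega), ?_⟩
        rcases Nat.eq_zero_or_pos k with rfl | hk0
        · exact not_lt.1 hf
        · exact h.upper k hk0 hk
    · left
      refine h.prod_le_of_subset hκ hM subset_rfl fun k hk => ?_
      have hk' := Finset.mem_range.1 hk
      refine hin _ ?_ ?_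
      · refine (not_lt.1 hl).trans ?_
        rw [lastWeight, if_neg (by omega)]
        exact h.ordered.2.2 k _ (by omega) (by omega)
      · rcases Nat.eq_zero_or_pos k with rfl | hk0
        · exact not_lt.1 hf
        · exact h.upper k hk0 hk'

end Admissible

/-- The `m`-th powers of the extreme weights, normalised by their maximal absolute values `1` and
`β`, where these values are not attained. -/
def boundaryPower (β : ℝ) (m : ℕ) (t : ℕ → ℝ) : ℝ :=
  (if |firstWeight t| < 1 then |firstWeight t| ^ m else 0) +
    if |lastWeight t| < β then (|lastWeight t| / β) ^ m else 0

lemma boundaryPower_nonneg {β : ℝ} (hβ : 0 < β) (m : ℕ) (t : ℕ → ℝ) : 0 ≤ boundaryPower β m t := by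
  unfold boundaryPower
  split_ifs <;> positivity

lemma boundaryPower_le_two {β : ℝ} (hβ : 0 < β) (m : ℕ) (t : ℕ → ℝ) : boundaryPower β m t ≤ 2 := by
  have h1 : (if |firstWeight t| < 1 then |firstWeight t| ^ m else 0) ≤ 1 := by
    split_ifs with h
    · exact pow_le_one₀ (abs_nonneg _) h.le
    · exact zero_le_one
  have h2 : (if |lastWeight t| < β then (|lastWeight t| / β) ^ m else 0) ≤ 1 := by
    split_ifs with h
    · exact pow_le_one₀ (by positivity) ((div_le_one hβ).2 h.le)
    · exact zero_le_one
  unfold boundaryPower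
  linarith

lemma tendsto_boundaryPower {β : ℝ} (hβ : 0 < β) (t : ℕ → ℝ) :
    Tendsto (fun m => boundaryPower β m t) atTop (𝓝 0) := by
  rw [← add_zero (0 : ℝ)]
  refine Tendsto.add ?_ ?_
  · split_ifs with h
    · exact tendsto_pow_atTop_nhds_zero_of_lt_one (abs_nonneg _) h
    · exact tendsto_const_nhds
  · split_ifs with h
    · exact tendsto_pow_atTop_nhds_zero_of_lt_one (by positivity) ((div_lt_one hβ).2 h)
    · exact tendsto_const_nhds

lemma measurable_boundaryPower (β : ℝ) (m : ℕ) : Measurable (boundaryPower β m) := by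
  have h1 : Measurable firstWeight := measurable_pi_apply 0
  have h2 := measurable_lastWeight
  unfold boundaryPower
  refine Measurable.add ?_ ?_
  · exact Measurable.ite (measurableSet_lt (by fun_prop) measurable_const) (by fun_prop)
      measurable_const
  · exact Measurable.ite (measurableSet_lt (by fun_prop) measurable_const) (by fun_prop)
      measurable_const

section Extension

variable {β δ S θ₁ θ₂ γ r₀ r K M D A B : ℝ} {m : ℕ} {w₁ w₂ : ℝ → ℝ} {Ψ : ℝ → ℝ≥0∞}

/-- The pointwise bound of the product in the functional equation at `r θ₁`. The points
`-β r θ₁` are written as `γ r θ₂`. -/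
lemma Admissible.prod_le_envelope {t : ℕ → ℝ} (h : Admissible β δ S t) (hβ : 0 < β)
    (hδ0 : 0 < δ) (hδ1 : δ < 1) (hS : 0 ≤ S) (hr : 0 ≤ r) (hrr₀ : r ≤ r₀) (hr₀ : r₀ ≤ 1)
    (hγ0 : 0 ≤ γ) (hγ1 : γ ≤ 1) (hrel : -β * θ₁ = γ * θ₂) (hK : 0 ≤ K)
    (hM : Real.exp (K * θ₁ ^ 2 * S) ≤ M) (hD : 1 ≤ D) (hA : 1 ≤ A) (hB : 0 ≤ B)
    (hw₁ : ∀ x y, 0 ≤ x → x ≤ y → y ≤ 1 → w₁ x ≤ w₁ y) (hw₁1 : ∀ x, 0 ≤ x → x ≤ 1 → 1 ≤ w₁ x)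
    (hw₂0 : ∀ x, 0 ≤ x → x ≤ 1 → 0 ≤ w₂ x) (hw₂A : ∀ x, 0 ≤ x → x ≤ 1 → w₂ x ≤ A)
    (hin₁ : ∀ x, 0 ≤ x → x ≤ (1 - δ) * r₀ →
      Ψ (x * θ₁) ≤ ENNReal.ofReal (Real.exp (K * (x * θ₁) ^ 2)))
    (hin₂ : ∀ x, 0 ≤ x → x ≤ (1 - δ) * r₀ →
      Ψ (x * θ₂) ≤ ENNReal.ofReal (Real.exp (K * (x * θ₂) ^ 2)))
    (h₁ : ∀ x, 0 ≤ x → x ≤ r₀ → Ψ (x * θ₁) ≤ ENNReal.ofReal (D + B * x ^ m * w₁ x))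
    (h₂ : ∀ x, 0 ≤ x → x ≤ r₀ → Ψ (x * θ₂) ≤ ENNReal.ofReal (D + B * x ^ m * w₂ x)) :
    ∏ k ∈ Finset.range (numWeights t), Ψ (r * θ₁ * t k) ≤
      ENNReal.ofReal (M * D + B * r ^ m * w₁ r * (M * A * boundaryPower β m t) +
        (if firstWeight t = 1 then B * r ^ m * w₁ r else 0) +
        if lastWeight t = -β then B * (γ * r) ^ m * w₂ (γ * r) else 0) := by
  have hr1 : r ≤ 1 := hrr₀.trans hr₀
  have hγr : γ * r ≤ r := mul_le_of_le_one_left hr hγ1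
  have hγr0 : 0 ≤ γ * r := mul_nonneg hγ0 hr
  have hM1 : 1 ≤ M := (Real.one_le_exp (by positivity)).trans hM
  have hh0 := boundaryPower_nonneg hβ m t
  set G := B * r ^ m * w₁ r with hG
  have hw1 := hw₁1 r hr hr1
  have hG0 : 0 ≤ G := by positivity
  set G₂ := B * (γ * r) ^ m * w₂ (γ * r) with hG₂
  have hG₂0 : 0 ≤ G₂ := by
    have := hw₂0 (γ * r) hγr0 (hγr.trans hr1)
    positivity
  have hi1 : 0 ≤ (if firstWeight t = 1 then G else 0) := by split_ifs <;> simp [hG0]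
  have hi2 : 0 ≤ (if lastWeight t = -β then G₂ else 0) := by split_ifs <;> simp [hG₂0]
  have hp : 0 ≤ G * (M * A * boundaryPower β m t) := by positivity
  have hDM : D ≤ M * D := by nlinarith
  have hc := h.prod_cases hβ hδ1 (Ψ := Ψ) (κ := K * (r * θ₁) ^ 2) (M := M) (s := r * θ₁)
    (by positivity) ?_ ?_
  · rcases hc with hc | ⟨e, hc⟩ | ⟨e1, e2, hc⟩ | ⟨e, hc⟩ | ⟨e1, e2, hc⟩
    · refine hc.trans (ENNReal.ofReal_le_ofReal ?_)
      nlinarith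
    · rw [hc]
      refine (h₁ r hr hrr₀).trans (ENNReal.ofReal_le_ofReal ?_)
      rw [if_pos e]
      linarith
    · set u := firstWeight t with hu
      have hu0 : 0 ≤ u := by linarith
      have hur : u * r ≤ r := mul_le_of_le_one_left hr e2.le
      have h3 := h₁ (u * r) (by positivity) (hur.trans hrr₀)
      rw [show u * r * θ₁ = r * θ₁ * u by ring] at h3
      refine hc.trans ((mul_le_mul' h3 le_rfl).trans ?_)
      rw [← ENNReal.ofReal_mul' (by linarith)]
      refine ENNReal.ofReal_le_ofReal ?_
      have h4 : u ^ m ≤ boundaryPower β m t := by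
        have h5 : 0 ≤ if |lastWeight t| < β then (|lastWeight t| / β) ^ m else 0 := by
          split_ifs <;> positivity
        rw [boundaryPower, ← hu, abs_of_nonneg hu0, if_pos e2]
        linarith
      have h6 : B * (u * r) ^ m * w₁ (u * r) ≤ G * u ^ m := by
        rw [hG, mul_pow]
        have := hw₁ (u * r) r (by positivity) hur hr1
        calc B * (u ^ m * r ^ m) * w₁ (u * r) ≤ B * (u ^ m * r ^ m) * w₁ r := by gcongr
          _ = _ := by ring
      have h7 : G * u ^ m ≤ G * (A * boundaryPower β m t) := by
        refine mul_le_mul_of_nonneg_left (h4.trans (le_mul_of_one_le_left hh0 hA)) hG0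
      have h8 : (D + B * (u * r) ^ m * w₁ (u * r)) * M ≤
          (D + G * (A * boundaryPower β m t)) * M :=
        mul_le_mul_of_nonneg_right (by linarith) (by linarith)
      linarith
    · rw [hc, show r * θ₁ * -β = γ * r * θ₂ by linear_combination r * hrel]
      refine (h₂ (γ * r) hγr0 (hγr.trans hrr₀)).trans (ENNReal.ofReal_le_ofReal ?_)
      rw [if_pos e]
      linarith
    · set l := lastWeight t with hl
      have hl0 : l < 0 := by nlinarith
      -- The point `r θ₁ l` is `u γ r θ₂` with `u < 1`, so the trial bound at this child gains the
      -- factor `u^m`.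
      set u := |l| / β with hu
      have hu0 : 0 ≤ u := by positivity
      have hlβ : |l| < β := by rw [abs_of_neg hl0]; linarith
      have hu1 : u < 1 := (div_lt_one hβ).2 hlβ
      have hβu : β * u = -l := by
        rw [hu, abs_of_neg hl0]
        field_simp
      have hur : u * (γ * r) ≤ γ * r := mul_le_of_le_one_left hγr0 hu1.le
      have h3 := h₂ (u * (γ * r)) (by positivity) ((hur.trans hγr).trans hrr₀)
      rw [show u * (γ * r) * θ₂ = r * θ₁ * l by linear_combination -u * r * hrel - r * θ₁ * hβu]
        at h3
      refine hc.trans ((mul_le_mul' h3 le_rfl).trans ?_)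
      rw [← ENNReal.ofReal_mul' (by linarith)]
      refine ENNReal.ofReal_le_ofReal ?_
      have h4 : u ^ m ≤ boundaryPower β m t := by
        have h5 : 0 ≤ if |firstWeight t| < 1 then |firstWeight t| ^ m else 0 := by
          split_ifs <;> positivity
        rw [boundaryPower, ← hl, if_pos hlβ, ← hu]
        linarith
      have h6 : B * (u * (γ * r)) ^ m * w₂ (u * (γ * r)) ≤ B * r ^ m * w₁ r * (A * u ^ m) := by
        have h7 := hw₂A (u * (γ * r)) (by positivity) ((hur.trans hγr).trans hr1)
        have h8 : (u * (γ * r)) ^ m ≤ u ^ m * r ^ m := by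
          rw [← mul_pow]
          gcongr
        calc B * (u * (γ * r)) ^ m * w₂ (u * (γ * r)) ≤ B * (u * (γ * r)) ^ m * A := by gcongr
          _ ≤ B * (u ^ m * r ^ m) * A := by gcongr
          _ ≤ B * (u ^ m * r ^ m) * A * w₁ r := le_mul_of_one_le_right (by positivity) hw1
          _ = _ := by ring
      have h7 : B * r ^ m * w₁ r * (A * u ^ m) ≤ G * (A * boundaryPower β m t) := by
        rw [← hG]
        gcongr
      have h8 : (D + B * (u * (γ * r)) ^ m * w₂ (u * (γ * r))) * M ≤
          (D + G * (A * boundaryPower β m t)) * M :=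
        mul_le_mul_of_nonneg_right (by linarith) (by linarith)
      linarith
  · refine le_trans (Real.exp_le_exp.2 ?_) hM
    have h3 : (r * θ₁) ^ 2 ≤ θ₁ ^ 2 := by
      rw [mul_pow]
      exact mul_le_of_le_one_left (sq_nonneg _) (pow_le_one₀ hr hr1)
    gcongr
  · intro u hu1 hu2
    rcases le_or_gt 0 u with hu0 | hu0
    · have h3 := hin₁ (u * r) (by positivity) (by gcongr)
      rw [show u * r * θ₁ = r * θ₁ * u by ring] at h3
      rwa [mul_pow _ u, ← mul_assoc] at h3
    · set v := -u / β with hv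
      have hv0 : 0 ≤ v := div_nonneg (by linarith) hβ.le
      have hβv : β * v = -u := by
        rw [hv]
        field_simp
      have hv1 : v ≤ 1 - δ := by
        rw [hv, div_le_iff₀ hβ]
        linarith
      have h3 := hin₂ (v * (γ * r)) (by positivity) (by
        gcongr
        exact hγr.trans hrr₀)
      rw [show v * (γ * r) * θ₂ = r * θ₁ * u by linear_combination -v * r * hrel - r * θ₁ * hβv]
        at h3
      rwa [mul_pow _ u, ← mul_assoc] at h3

end Extension

section Extension

variable {Ω : Type*} [MeasurableSpace Ω] {P : Measure Ω} {C : Ω → ℝ} {T : Ω → ℕ → ℝ}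

lemma integrable_mul_boundaryPower {β : ℝ} (hβ : 0 < β) (hT : AEMeasurable T P) {E : Ω → ℝ}
    (hE : Integrable E P) (m : ℕ) : Integrable (fun ω => E ω * boundaryPower β m (T ω)) P := by
  refine hE.mul_bdd (c := 2)
    ((measurable_boundaryPower β m).comp_aemeasurable hT).aestronglyMeasurable ?_
  refine ae_of_all _ fun ω => ?_
  rw [Real.norm_of_nonneg (boundaryPower_nonneg hβ m _)]
  exact boundaryPower_le_two hβ m _

/-- Dominated convergence, possible since the extremal values are cut out of `boundaryPower`. This
makes non-attained extreme weights negligible without any moment assumption on their distance to `1`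
or `-β`. -/
lemma tendsto_integral_mul_boundaryPower {β : ℝ} (hβ : 0 < β) (hT : AEMeasurable T P) {E : Ω → ℝ}
    (hE : Integrable E P) :
    Tendsto (fun m => ∫ ω, E ω * boundaryPower β m (T ω) ∂P) atTop (𝓝 0) := by
  have h := tendsto_integral_of_dominated_convergence (F := fun m ω =>
    E ω * boundaryPower β m (T ω)) (f := fun _ => (0 : ℝ)) (μ := P) (fun ω => ‖E ω‖ * 2)
    (fun m => (integrable_mul_boundaryPower hβ hT hE m).1) (hE.norm.mul_const 2)
    (fun m => ae_of_all _ fun ω => ?_) (ae_of_all _ fun ω => ?_)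
  · simpa using h
  · rw [norm_mul, Real.norm_of_nonneg (boundaryPower_nonneg hβ m _)]
    exact mul_le_mul_of_nonneg_left (boundaryPower_le_two hβ m _) (norm_nonneg _)
  · simpa using (tendsto_boundaryPower hβ (T ω)).const_mul (E ω)

lemma integral_ite_mul_exp {s : ℝ} (hs : s ∈ integrableExpSet C P) {p : Ω → Prop}
    [DecidablePred p] (hp : NullMeasurableSet {ω | p ω} P) (G : ℝ) :
    Integrable (fun ω => Real.exp (s * C ω) * if p ω then G else 0) P ∧
    ∫ ω, Real.exp (s * C ω) * (if p ω then G else 0) ∂P =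
      (∫ ω in {ω | p ω}, Real.exp (s * C ω) ∂P) * G := by
  have h : (fun ω => Real.exp (s * C ω) * if p ω then G else 0) =
      {ω | p ω}.indicator fun ω => Real.exp (s * C ω) * G := by
    ext ω
    by_cases hω : p ω
    · rw [Set.indicator_of_mem (show ω ∈ {ω | p ω} from hω), if_pos hω]
    · rw [Set.indicator_of_notMem (show ω ∉ {ω | p ω} from hω), if_neg hω, mul_zero]
  rw [h]
  refine ⟨(Integrable.mul_const hs G).indicator₀ hp, ?_⟩
  rw [integral_indicator₀ hp, integral_mul_const]

/-- One of `θ c` and `-β θ c` is nonnegative, so the right side is at least `1`. It is an integrable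
majorant common to all `r` and both rays. -/
lemma exp_mul_le_exp_add_exp {β θ r : ℝ} (hβ : 0 < β) (hr0 : 0 ≤ r) (hr1 : r ≤ 1) (c : ℝ) :
    Real.exp (r * θ * c) ≤ Real.exp (θ * c) + Real.exp (-β * θ * c) ∧
    Real.exp (r * (-β * θ) * c) ≤ Real.exp (θ * c) + Real.exp (-β * θ * c) := by
  have key : ∀ y : ℝ, Real.exp (r * y) ≤ max 1 (Real.exp y) := fun y => by
    rcases le_or_gt 0 y with hy | hy
    · exact le_max_of_le_right (Real.exp_le_exp.2 (mul_le_of_le_one_left hy hr1))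
    · exact le_max_of_le_left (Real.exp_le_one_iff.2 (mul_nonpos_of_nonneg_of_nonpos hr0 hy.le))
  have h1 : 1 ≤ Real.exp (θ * c) + Real.exp (-β * θ * c) := by
    rcases le_or_gt 0 (θ * c) with hy | hy
    · linarith [Real.one_le_exp hy, Real.exp_pos (-β * θ * c)]
    · have : 0 ≤ -β * θ * c := by nlinarith
      linarith [Real.one_le_exp this, Real.exp_pos (θ * c)]
  have hp1 := Real.exp_pos (θ * c)
  have hp2 := Real.exp_pos (-β * θ * c)
  constructor
  · rw [mul_assoc]
    exact (key _).trans (max_le h1 (by linarith))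
  · rw [mul_assoc]
    exact (key _).trans (max_le h1 (by linarith))

/-- The budget `G = B r^m w₁(r)` is shared out: `κ G` to the events where `1` or `-β` is attained,
and `(1 - κ) G / 2` each to the constant term and to the non-attained extreme weights. The lemma
serves both rays: from `θ` to `-β θ` one has `γ = 1`, and from `-β θ` back to `θ` one has `γ = β²`.
-/
lemma lintegral_step_le {β δ S θ₁ θ₂ γ r₀ r K M D A B κ : ℝ} {m : ℕ} {w₁ w₂ : ℝ → ℝ} {Ψ : ℝ → ℝ≥0∞}
    (hC : AEMeasurable C P) (hT : AEMeasurable T P)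
    (hadm : ∀ᵐ ω ∂P, Admissible β δ S (T ω)) (hβ : 0 < β)
    (hδ0 : 0 < δ) (hδ1 : δ < 1) (hS : 0 ≤ S) (hr : (1 - δ) * r₀ ≤ r) (hrr₀ : r ≤ r₀)
    (hr₀0 : 0 ≤ r₀) (hr₀ : r₀ ≤ 1)
    (hγ0 : 0 ≤ γ) (hγ1 : γ ≤ 1) (hrel : -β * θ₁ = γ * θ₂) (hK : 0 ≤ K)
    (hM : Real.exp (K * θ₁ ^ 2 * S) ≤ M) (hD : 1 ≤ D) (hA : 1 ≤ A) (hB : 0 ≤ B)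
    (hw₁ : ∀ x y, 0 ≤ x → x ≤ y → y ≤ 1 → w₁ x ≤ w₁ y) (hw₁1 : ∀ x, 0 ≤ x → x ≤ 1 → 1 ≤ w₁ x)
    (hw₂0 : ∀ x, 0 ≤ x → x ≤ 1 → 0 ≤ w₂ x) (hw₂A : ∀ x, 0 ≤ x → x ≤ 1 → w₂ x ≤ A)
    (hin₁ : ∀ x, 0 ≤ x → x ≤ (1 - δ) * r₀ →
      Ψ (x * θ₁) ≤ ENNReal.ofReal (Real.exp (K * (x * θ₁) ^ 2)))
    (hin₂ : ∀ x, 0 ≤ x → x ≤ (1 - δ) * r₀ →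
      Ψ (x * θ₂) ≤ ENNReal.ofReal (Real.exp (K * (x * θ₂) ^ 2)))
    (h₁ : ∀ x, 0 ≤ x → x ≤ r₀ → Ψ (x * θ₁) ≤ ENNReal.ofReal (D + B * x ^ m * w₁ x))
    (h₂ : ∀ x, 0 ≤ x → x ≤ r₀ → Ψ (x * θ₂) ≤ ENNReal.ofReal (D + B * x ^ m * w₂ x))
    {E : Ω → ℝ} (hE : Integrable E P) (hEs : ∀ ω, Real.exp (r * θ₁ * C ω) ≤ E ω)
    (hE1 : M * D * ∫ ω, E ω ∂P ≤ (1 - κ) / 2 * (B * ((1 - δ) * r₀) ^ m))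
    (hE2 : M * A * ∫ ω, E ω * boundaryPower β m (T ω) ∂P ≤ (1 - κ) / 2) (hκ : κ < 1)
    (hcond : (∫ ω in {ω | firstWeight (T ω) = 1}, Real.exp (r * θ₁ * C ω) ∂P) * w₁ r +
      (∫ ω in {ω | lastWeight (T ω) = -β}, Real.exp (r * θ₁ * C ω) ∂P) *
        (γ ^ m * w₂ (γ * r)) ≤ κ * w₁ r) :
    ∫⁻ ω, ENNReal.ofReal (Real.exp (r * θ₁ * C ω)) *
      ∏ k ∈ Finset.range (numWeights (T ω)), Ψ (r * θ₁ * T ω k) ∂P ≤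
      ENNReal.ofReal (B * r ^ m * w₁ r) := by
  have hr0 : 0 ≤ r := le_trans (by nlinarith) hr
  have hr1 : r ≤ 1 := hrr₀.trans hr₀
  have hM0 : 0 ≤ M := (Real.exp_pos _).le.trans hM
  have hw1 := hw₁1 r hr0 hr1
  set s := r * θ₁ with hs
  set G := B * r ^ m * w₁ r with hG
  have hG0 : 0 ≤ G := by positivity
  set G₂ := B * (γ * r) ^ m * w₂ (γ * r) with hG₂
  have hG₂0 : 0 ≤ G₂ := by
    have := hw₂0 (γ * r) (by positivity) ((mul_le_of_le_one_left hr0 hγ1).trans hr1)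
    positivity
  have hsd : s ∈ integrableExpSet C P := by
    refine Integrable.mono' hE (by fun_prop) (ae_of_all _ fun ω => ?_)
    rw [Real.norm_of_nonneg (Real.exp_pos _).le]
    exact hEs ω
  obtain ⟨hi1, he1⟩ := integral_ite_mul_exp hsd (nullMeasurableSet_first hT 1) G
  obtain ⟨hi2, he2⟩ := integral_ite_mul_exp hsd (nullMeasurableSet_last hT (-β)) G₂
  have hEb := integrable_mul_boundaryPower hβ hT hE m
  set F : Ω → ℝ := fun ω => (M * D * E ω + G * (M * A) * (E ω * boundaryPower β m (T ω))) +
    (Real.exp (s * C ω) * (if firstWeight (T ω) = 1 then G else 0) +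
      Real.exp (s * C ω) * if lastWeight (T ω) = -β then G₂ else 0) with hF
  have hF1 := (hE.const_mul (M * D)).add (hEb.const_mul (G * (M * A)))
  have hFi : Integrable F P := hF1.add (hi1.add hi2)
  have hFint : ∫ ω, F ω ∂P = (M * D * ∫ ω, E ω ∂P +
      G * (M * A) * ∫ ω, E ω * boundaryPower β m (T ω) ∂P) +
      ((∫ ω in {ω | firstWeight (T ω) = 1}, Real.exp (s * C ω) ∂P) * G +
      (∫ ω in {ω | lastWeight (T ω) = -β}, Real.exp (s * C ω) ∂P) * G₂) := by
    rw [← he1, ← he2, ← integral_const_mul, ← integral_const_mul, ← integral_add hi1 hi2,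
      ← integral_add (hE.const_mul (M * D)) (hEb.const_mul (G * (M * A)))]
    exact integral_add hF1 (hi1.add hi2)
  have hle : ∀ᵐ ω ∂P, ENNReal.ofReal (Real.exp (s * C ω)) *
      ∏ k ∈ Finset.range (numWeights (T ω)), Ψ (s * T ω k) ≤ ENNReal.ofReal (F ω) := by
    filter_upwards [hadm] with ω hω
    have henv := hω.prod_le_envelope hβ hδ0 hδ1 hS hr0 hrr₀ hr₀ hγ0 hγ1 hrel hK hM hD hA hB
      hw₁ hw₁1 hw₂0 hw₂A hin₁ hin₂ h₁ h₂
    refine (mul_le_mul' le_rfl henv).trans ?_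
    rw [← ENNReal.ofReal_mul (Real.exp_pos _).le]
    refine ENNReal.ofReal_le_ofReal ?_
    have hb := boundaryPower_nonneg hβ m (T ω)
    have h3 : Real.exp (s * C ω) * (M * D + G * (M * A * boundaryPower β m (T ω))) ≤
        E ω * (M * D + G * (M * A * boundaryPower β m (T ω))) :=
      mul_le_mul_of_nonneg_right (hEs ω) (by positivity)
    simp only [hF]
    linarith
  have hF0 : 0 ≤ᵐ[P] F := ae_of_all _ fun ω => by
    have hb := boundaryPower_nonneg hβ m (T ω)
    have hE0 : 0 ≤ E ω := (Real.exp_pos _).le.trans (hEs ω)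
    have h1 : 0 ≤ (if firstWeight (T ω) = 1 then G else 0) := by split_ifs <;> simp [hG0]
    have h2 : 0 ≤ (if lastWeight (T ω) = -β then G₂ else 0) := by split_ifs <;> simp [hG₂0]
    simp only [hF, Pi.zero_apply]
    positivity
  refine (lintegral_mono_ae hle).trans ?_
  rw [← ofReal_integral_eq_lintegral_ofReal hFi hF0, hFint]
  refine ENNReal.ofReal_le_ofReal ?_
  -- The lower bound on `r` enters here: the constant term can be absorbed into `r^m` only away from
  -- the origin.
  have h4 : (1 - κ) / 2 * (B * ((1 - δ) * r₀) ^ m) ≤ (1 - κ) / 2 * G := by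
    have h5 : ((1 - δ) * r₀) ^ m ≤ r ^ m :=
      pow_le_pow_left₀ (mul_nonneg (by linarith) hr₀0) hr m
    refine mul_le_mul_of_nonneg_left ?_ (by linarith)
    calc B * ((1 - δ) * r₀) ^ m ≤ B * r ^ m := by gcongr
      _ ≤ G := le_mul_of_one_le_right (by positivity) hw1
  have h6 : G * (M * A) * ∫ ω, E ω * boundaryPower β m (T ω) ∂P ≤ G * ((1 - κ) / 2) := by
    rw [mul_assoc]
    exact mul_le_mul_of_nonneg_left hE2 hG0
  have h7 : (∫ ω in {ω | firstWeight (T ω) = 1}, Real.exp (s * C ω) ∂P) * G +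
      (∫ ω in {ω | lastWeight (T ω) = -β}, Real.exp (s * C ω) ∂P) * G₂ ≤ κ * G := by
    have h8 := mul_le_mul_of_nonneg_left hcond (by positivity : 0 ≤ B * r ^ m)
    rw [hG, hG₂, mul_pow]
    linarith
  linarith

/-- The weight functions that balance the two sides `θ` and `-β θ`: for large `m`, the functions
`r ^ m * w₁ r` at `r θ` and `r ^ m * w₂ r` at `-r β θ` are strict supersolutions of the linear
system given by `a` and `b`. -/
structure BalancedWeights (P : Measure Ω) (C : Ω → ℝ) (T : Ω → ℕ → ℝ) (β θ A κ : ℝ) (m₀ : ℕ)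
    (w₁ w₂ : ℝ → ℝ) : Prop where
  lt_one : κ < 1
  mono₁ : ∀ x y, 0 ≤ x → x ≤ y → y ≤ 1 → w₁ x ≤ w₁ y
  mono₂ : ∀ x y, 0 ≤ x → x ≤ y → y ≤ 1 → w₂ x ≤ w₂ y
  one_le₁ : ∀ x, 0 ≤ x → x ≤ 1 → 1 ≤ w₁ x
  one_le₂ : ∀ x, 0 ≤ x → x ≤ 1 → 1 ≤ w₂ x
  le₁ : ∀ x, 0 ≤ x → x ≤ 1 → w₁ x ≤ A
  le₂ : ∀ x, 0 ≤ x → x ≤ 1 → w₂ x ≤ A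
  cond₁ : ∀ m ≥ m₀, ∀ r, 0 ≤ r → r ≤ 1 →
    (∫ ω in {ω | firstWeight (T ω) = 1}, Real.exp (r * θ * C ω) ∂P) * w₁ r +
    (∫ ω in {ω | lastWeight (T ω) = -β}, Real.exp (r * θ * C ω) ∂P) *
      (1 ^ m * w₂ (1 * r)) ≤ κ * w₁ r
  cond₂ : ∀ m ≥ m₀, ∀ r, 0 ≤ r → r ≤ 1 →
    (∫ ω in {ω | firstWeight (T ω) = 1}, Real.exp (r * (-β * θ) * C ω) ∂P) * w₂ r +
    (∫ ω in {ω | lastWeight (T ω) = -β}, Real.exp (r * (-β * θ) * C ω) ∂P) *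
      ((β ^ 2) ^ m * w₁ (β ^ 2 * r)) ≤ κ * w₂ r

/-- A bound on the scaled interval extends to a bound on the whole interval. -/
lemma exists_bound_of_bound_scaled {β δ S θ r₀ K A κ : ℝ} {m₀ : ℕ} {w₁ w₂ : ℝ → ℝ}
    {Ψ : ℕ → ℝ → ℝ≥0∞}
    (hC : AEMeasurable C P) (hT : AEMeasurable T P)
    (hadm : ∀ᵐ ω ∂P, Admissible β δ S (T ω)) (hβ : 0 < β) (hβ1 : β ≤ 1)
    (hδ0 : 0 < δ) (hδ1 : δ < 1) (hS : 0 ≤ S) (hr₀0 : 0 < r₀) (hr₀ : r₀ ≤ 1)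
    (hθ : θ ∈ integrableExpSet C P) (hθ' : -β * θ ∈ integrableExpSet C P)
    (hw : BalancedWeights P C T β θ A κ m₀ w₁ w₂) (hK : 0 ≤ K)
    (hΨ0 : ∀ s, Ψ 0 s = 1)
    (hΨ : ∀ n s, Ψ (n + 1) s = ∫⁻ ω, ENNReal.ofReal (Real.exp (s * C ω)) *
        ∏ k ∈ Finset.range (numWeights (T ω)), Ψ n (s * T ω k) ∂P)
    (hin₁ : ∀ n x, 0 ≤ x → x ≤ (1 - δ) * r₀ →
      Ψ n (x * θ) ≤ ENNReal.ofReal (Real.exp (K * (x * θ) ^ 2)))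
    (hin₂ : ∀ n x, 0 ≤ x → x ≤ (1 - δ) * r₀ →
      Ψ n (x * (-β * θ)) ≤ ENNReal.ofReal (Real.exp (K * (x * (-β * θ)) ^ 2))) :
    ∃ V : ℝ, 1 ≤ V ∧ ∀ n x, 0 ≤ x → x ≤ r₀ →
      Ψ n (x * θ) ≤ ENNReal.ofReal V ∧ Ψ n (x * (-β * θ)) ≤ ENNReal.ofReal V := by
  have hA : 1 ≤ A := (hw.one_le₁ 0 le_rfl zero_le_one).trans (hw.le₁ 0 le_rfl zero_le_one)
  set E : Ω → ℝ := fun ω => Real.exp (θ * C ω) + Real.exp (-β * θ * C ω) with hEdef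
  have hE : Integrable E P := Integrable.add hθ hθ'
  set M := Real.exp (K * θ ^ 2 * S) with hM
  have hM0 : 0 < M := Real.exp_pos _
  set D := Real.exp (K * θ ^ 2) with hD
  have hD1 : 1 ≤ D := Real.one_le_exp (by positivity)
  have hβθ : (-β * θ) ^ 2 ≤ θ ^ 2 := by
    rw [mul_pow, neg_sq]
    exact mul_le_of_le_one_left (sq_nonneg _) (pow_le_one₀ hβ.le hβ1)
  have hκ := hw.lt_one
  -- The exponent is fixed before `B`: its condition does not involve `B`, whereas `B` has to
  -- compensate the small factor `((1 - δ) r₀)^m`.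
  obtain ⟨m, hm0, hm⟩ : ∃ m ≥ m₀,
      M * A * ∫ ω, E ω * boundaryPower β m (T ω) ∂P ≤ (1 - κ) / 2 := by
    have h := (tendsto_integral_mul_boundaryPower hβ hT hE).const_mul (M * A)
    rw [mul_zero] at h
    have h2 := (h.eventually (ge_mem_nhds (by linarith : 0 < (1 - κ) / 2))).and
      (eventually_ge_atTop m₀)
    obtain ⟨m, h3, h4⟩ := h2.exists
    exact ⟨m, h4, h3⟩
  have hρ : 0 < (1 - δ) * r₀ := mul_pos (by linarith) hr₀0
  have hEi0 : 0 ≤ ∫ ω, E ω ∂P := integral_nonneg fun ω => by positivity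
  set B := M * D * (∫ ω, E ω ∂P) / ((1 - κ) / 2 * ((1 - δ) * r₀) ^ m) with hB
  have hκ2 : 0 < (1 - κ) / 2 := by linarith
  have hB0 : 0 ≤ B := by positivity
  have hBE : M * D * ∫ ω, E ω ∂P ≤ (1 - κ) / 2 * (B * ((1 - δ) * r₀) ^ m) := by
    refine le_of_eq ?_
    have hκ3 : 1 - κ ≠ 0 := by linarith
    rw [hB]
    field_simp
  have main : ∀ n,
      (∀ x, 0 ≤ x → x ≤ r₀ → Ψ n (x * θ) ≤ ENNReal.ofReal (D + B * x ^ m * w₁ x)) ∧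
      (∀ x, 0 ≤ x → x ≤ r₀ → Ψ n (x * (-β * θ)) ≤ ENNReal.ofReal (D + B * x ^ m * w₂ x)) := by
    have hnn₁ : ∀ x, 0 ≤ x → x ≤ r₀ → 0 ≤ B * x ^ m * w₁ x := fun x h0 h1 => by
      have := hw.one_le₁ x h0 (h1.trans hr₀)
      positivity
    have hnn₂ : ∀ x, 0 ≤ x → x ≤ r₀ → 0 ≤ B * x ^ m * w₂ x := fun x h0 h1 => by
      have := hw.one_le₂ x h0 (h1.trans hr₀)
      positivity
    have hDin : ∀ x y, 0 ≤ x → x ≤ r₀ → y ^ 2 ≤ θ ^ 2 →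
        Real.exp (K * (x * y) ^ 2) ≤ D := fun x y h0 h1 hy => by
      refine Real.exp_le_exp.2 (mul_le_mul_of_nonneg_left ?_ hK)
      rw [mul_pow]
      exact (mul_le_of_le_one_left (sq_nonneg _) (pow_le_one₀ h0 (h1.trans hr₀))).trans hy
    intro n
    induction n with
    | zero =>
      simp only [hΨ0, ENNReal.one_le_ofReal]
      exact ⟨fun x h0 h1 => by linarith [hnn₁ x h0 h1], fun x h0 h1 => by linarith [hnn₂ x h0 h1]⟩
    | succ n ih =>
      refine ⟨fun x h0 h1 => ?_, fun x h0 h1 => ?_⟩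
      · rcases le_or_gt x ((1 - δ) * r₀) with hx | hx
        · refine (hin₁ (n + 1) x h0 hx).trans (ENNReal.ofReal_le_ofReal ?_)
          linarith [hDin x θ h0 h1 le_rfl, hnn₁ x h0 h1]
        · rw [hΨ]
          refine (lintegral_step_le (θ₂ := -β * θ) (γ := 1) (w₂ := w₂) (κ := κ) (A := A) (M := M)
            hC hT hadm hβ hδ0 hδ1 hS hx.le h1 hr₀0.le hr₀ zero_le_one le_rfl (by ring) hK le_rfl
            hD1 hA hB0 hw.mono₁ hw.one_le₁ (fun x h h' => zero_le_one.trans (hw.one_le₂ x h h'))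
            hw.le₂ (hin₁ n) (hin₂ n) ih.1 ih.2 hE
            (fun ω => (exp_mul_le_exp_add_exp hβ h0 (h1.trans hr₀) (C ω)).1) hBE hm hκ
            (hw.cond₁ m hm0 x h0 (h1.trans hr₀))).trans (ENNReal.ofReal_le_ofReal (by linarith))
      · rcases le_or_gt x ((1 - δ) * r₀) with hx | hx
        · refine (hin₂ (n + 1) x h0 hx).trans (ENNReal.ofReal_le_ofReal ?_)
          linarith [hDin x (-β * θ) h0 h1 hβθ, hnn₂ x h0 h1]
        · rw [hΨ]
          refine (lintegral_step_le (θ₂ := θ) (γ := β ^ 2) (w₂ := w₁) (κ := κ) (A := A) (M := M)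
            hC hT hadm hβ hδ0 hδ1 hS hx.le h1 hr₀0.le hr₀ (sq_nonneg β) (pow_le_one₀ hβ.le hβ1)
            (by ring) hK (Real.exp_le_exp.2 (by gcongr))
            hD1 hA hB0 hw.mono₂ hw.one_le₂ (fun x h h' => zero_le_one.trans (hw.one_le₁ x h h'))
            hw.le₁ (hin₂ n) (hin₁ n) ih.2 ih.1 hE
            (fun ω => (exp_mul_le_exp_add_exp hβ h0 (h1.trans hr₀) (C ω)).2) hBE hm hκ
            (hw.cond₂ m hm0 x h0 (h1.trans hr₀))).trans (ENNReal.ofReal_le_ofReal (by linarith))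
  have hV : ∀ w : ℝ, w ≤ A → ∀ x, 0 ≤ x → x ≤ r₀ → D + B * x ^ m * w ≤ D + B * A := by
    intro w h x h0 h1
    have h2 : x ^ m ≤ 1 := pow_le_one₀ h0 (h1.trans hr₀)
    have h3 : B * x ^ m * w ≤ B * x ^ m * A := by gcongr
    have h4 : B * x ^ m * A ≤ B * 1 * A := by gcongr
    linarith
  refine ⟨D + B * A, by nlinarith, fun n x h0 h1 => ⟨?_, ?_⟩⟩
  · exact ((main n).1 x h0 h1).trans (ENNReal.ofReal_le_ofReal
      (hV _ (hw.le₁ x h0 (h1.trans hr₀)) x h0 h1))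
  · exact ((main n).2 x h0 h1).trans (ENNReal.ofReal_le_ofReal
      (hV _ (hw.le₂ x h0 (h1.trans hr₀)) x h0 h1))

/-- Under balanced weights the iterates stay bounded at `θ`. -/
theorem exists_bound_iterates [IsProbabilityMeasure P] {β δ S θ A κ : ℝ} {m₀ : ℕ} {w₁ w₂ : ℝ → ℝ}
    {Ψ : ℕ → ℝ → ℝ≥0∞}
    (hC : AEMeasurable C P) (hT : AEMeasurable T P)
    (hadm : ∀ᵐ ω ∂P, Admissible β δ S (T ω)) (hβ : 0 < β) (hβ1 : β ≤ 1)
    (hδ0 : 0 < δ) (hδ1 : δ < 1) (hS : 0 ≤ S) (hθ0 : θ ≠ 0)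
    (hθ : θ ∈ integrableExpSet C P) (hθ' : -β * θ ∈ integrableExpSet C P)
    (hmean : ∫ ω, C ω ∂P = 0) (hV1 : ∫ ω, powerSum 2 (T ω) ∂P < 1)
    (hw : BalancedWeights P C T β θ A κ m₀ w₁ w₂)
    (hΨ0 : ∀ s, Ψ 0 s = 1)
    (hΨ : ∀ n s, Ψ (n + 1) s = ∫⁻ ω, ENNReal.ofReal (Real.exp (s * C ω)) *
        ∏ k ∈ Finset.range (numWeights (T ω)), Ψ n (s * T ω k) ∂P) :
    ∃ V : ℝ, ∀ n, Ψ n θ ≤ ENNReal.ofReal V := by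
  have hδ' : 0 < 1 - δ := by linarith
  have hθa : 0 < |θ| := abs_pos.2 hθ0
  have hβθa : |-β * θ| = β * |θ| := by rw [abs_mul, abs_neg, abs_of_pos hβ]
  -- A constant bound would not suffice for the next extension: the number of children is not
  -- assumed bounded, and the product over them is controlled through `Σ_2` by the Gaussian form.
  let Good : ℝ → Prop := fun ρ => ∃ K : ℝ, 0 ≤ K ∧ ∀ n x, 0 ≤ x → x ≤ ρ →
    Ψ n (x * θ) ≤ ENNReal.ofReal (Real.exp (K * (x * θ) ^ 2)) ∧
    Ψ n (x * (-β * θ)) ≤ ENNReal.ofReal (Real.exp (K * (x * (-β * θ)) ^ 2))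
  have hstep : ∀ r₀, 0 < r₀ → r₀ ≤ 1 → Good ((1 - δ) * r₀) → Good r₀ := by
    rintro r₀ h0 h1 ⟨K, hK, hgood⟩
    obtain ⟨V, hV, hbd⟩ := exists_bound_of_bound_scaled hC hT hadm hβ hβ1 hδ0 hδ1 hS h0 h1 hθ hθ'
      hw hK hΨ0 hΨ (fun n x hx hx' => (hgood n x hx hx').1) (fun n x hx hx' => (hgood n x hx hx').2)
    set ρ := (1 - δ) * r₀ * (β * |θ|) with hρ
    have hρ0 : 0 < ρ := by positivity
    -- Outside the radius `ρ` the constant `V` is absorbed by a larger Gaussian constant.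
    set K' := max K (Real.log V / ρ ^ 2) with hK'
    have hVK : ∀ y, ρ ≤ |y| → V ≤ Real.exp (K' * y ^ 2) := by
      intro y hy
      have hy2 : ρ ^ 2 ≤ y ^ 2 := by
        rw [← sq_abs y]
        gcongr
      have h2 : Real.log V ≤ K' * y ^ 2 := by
        calc Real.log V = Real.log V / ρ ^ 2 * ρ ^ 2 := by field_simp
          _ ≤ K' * ρ ^ 2 := by gcongr; exact le_max_right _ _
          _ ≤ K' * y ^ 2 := by
            have : 0 ≤ K' := hK.trans (le_max_left _ _)
            gcongr
      calc V = Real.exp (Real.log V) := (Real.exp_log (by linarith)).symm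
        _ ≤ _ := Real.exp_le_exp.2 h2
    have hKK : ∀ y, Real.exp (K * y ^ 2) ≤ Real.exp (K' * y ^ 2) := fun y =>
      Real.exp_le_exp.2 (mul_le_mul_of_nonneg_right (le_max_left _ _) (sq_nonneg y))
    refine ⟨K', hK.trans (le_max_left _ _), fun n x hx hx' => ?_⟩
    rcases le_or_gt x ((1 - δ) * r₀) with hle | hgt
    · exact ⟨(hgood n x hx hle).1.trans (ENNReal.ofReal_le_ofReal (hKK _)),
        (hgood n x hx hle).2.trans (ENNReal.ofReal_le_ofReal (hKK _))⟩
    · have hin1 : ρ ≤ |x * (-β * θ)| := by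
        rw [abs_mul, hβθa, abs_of_nonneg hx, hρ]
        gcongr
      have hin2 : ρ ≤ |x * θ| := by
        rw [abs_mul, abs_of_nonneg hx, hρ]
        have : β * |θ| ≤ |θ| := mul_le_of_le_one_left hθa.le hβ1
        gcongr
      exact ⟨(hbd n x hx hx').1.trans (ENNReal.ofReal_le_ofReal (hVK _ hin2)),
        (hbd n x hx hx').2.trans (ENNReal.ofReal_le_ofReal (hVK _ hin1))⟩
  have hpow : ∀ j : ℕ, Good ((1 - δ) ^ j) → Good 1 := by
    intro j
    induction j with
    | zero => simp
    | succ j ih =>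
      intro h
      rw [pow_succ'] at h
      exact ih (hstep _ (by positivity) (pow_le_one₀ hδ'.le (by linarith)) h)
  -- The domain is an interval containing `θ` and `-β θ`; as `β ≤ 1`, it contains the symmetric
  -- interval of radius `β |θ|`.
  have hdom : β * |θ| ∈ integrableExpSet C P ∧ -(β * |θ|) ∈ integrableExpSet C P := by
    have hcv := (convex_integrableExpSet (X := C) (μ := P)).ordConnected
    have hmem : ∀ y, |y| ≤ β * |θ| → y ∈ integrableExpSet C P := by
      intro y hy
      have hb : β * |θ| ≤ |θ| := mul_le_of_le_one_left hθa.le hβ1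
      rcases lt_or_gt_of_ne hθ0 with hneg | hpos
      · rw [abs_of_neg hneg] at hy hb
        exact hcv.out hθ hθ' ⟨by linarith [(abs_le.1 hy).1], by linarith [(abs_le.1 hy).2]⟩
      · rw [abs_of_pos hpos] at hy hb
        exact hcv.out hθ' hθ ⟨by linarith [(abs_le.1 hy).1], by linarith [(abs_le.1 hy).2]⟩
    have hnn : 0 ≤ β * |θ| := by positivity
    exact ⟨hmem _ (abs_of_nonneg hnn).le, hmem _ (by rw [abs_neg, abs_of_nonneg hnn])⟩
  obtain ⟨K, s₀, hK, hs₀, hsmall⟩ := exists_gaussian_bound_iterates hT hadm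
    (by positivity : 0 < β * |θ|) hdom.1 hdom.2 hmean hV1 hΨ0 hΨ
  obtain ⟨j, hj⟩ := exists_pow_lt_of_lt_one (div_pos hs₀ hθa) (by linarith : 1 - δ < 1)
  have hg : Good ((1 - δ) ^ j) := by
    refine ⟨K, hK, fun n x hx hx' => ?_⟩
    have h1 : x * |θ| ≤ s₀ := by
      rw [lt_div_iff₀ hθa] at hj
      exact (mul_le_mul_of_nonneg_right hx' hθa.le).trans hj.le
    refine ⟨hsmall n _ ?_, hsmall n _ ?_⟩
    · rwa [abs_mul, abs_of_nonneg hx]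
    · rw [abs_mul, hβθa, abs_of_nonneg hx]
      refine le_trans ?_ h1
      gcongr
      exact mul_le_of_le_one_left hθa.le hβ1
  obtain ⟨K', -, hfin⟩ := hpow j hg
  refine ⟨Real.exp (K' * (1 * θ) ^ 2), fun n => ?_⟩
  have h := (hfin n 1 zero_le_one le_rfl).1
  rwa [one_mul] at h ⊢

end Extension

/-! ### Existence of balanced weights -/

section Balanced

variable {Ω : Type*} [MeasurableSpace Ω] {P : Measure Ω} [IsProbabilityMeasure P]
  {C : Ω → ℝ} {T : Ω → ℕ → ℝ}

/-- Interpolation of an exponential integral between `0` and `s`. -/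
lemma setIntegral_exp_mul_rpow_le {s x r : ℝ} (hC : AEMeasurable C P)
    (hs : s ∈ integrableExpSet C P) (hx : 0 < x) (hr0 : 0 ≤ r) (hr1 : r ≤ 1) (U : Set Ω) :
    (∫ ω in U, Real.exp (r * s * C ω) ∂P) * x ^ r ≤
      r * (x * ∫ ω in U, Real.exp (s * C ω) ∂P) + (1 - r) * P.real U := by
  have hpt : ∀ ω, Real.exp (r * s * C ω) * x ^ r ≤ r * (x * Real.exp (s * C ω)) + (1 - r) := by
    intro ω
    -- The two quantities averaged, with weights `r` and `1 - r`, are `x exp(s C)` and `1`; the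
    -- latter accounts for the probability of `U`.
    have h := Real.geom_mean_le_arith_mean2_weighted hr0 (by linarith : 0 ≤ 1 - r)
      (by positivity : 0 ≤ x * Real.exp (s * C ω)) zero_le_one (by ring)
    rw [Real.one_rpow, mul_one, mul_one, Real.mul_rpow hx.le (Real.exp_pos _).le,
      ← Real.exp_mul] at h
    rw [mul_comm (Real.exp _)]
    convert h using 3
    ring
  have hi : Integrable (fun ω => r * (x * Real.exp (s * C ω)) + (1 - r)) (P.restrict U) :=
    ((Integrable.const_mul (Integrable.integrableOn hs) x).const_mul r).add (integrable_const _)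
  have hi' : Integrable (fun ω => Real.exp (r * s * C ω) * x ^ r) (P.restrict U) := by
    have hCm : AEMeasurable C (P.restrict U) := hC.restrict
    refine hi.mono' (by fun_prop) (ae_of_all _ fun ω => ?_)
    rw [Real.norm_of_nonneg (by positivity)]
    exact hpt ω
  rw [← integral_mul_const]
  refine (integral_mono hi' hi hpt).trans_eq ?_
  rw [integral_add ((Integrable.const_mul (Integrable.integrableOn hs) x).const_mul r)
    (integrable_const _), integral_const_mul, integral_const_mul, integral_const, smul_eq_mul,
    mul_comm (1 - r)]
  simp [Measure.real]

/-- The coupling from `-β θ` back to `θ` carries `β^(2m)`, so the system is nearly triangular and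
constant weights suffice. A large `H` on the first ray absorbs the coupling there; then `m₀` is
chosen so that `β^(2m) H` is small on the second. -/
lemma exists_balancedWeights_of_lt_one {β θ : ℝ} (hC : AEMeasurable C P) (hβ : 0 < β) (hβ1 : β < 1)
    (hθ : θ ∈ integrableExpSet C P) (hθ' : -β * θ ∈ integrableExpSet C P)
    (hP : P.real {ω | firstWeight (T ω) = 1} < 1)
    (ha : ∫ ω in {ω | firstWeight (T ω) = 1}, Real.exp (θ * C ω) ∂P < 1)
    (ha' : ∫ ω in {ω | firstWeight (T ω) = 1}, Real.exp (-β * θ * C ω) ∂P < 1) :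
    ∃ A κ m₀ w₁ w₂, BalancedWeights P C T β θ A κ m₀ w₁ w₂ := by
  set E : Ω → ℝ := fun ω => Real.exp (θ * C ω) + Real.exp (-β * θ * C ω) with hEdef
  have hE : Integrable E P := Integrable.add hθ hθ'
  set Φ := ∫ ω, E ω ∂P with hΦ
  have hΦ0 : 0 ≤ Φ := integral_nonneg fun ω => by positivity
  have hbound : ∀ s, (∀ ω, Real.exp (s * C ω) ≤ E ω) → ∀ U : Set Ω,
      ∫ ω in U, Real.exp (s * C ω) ∂P ≤ Φ := by
    intro s hs U
    have hi : Integrable (fun ω => Real.exp (s * C ω)) P := by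
      refine hE.mono' (by fun_prop) (ae_of_all _ fun ω => ?_)
      rw [Real.norm_of_nonneg (Real.exp_pos _).le]
      exact hs ω
    refine (setIntegral_le_integral hi (ae_of_all _ fun _ => (Real.exp_pos _).le)).trans ?_
    exact integral_mono hi hE hs
  set p₀ := P.real {ω | firstWeight (T ω) = 1} with hp₀
  set a := ∫ ω in {ω | firstWeight (T ω) = 1}, Real.exp (θ * C ω) ∂P with hadef
  set a' := ∫ ω in {ω | firstWeight (T ω) = 1}, Real.exp (-β * θ * C ω) ∂P with hadef'
  -- Interpolation between `r = 0`, where `a` is the probability `p₀`, and `r = 1` keeps `a` at most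
  -- `q` along both rays.
  set q := max p₀ (max a a') with hq
  have hq1 : q < 1 := max_lt hP (max_lt ha ha')
  have hq0 : 0 ≤ q := measureReal_nonneg.trans (le_max_left _ _)
  have hconv : ∀ s, s ∈ integrableExpSet C P →
      ∫ ω in {ω | firstWeight (T ω) = 1}, Real.exp (s * C ω) ∂P ≤ q → ∀ r, 0 ≤ r → r ≤ 1 →
      ∫ ω in {ω | firstWeight (T ω) = 1}, Real.exp (r * s * C ω) ∂P ≤ q := by
    intro s hs hsq r hr0 hr1
    have h := setIntegral_exp_mul_rpow_le hC hs one_pos hr0 hr1 {ω | firstWeight (T ω) = 1}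
    rw [Real.one_rpow, mul_one, one_mul] at h
    have h1 := mul_le_mul_of_nonneg_left hsq hr0
    have h2 := mul_le_mul_of_nonneg_left (le_max_left p₀ (max a a')) (by linarith : 0 ≤ 1 - r)
    linarith
  set H := 1 + 2 * Φ / (1 - q) with hH
  have h1q : 0 < 1 - q := by linarith
  have hH1 : 1 ≤ H := by
    have : 0 ≤ 2 * Φ / (1 - q) := by positivity
    linarith
  have hHΦ : Φ ≤ (1 - q) / 2 * H := by
    have : (1 - q) / 2 * H = (1 - q) / 2 + Φ := by
      rw [hH]
      field_simp
    linarith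
  obtain ⟨m₀, hm₀⟩ : ∃ m₀ : ℕ, ∀ m ≥ m₀, Φ * H * (β ^ 2) ^ m ≤ (1 - q) / 2 := by
    have h := (tendsto_pow_atTop_nhds_zero_of_lt_one (sq_nonneg β)
      (pow_lt_one₀ hβ.le hβ1 two_ne_zero)).const_mul (Φ * H)
    rw [mul_zero] at h
    exact eventually_atTop.1 (h.eventually (ge_mem_nhds (by linarith : 0 < (1 - q) / 2)))
  refine ⟨H, (1 + q) / 2, m₀, fun _ => H, fun _ => 1, ?_⟩
  refine ⟨by linarith, fun _ _ _ _ _ => le_rfl, fun _ _ _ _ _ => le_rfl, fun _ _ _ => hH1,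
    fun _ _ _ => le_rfl, fun _ _ _ => le_rfl, fun _ _ _ => hH1, fun m hm r hr0 hr1 => ?_,
    fun m hm r hr0 hr1 => ?_⟩
  · have h1 := hconv θ hθ ((le_max_left _ _).trans (le_max_right _ _)) r hr0 hr1
    have h2 := hbound (r * θ) (fun ω => (exp_mul_le_exp_add_exp hβ hr0 hr1 (C ω)).1)
      {ω | lastWeight (T ω) = -β}
    have h3 := mul_le_mul_of_nonneg_right h1 (zero_le_one.trans hH1)
    simp only [one_pow, mul_one]
    linarith
  · have h1 := hconv (-β * θ) hθ' ((le_max_right _ _).trans (le_max_right _ _)) r hr0 hr1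
    have h2 := hbound (r * (-β * θ)) (fun ω => (exp_mul_le_exp_add_exp hβ hr0 hr1 (C ω)).2)
      {ω | lastWeight (T ω) = -β}
    have h3 := mul_le_mul_of_nonneg_right h2 (by positivity : 0 ≤ (β ^ 2) ^ m * H)
    have h4 := hm₀ m hm
    simp only [mul_one]
    linarith

/-- The vector `(1 - a', b')` solves the second relation with equality and the first strictly.
Raising its second entry by a small `e` makes both strict, and scaling by `c` lifts both entries to
at least `1`. -/
lemma exists_pos_vector_lt {a a' b b' : ℝ} (hb : 0 ≤ b) (hb' : 0 ≤ b') (ha : a < 1) (ha' : a' < 1)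
    (h : b * b' < (1 - a') * (1 - a)) :
    ∃ A₁ A₂ : ℝ, 1 ≤ A₁ ∧ 1 ≤ A₂ ∧ a * A₁ + b * A₂ < A₁ ∧ a' * A₂ + b' * A₁ < A₂ := by
  have h1 : 0 < 1 - a := by linarith
  have h1' : 0 < 1 - a' := by linarith
  set e := ((1 - a') * (1 - a) - b * b') / (2 * (b + 1)) with he
  have he0 : 0 < e := div_pos (by linarith) (by linarith)
  have heb : e * (2 * (b + 1)) = (1 - a') * (1 - a) - b * b' := by
    rw [he]
    field_simp
  have hx : 0 < 1 - a' := h1'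
  have hy : 0 < b' + e := by linarith
  have key1 : b * (b' + e) < (1 - a) * (1 - a') := by nlinarith
  set c := 1 + 1 / (1 - a') + 1 / (b' + e) with hc
  have hi1 : 0 < 1 / (1 - a') := by positivity
  have hi2 : 0 < 1 / (b' + e) := by positivity
  have hc0 : 0 < c := by linarith
  have hc1 : 1 ≤ c * (1 - a') := by
    have : 1 / (1 - a') * (1 - a') = 1 := by field_simp
    nlinarith
  have hc2 : 1 ≤ c * (b' + e) := by
    have : 1 / (b' + e) * (b' + e) = 1 := by field_simp
    nlinarith
  refine ⟨c * (1 - a'), c * (b' + e), hc1, hc2, ?_, ?_⟩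
  · have := mul_lt_mul_of_pos_left key1 hc0
    linarith
  · have : 0 < c * ((1 - a') * e) := by positivity
    linarith

/-- With `w_i(x) = A_i^x`, the inequality at `r = 1` is the one for the positive vector, and at `r =
0` it says that the two extremal events have total probability below `1`. The mean inequality with
`x = B₂ / B₁` interpolates between them. -/
lemma exists_balancedWeights_of_eq_one {θ : ℝ} (hC : AEMeasurable C P)
    (hθ : θ ∈ integrableExpSet C P) (hθ' : -θ ∈ integrableExpSet C P)
    (hP : P.real {ω | firstWeight (T ω) = 1} + P.real {ω | lastWeight (T ω) = -1} < 1)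
    (ha : ∫ ω in {ω | firstWeight (T ω) = 1}, Real.exp (θ * C ω) ∂P < 1)
    (ha' : ∫ ω in {ω | firstWeight (T ω) = 1}, Real.exp (-θ * C ω) ∂P < 1)
    (hb : (∫ ω in {ω | lastWeight (T ω) = -1}, Real.exp (θ * C ω) ∂P) *
        ∫ ω in {ω | lastWeight (T ω) = -1}, Real.exp (-θ * C ω) ∂P <
      (1 - ∫ ω in {ω | firstWeight (T ω) = 1}, Real.exp (-θ * C ω) ∂P) *
        (1 - ∫ ω in {ω | firstWeight (T ω) = 1}, Real.exp (θ * C ω) ∂P)) :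
    ∃ A κ m₀ w₁ w₂, BalancedWeights P C T 1 θ A κ m₀ w₁ w₂ := by
  have hnn : ∀ (s : ℝ) (U : Set Ω), 0 ≤ ∫ ω in U, Real.exp (s * C ω) ∂P := fun s U =>
    integral_nonneg fun _ => (Real.exp_pos _).le
  obtain ⟨A₁, A₂, hA₁, hA₂, h1, h2⟩ := exists_pos_vector_lt (hnn θ _) (hnn (-θ) _) ha ha' hb
  set p₀ := P.real {ω | firstWeight (T ω) = 1} + P.real {ω | lastWeight (T ω) = -1} with hp₀
  have key : ∀ (s B₁ B₂ : ℝ), s ∈ integrableExpSet C P → 1 ≤ B₁ → 1 ≤ B₂ → ∀ κ, p₀ ≤ κ →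
      ((∫ ω in {ω | firstWeight (T ω) = 1}, Real.exp (s * C ω) ∂P) * B₁ +
        (∫ ω in {ω | lastWeight (T ω) = -1}, Real.exp (s * C ω) ∂P) * B₂) / B₁ ≤ κ →
      ∀ r, 0 ≤ r → r ≤ 1 →
      (∫ ω in {ω | firstWeight (T ω) = 1}, Real.exp (r * s * C ω) ∂P) * B₁ ^ r +
        (∫ ω in {ω | lastWeight (T ω) = -1}, Real.exp (r * s * C ω) ∂P) * B₂ ^ r ≤
      κ * B₁ ^ r := by
    intro s B₁ B₂ hs hB₁ hB₂ κ hκ0 hκ1 r hr0 hr1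
    have hB₁0 : 0 < B₁ := by linarith
    have hx : 0 < B₂ / B₁ := div_pos (by linarith) hB₁0
    have h3 := setIntegral_exp_mul_rpow_le hC hs one_pos hr0 hr1 {ω | firstWeight (T ω) = 1}
    have h4 := setIntegral_exp_mul_rpow_le hC hs hx hr0 hr1 {ω | lastWeight (T ω) = -1}
    rw [Real.one_rpow, mul_one, one_mul] at h3
    have h5 : B₂ ^ r = (B₂ / B₁) ^ r * B₁ ^ r := by
      rw [← Real.mul_rpow hx.le hB₁0.le, div_mul_cancel₀ _ hB₁0.ne']
    rw [h5, ← mul_assoc, ← add_mul]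
    refine mul_le_mul_of_nonneg_right ?_ (by positivity)
    rw [add_div, mul_div_cancel_right₀ _ hB₁0.ne', mul_div_assoc] at hκ1
    have h6 := mul_le_mul_of_nonneg_left hκ1 hr0
    have h7 := mul_le_mul_of_nonneg_left hκ0 (by linarith : 0 ≤ 1 - r)
    linarith
  have hA₁0 : 0 < A₁ := by linarith
  have hA₂0 : 0 < A₂ := by linarith
  have hmono : ∀ B : ℝ, 1 ≤ B → ∀ x y : ℝ, 0 ≤ x → x ≤ y → y ≤ 1 → B ^ x ≤ B ^ y :=
    fun B hB x y _ h _ => Real.rpow_le_rpow_of_exponent_le hB h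
  have hone : ∀ B : ℝ, 1 ≤ B → ∀ x : ℝ, 0 ≤ x → x ≤ 1 → 1 ≤ B ^ x :=
    fun B hB x h _ => Real.one_le_rpow hB h
  have hle : ∀ B : ℝ, 1 ≤ B → ∀ x : ℝ, 0 ≤ x → x ≤ 1 → B ^ x ≤ B := fun B hB x _ h => by
    simpa using Real.rpow_le_rpow_of_exponent_le hB h
  refine ⟨max A₁ A₂, _, 0, fun x => A₁ ^ x, fun x => A₂ ^ x,
    ⟨max_lt hP (max_lt ((div_lt_one hA₁0).2 h1) ((div_lt_one hA₂0).2 h2)), hmono A₁ hA₁,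
      hmono A₂ hA₂, hone A₁ hA₁, hone A₂ hA₂,
      fun x h h' => (hle A₁ hA₁ x h h').trans (le_max_left _ _),
      fun x h h' => (hle A₂ hA₂ x h h').trans (le_max_right _ _), fun m _ r hr0 hr1 => ?_,
      fun m _ r hr0 hr1 => ?_⟩⟩
  · simp only [one_pow, one_mul]
    exact key θ A₁ A₂ hθ hA₁ hA₂ _ (le_max_left _ _)
      ((le_max_left _ _).trans (le_max_right _ _)) r hr0 hr1
  · simp only [one_pow, one_mul, neg_one_mul]
    exact key (-θ) A₂ A₁ hθ' hA₂ hA₁ _ (le_max_left _ _)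
      ((le_max_right _ _).trans (le_max_right _ _)) r hr0 hr1

end Balanced

/-! ### Verification of the assumptions -/

lemma measurableSet_isOrdered : MeasurableSet {t : ℕ → ℝ | IsOrdered t} := by
  have hN := measurable_numWeights
  have h0 : ∀ k, MeasurableSet {t : ℕ → ℝ | t k = 0} := fun k =>
    measurable_pi_apply k (measurableSet_singleton 0)
  have heq : {t : ℕ → ℝ | IsOrdered t} = (⋃ n : ℕ, ⋂ k ∈ Set.Ici n, {t | t k = 0}) ∩
      ((⋂ k : ℕ, ({t | k < numWeights t} ∪ {t | t k = 0})) ∩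
      ⋂ i : ℕ, ⋂ j ∈ Set.Ici i, ({t | numWeights t ≤ j} ∪ {t | t j ≤ t i})) := by
    ext t
    simp only [IsOrdered, Set.mem_inter_iff, Set.mem_iUnion, Set.mem_iInter, Set.mem_union,
      Set.mem_ofPred_eq, Set.mem_Ici]
    refine and_congr ⟨fun h => ?_, fun ⟨n, h⟩ => ?_⟩ (and_congr ?_ ?_)
    · obtain ⟨n, hn⟩ := h.bddAbove
      refine ⟨n + 1, fun k hk => ?_⟩
      by_contra hne
      have := hn (show k ∈ {k | t k ≠ 0} from hne)
      omega
    · refine (Set.finite_Iio n).subset fun k hk => ?_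
      by_contra hne
      exact hk (h k (not_lt.1 hne))
    · exact forall_congr' fun k => by rw [imp_iff_not_or, not_le]
    · exact forall₂_congr fun i j => forall_congr' fun _ => by rw [imp_iff_not_or, not_lt]
  rw [heq]
  refine (MeasurableSet.iUnion fun n => MeasurableSet.biInter (Set.to_countable _)
    fun k _ => h0 k).inter ((MeasurableSet.iInter fun k => ?_).inter
    (MeasurableSet.iInter fun i => MeasurableSet.biInter (Set.to_countable _) fun j _ => ?_))
  · exact (measurableSet_lt measurable_const hN).union (h0 k)
  · exact (measurableSet_le hN measurable_const).union
      (measurableSet_le (measurable_pi_apply j) (measurable_pi_apply i))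

section Beta

variable {Ω : Type*} [MeasurableSpace Ω] {P : Measure Ω} {T : Ω → ℕ → ℝ}

lemma abs_lastWeight_le_one {t : ℕ → ℝ} (h : ∀ k, |t k| ≤ 1) : |lastWeight t| ≤ 1 := by
  rw [lastWeight]
  split_ifs
  · simp
  · exact h _

lemma beta_le_of_ae_le [IsProbabilityMeasure P] {c : ℝ} (hc : 0 ≤ c) (h : ∀ᵐ ω ∂P, -lastWeight (T ω) ≤ c) :
    beta P T ≤ c := by
  refine essSup_le_of_ae_le c (h.mono fun ω hω => max_le hω hc) ?_
  exact isCoboundedUnder_le_of_eventually_le _ (x := 0)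
    (Eventually.of_forall fun ω => le_max_right _ _)

lemma ae_neg_beta_le_lastWeight (hT_le : ∀ᵐ ω ∂P, ∀ k, |T ω k| ≤ 1) :
    ∀ᵐ ω ∂P, -beta P T ≤ lastWeight (T ω) := by
  have hb : IsBoundedUnder (· ≤ ·) (ae P) fun ω => max (-lastWeight (T ω)) 0 :=
    isBoundedUnder_of_eventually_le (a := 1) (hT_le.mono fun ω h =>
      max_le (neg_le.1 (abs_le.1 (abs_lastWeight_le_one h)).1) zero_le_one)
  filter_upwards [ae_le_essSup hb] with ω hω
  have h2 : -lastWeight (T ω) ≤ beta P T := (le_max_left _ _).trans hω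
  linarith

lemma beta_le_one [IsProbabilityMeasure P] (hT_le : ∀ᵐ ω ∂P, ∀ k, |T ω k| ≤ 1) : beta P T ≤ 1 :=
  beta_le_of_ae_le zero_le_one (hT_le.mono fun _ h =>
    neg_le.1 (abs_le.1 (abs_lastWeight_le_one h)).1)

end Beta

section Sums

variable {Ω : Type*} [MeasurableSpace Ω] {P : Measure Ω} {T : Ω → ℕ → ℝ}

lemma powerSum_two_le {p : ℝ} (hp0 : 0 ≤ p) (hp2 : p ≤ 2) {t : ℕ → ℝ} (h : ∀ k, |t k| ≤ 1) :
    powerSum 2 t ≤ powerSum p t :=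
  Finset.sum_le_sum fun k _ => Real.rpow_le_rpow_of_exponent_ge' (abs_nonneg _) (h k) hp0 hp2

lemma one_le_powerSum (p : ℝ) {t : ℕ → ℝ} {k : ℕ} (hk : k < numWeights t) (h : |t k| = 1) :
    1 ≤ powerSum p t := by
  have h1 : |t k| ^ p ≤ powerSum p t :=
    Finset.single_le_sum (f := fun k => |t k| ^ p) (fun _ _ => by positivity)
      (Finset.mem_range.2 hk)
  rwa [h, Real.one_rpow] at h1

/-- A Markov inequality: contraction prevents a weight of modulus `1` from occurring almost surely.
-/
lemma measure_lt_one_of_one_le_powerSum {p : ℝ} {U : Set Ω} (hU : NullMeasurableSet U P)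
    (hcontr : ∫⁻ ω, ENNReal.ofReal (powerSum p (T ω)) ∂P < 1)
    (h : ∀ᵐ ω ∂P, ω ∈ U → 1 ≤ powerSum p (T ω)) : P U < 1 := by
  refine lt_of_le_of_lt ?_ hcontr
  rw [← lintegral_indicator_one₀ hU]
  refine lintegral_mono_ae (h.mono fun ω hω => ?_)
  by_cases hm : ω ∈ U
  · rw [Set.indicator_of_mem hm]
    exact ENNReal.one_le_ofReal.2 (hω hm)
  · rw [Set.indicator_of_notMem hm]
    exact zero_le

end Sums

/-- If the law of `X` has finite exponential moments near `θ`, then `-β θ` is in the domain as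
well, even if the value `-β` is not attained by the last weight. -/
lemma lt_top_neg_of_mem_interior {Ω : Type*} [MeasurableSpace Ω] {P : Measure Ω}
    [IsProbabilityMeasure P] {C : Ω → ℝ} {T : Ω → ℕ → ℝ} {Ψ : ℝ → ℝ≥0∞} {θ : ℝ}
    (hT : AEMeasurable T P) (hβ : 0 < beta P T) (hΨ1 : ∀ s, 1 ≤ Ψ s)
    (hΨ : ∀ s, Ψ s = ∫⁻ ω, ENNReal.ofReal (Real.exp (s * C ω)) *
        ∏ k ∈ Finset.range (numWeights (T ω)), Ψ (s * T ω k) ∂P)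
    (hconv : Convex ℝ {s | Ψ s < ∞}) (h0 : Ψ 0 < ∞) (hθ : θ ∈ interior {s | Ψ s < ∞}) :
    Ψ (-beta P T * θ) < ∞ := by
  set β := beta P T with hβdef
  -- The finiteness set is convex and contains `0`.
  have hscale : ∀ v y : ℝ, 1 ≤ v → Ψ (v * y) < ∞ → Ψ y < ∞ := by
    intro v y hv hy
    have hv0 : 0 < v := by linarith
    have h := hconv.smul_mem_of_zero_mem (x := v * y) h0 hy
      (t := v⁻¹) ⟨by positivity, inv_le_one_of_one_le₀ hv⟩
    simpa [hv0.ne'] using h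
  obtain ⟨c, hc1, hc⟩ : ∃ c > 1, Ψ (c * θ) < ∞ := by
    have hmem : ∀ᶠ c : ℝ in 𝓝 1, c * θ ∈ {s | Ψ s < ∞} := by
      have hcont : ContinuousAt (fun c : ℝ => c * θ) 1 := by fun_prop
      refine hcont.eventually (p := fun s => s ∈ {s | Ψ s < ∞}) ?_
      simp only [one_mul]
      exact mem_interior_iff_mem_nhds.1 hθ
    have h2 := (hmem.filter_mono nhdsWithin_le_nhds).and
      (self_mem_nhdsWithin : Set.Ioi (1 : ℝ) ∈ 𝓝[>] 1)
    obtain ⟨c, h3, h4⟩ := h2.exists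
    exact ⟨c, h4, h3⟩
  by_contra htop
  have hc0 : 0 < c := by linarith
  set U := {ω | lastWeight (T ω) < -(β / c)} with hU
  have hUm : NullMeasurableSet U P :=
    (aemeasurable_lastWeight hT).nullMeasurableSet_preimage measurableSet_Iio
  have hUpos : P U ≠ 0 := by
    intro hz
    -- If `U` were null, `β / c < β` would already bound the negative part, against the definition
    -- of `β` as an essential supremum.
    have h1 : ∀ᵐ ω ∂P, -lastWeight (T ω) ≤ β / c := by
      filter_upwards [measure_eq_zero_iff_ae_notMem.1 hz] with ω hω
      have hω' : ¬ lastWeight (T ω) < -(β / c) := hω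
      have := not_lt.1 hω'
      linarith
    have h2 : β ≤ β / c := beta_le_of_ae_le (by positivity) h1
    have h3 : β / c < β := div_lt_self hβ hc1
    linarith
  have hinf : ∀ ω ∈ U, ENNReal.ofReal (Real.exp (c * θ * C ω)) *
      ∏ k ∈ Finset.range (numWeights (T ω)), Ψ (c * θ * T ω k) = ∞ := by
    intro ω hω
    have hl : lastWeight (T ω) < -(β / c) := hω
    have hN : numWeights (T ω) ≠ 0 := fun h => by
      rw [lastWeight, if_pos h] at hl
      have : 0 < β / c := by positivity
      linarith
    have hl2 : lastWeight (T ω) = T ω (numWeights (T ω) - 1) := by rw [lastWeight, if_neg hN]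
    have h1 : Ψ (c * θ * T ω (numWeights (T ω) - 1)) = ∞ := by
      by_contra hne
      -- On `U`, `c θ T_N` is this factor, at least `1`, times `-β θ`.
      refine htop (hscale (c * -lastWeight (T ω) / β) _ ?_ ?_)
      · rw [le_div_iff₀ hβ, one_mul]
        have h3 : β / c < -lastWeight (T ω) := by linarith
        rw [div_lt_iff₀ hc0] at h3
        linarith
      · rw [← hl2] at hne
        convert lt_top_iff_ne_top.2 hne using 2
        field_simp
    have h2 := Finset.single_le_prod' (f := fun k => Ψ (c * θ * T ω k)) (fun k _ => hΨ1 _)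
      (Finset.mem_range.2 (by omega : numWeights (T ω) - 1 < numWeights (T ω)))
    rw [h1, top_le_iff] at h2
    rw [h2, ENNReal.mul_top]
    simpa using Real.exp_pos _
  have h3 : ∞ ≤ Ψ (c * θ) := by
    rw [hΨ (c * θ)]
    calc ∞ = ∫⁻ _ in U, ∞ ∂P := by rw [setLIntegral_const, ENNReal.top_mul hUpos]
      _ ≤ ∫⁻ ω in U, ENNReal.ofReal (Real.exp (c * θ * C ω)) *
          ∏ k ∈ Finset.range (numWeights (T ω)), Ψ (c * θ * T ω k) ∂P := by
        refine lintegral_mono_ae ((ae_restrict_iff'₀ hUm).2 (ae_of_all _ fun ω hω => ?_))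
        rw [hinf ω hω]
      _ ≤ _ := setLIntegral_le_lintegral _ _
  exact hc.ne (top_le_iff.1 h3)

lemma isProbabilityMeasure_iterate_smoothingStep {μ : Measure (ℝ × (ℕ → ℝ))}
    [IsProbabilityMeasure μ] (n : ℕ) :
    IsProbabilityMeasure ((smoothingStep μ)^[n] (Measure.dirac 0)) := by
  induction n with
  | zero => exact Measure.dirac.isProbabilityMeasure
  | succ n ih =>
    rw [Function.iterate_succ_apply']
    infer_instance

/-! ### Admissibility of the weights, and necessity for the two domains -/

section Main

variable {Ω : Type*} [MeasurableSpace Ω] {P : Measure Ω} {C : Ω → ℝ} {T : Ω → ℕ → ℝ}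
  {β δ S : ℝ}

lemma Admissible.one_le_powerSum_of_first {t : ℕ → ℝ} (h : Admissible β δ S t) (p : ℝ)
    (h1 : firstWeight t = 1) : 1 ≤ powerSum p t := by
  have h0 : 0 < numWeights t := h.numWeights_pos_of_first_ne (by rw [h1]; exact one_ne_zero)
  exact one_le_powerSum p h0 (by rw [show t 0 = 1 from h1, abs_one])

lemma one_le_powerSum_of_last {t : ℕ → ℝ} (p : ℝ) (h1 : lastWeight t = -1) :
    1 ≤ powerSum p t := by
  have h0 : numWeights t ≠ 0 := fun h0 => by
    rw [lastWeight, if_pos h0] at h1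
    norm_num at h1
  rw [lastWeight, if_neg h0] at h1
  exact one_le_powerSum p (Nat.sub_one_lt h0) (by rw [h1, abs_neg, abs_one])

lemma measure_first_lt_one (hT : AEMeasurable T P)
    (hadm : ∀ᵐ ω ∂P, Admissible β δ S (T ω)) {p : ℝ}
    (hcontr : ∫⁻ ω, ENNReal.ofReal (powerSum p (T ω)) ∂P < 1) :
    P {ω | firstWeight (T ω) = 1} < 1 :=
  measure_lt_one_of_one_le_powerSum (nullMeasurableSet_first hT 1) hcontr
    (hadm.mono fun _ h h1 => h.one_le_powerSum_of_first p h1)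

lemma measure_first_union_last_lt_one (hT : AEMeasurable T P)
    (hadm : ∀ᵐ ω ∂P, Admissible β δ S (T ω)) {p : ℝ}
    (hcontr : ∫⁻ ω, ENNReal.ofReal (powerSum p (T ω)) ∂P < 1) :
    P ({ω | firstWeight (T ω) = 1} ∪ {ω | lastWeight (T ω) = -1}) < 1 :=
  measure_lt_one_of_one_le_powerSum
    ((nullMeasurableSet_first hT 1).union (nullMeasurableSet_last hT (-1))) hcontr
    (hadm.mono fun _ h h1 => h1.elim (h.one_le_powerSum_of_first p) (one_le_powerSum_of_last p))

lemma measureReal_first_add_last_lt_one [IsProbabilityMeasure P] (hT : AEMeasurable T P)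
    (hadm : ∀ᵐ ω ∂P, Admissible β δ S (T ω)) {p : ℝ}
    (hcontr : ∫⁻ ω, ENNReal.ofReal (powerSum p (T ω)) ∂P < 1) :
    P.real {ω | firstWeight (T ω) = 1} + P.real {ω | lastWeight (T ω) = -1} < 1 := by
  have hdisj : AEDisjoint P {ω | firstWeight (T ω) = 1} {ω | lastWeight (T ω) = -1} := by
    refine measure_eq_zero_iff_ae_notMem.2 (hadm.mono fun ω h ⟨h1, h2⟩ => ?_)
    have h1' : T ω 0 = 1 := h1
    have h2' : lastWeight (T ω) = -1 := h2
    have h3 := h.numWeights_eq_one_of_first h1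
    rw [lastWeight, h3, if_neg one_ne_zero, Nat.sub_self, h1'] at h2'
    norm_num at h2'
  rw [Measure.real, Measure.real,
    ← ENNReal.toReal_add (measure_ne_top _ _) (measure_ne_top _ _),
    ← measure_union₀ (nullMeasurableSet_last hT (-1)) hdisj]
  refine ENNReal.toReal_lt_of_lt_ofReal ?_
  rw [ENNReal.ofReal_one]
  exact measure_first_union_last_lt_one hT hadm hcontr

lemma integral_powerSum_two_lt_one (hT : AEMeasurable T P) {p : ℝ} (hp0 : 0 ≤ p) (hp2 : p ≤ 2)
    (hT_le : ∀ᵐ ω ∂P, ∀ k, |T ω k| ≤ 1)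
    (hcontr : ∫⁻ ω, ENNReal.ofReal (powerSum p (T ω)) ∂P < 1) :
    ∫ ω, powerSum 2 (T ω) ∂P < 1 := by
  have hm : AEMeasurable (fun ω => powerSum 2 (T ω)) P :=
    (measurable_powerSum 2).comp_aemeasurable hT
  rw [integral_eq_lintegral_of_nonneg_ae (ae_of_all _ fun ω => powerSum_nonneg 2 (T ω))
    hm.aestronglyMeasurable, ← ENNReal.toReal_one]
  have h : ∫⁻ ω, ENNReal.ofReal (powerSum 2 (T ω)) ∂P < 1 := lt_of_le_of_lt
    (lintegral_mono_ae (hT_le.mono fun ω hω => ENNReal.ofReal_le_ofReal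
      (powerSum_two_le hp0 hp2 hω))) hcontr
  exact (ENNReal.toReal_lt_toReal (h.trans ENNReal.one_lt_top).ne ENNReal.one_ne_top).2 h

lemma ae_admissible [IsProbabilityMeasure P]
    (hT_ordered : ∀ᵐ ω ∂P, IsOrdered (T ω)) (hT_le : ∀ᵐ ω ∂P, ∀ k, |T ω k| ≤ 1)
    (h_sq : eLpNorm (fun ω => powerSum 2 (T ω)) ∞ P < ∞)
    (h_sep : ∀ᵐ ω ∂P, (∀ k, 1 ≤ k → k < numWeights (T ω) → T ω k ≤ 1 - δ) ∧
      (∀ k, k + 1 < numWeights (T ω) → -beta P T * (1 - δ) ≤ T ω k))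
    (h_sep' : P {ω | firstWeight (T ω) > 1 - δ ∧
      lastWeight (T ω) < -beta P T * (1 - δ)} = 0)
    (h_first : P {ω | firstWeight (T ω) = 1 ∧ 2 ≤ numWeights (T ω)} = 0)
    (h_last : P {ω | lastWeight (T ω) = -beta P T ∧ 2 ≤ numWeights (T ω)} = 0) :
    ∀ᵐ ω ∂P, Admissible (beta P T) δ
      (eLpNorm (fun ω => powerSum 2 (T ω)) ∞ P).toReal (T ω) := by
  have hS : ∀ᵐ ω ∂P, powerSum 2 (T ω) ≤ (eLpNorm (fun ω => powerSum 2 (T ω)) ∞ P).toReal := by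
    rw [eLpNorm_exponent_top] at h_sq ⊢
    filter_upwards [ae_le_eLpNormEssSup (f := fun ω => powerSum 2 (T ω)) (μ := P)] with ω hω
    have := ENNReal.toReal_mono h_sq.ne hω
    rw [toReal_enorm] at this
    exact (le_abs_self _).trans this
  filter_upwards [hT_ordered, hT_le, hS, h_sep, measure_eq_zero_iff_ae_notMem.1 h_sep',
    measure_eq_zero_iff_ae_notMem.1 h_first, measure_eq_zero_iff_ae_notMem.1 h_last,
    ae_neg_beta_le_lastWeight hT_le] with ω h1 h2 h3 h4 h5 h6 h7 h8
  exact ⟨h1, h2, h8, h3, h4.1, h4.2, h5, fun h => not_le.1 fun h' => h6 ⟨h, h'⟩,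
    fun h => not_le.1 fun h' => h7 ⟨h, h'⟩⟩

variable [IsProbabilityMeasure P] {p : ℝ} {Ψ : ℝ → ℝ≥0∞} {θ : ℝ}

lemma mem_domainA_of_functional_eq (hC : AEMeasurable C P) (hT : AEMeasurable T P)
    (hβ : 0 < beta P T) (hadm : ∀ᵐ ω ∂P, Admissible (beta P T) δ S (T ω))
    (hcontr : ∫⁻ ω, ENNReal.ofReal (powerSum p (T ω)) ∂P < 1) (hΨ1 : ∀ s, 1 ≤ Ψ s)
    (hΨ : ∀ s, Ψ s = ∫⁻ ω, ENNReal.ofReal (Real.exp (s * C ω)) *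
        ∏ k ∈ Finset.range (numWeights (T ω)), Ψ (s * T ω k) ∂P)
    (hs : Ψ θ < ∞) (hs' : Ψ (-beta P T * θ) < ∞) : θ ∈ domainA P C T := by
  have hP := measure_first_lt_one hT hadm hcontr
  obtain ⟨h1, h2⟩ := necessary_of_functional_eq hC hT hβ hadm hΨ1 hΨ hP hs
  obtain ⟨h3, h4⟩ := necessary_of_functional_eq hC hT hβ hadm hΨ1 hΨ hP hs'
  exact ⟨max_lt h4 h2, h3, h1⟩

lemma mem_domainB_of_functional_eq (hC : AEMeasurable C P) (hT : AEMeasurable T P)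
    (hβ : beta P T = 1) (hadm : ∀ᵐ ω ∂P, Admissible (beta P T) δ S (T ω))
    (hcontr : ∫⁻ ω, ENNReal.ofReal (powerSum p (T ω)) ∂P < 1) (hΨ1 : ∀ s, 1 ≤ Ψ s)
    (hΨ : ∀ s, Ψ s = ∫⁻ ω, ENNReal.ofReal (Real.exp (s * C ω)) *
        ∏ k ∈ Finset.range (numWeights (T ω)), Ψ (s * T ω k) ∂P)
    (hP : 0 < P {ω | lastWeight (T ω) = -1})
    (hs : Ψ θ < ∞) : θ ∈ domainB P C T := by
  have hs' : Ψ (-θ) < ∞ := by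
    have := lt_top_neg_of_functional_eq hC hT (by rw [hβ]; exact one_pos) hadm hΨ1 hΨ
      (by rwa [hβ]) hs
    rwa [hβ, neg_one_mul] at this
  have hA := mem_domainA_of_functional_eq hC hT (by rw [hβ]; exact one_pos) hadm hcontr hΨ1 hΨ hs
    (by rwa [hβ, neg_one_mul])
  rw [domainA, Set.mem_ofPred_eq, hβ, neg_one_mul] at hA
  obtain ⟨hmax, hd', hd⟩ := hA
  refine ⟨hmax, ?_, hd', hd⟩
  rw [hβ] at hadm
  have hU := measure_first_union_last_lt_one hT hadm hcontr
  have h1 := mul_lt_mul_of_functional_eq hC hT hadm hΨ1 hΨ hU hs hs' hd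
  have h2 := mul_lt_mul_of_functional_eq hC hT hadm hΨ1 hΨ hU hs' (by rwa [neg_neg]) hd'
  rw [neg_neg] at h2
  have hpos : ∀ s, Ψ s < ∞ → 0 < (Ψ s).toReal := fun s h =>
    ENNReal.toReal_pos (one_pos.trans_le (hΨ1 s)).ne' h.ne
  have hx := hpos _ hs
  have hy := hpos _ hs'
  simp only [bFun, aFun, hβ, gt_iff_lt]
  have hb0 : ∀ s : ℝ, 0 ≤ ∫ ω in {ω | lastWeight (T ω) = -1}, Real.exp (s * C ω) ∂P :=
    fun s => integral_nonneg fun _ => (Real.exp_pos _).le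
  -- The inequalities at `θ` and `-θ` carry the same factor `Ψ(θ) Ψ(-θ)` on both sides of their
  -- product, and it cancels.
  have h3 := mul_lt_mul'' h1 h2 (mul_nonneg (hb0 θ) hy.le) (mul_nonneg (hb0 (-θ)) hx.le)
  refine lt_of_mul_lt_mul_right (a := (Ψ θ).toReal * (Ψ (-θ)).toReal) ?_ (by positivity)
  linarith

end Main

/-! ### Sufficiency: from the domains to balanced weights -/

section Sufficiency

variable {Ω : Type*} [MeasurableSpace Ω] {P : Measure Ω} {C : Ω → ℝ}
  {T : Ω → ℕ → ℝ} {δ S p θ : ℝ}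

lemma exists_balancedWeights_of_mem_domainA [IsProbabilityMeasure P] (hC : AEMeasurable C P) (hT : AEMeasurable T P)
    (hβ : 0 < beta P T) (hβ1 : beta P T < 1)
    (hadm : ∀ᵐ ω ∂P, Admissible (beta P T) δ S (T ω))
    (hcontr : ∫⁻ ω, ENNReal.ofReal (powerSum p (T ω)) ∂P < 1) (hθ : θ ∈ domainA P C T) :
    ∃ A κ m₀ w₁ w₂, BalancedWeights P C T (beta P T) θ A κ m₀ w₁ w₂ := by
  obtain ⟨hmax, hd', hd⟩ := hθ
  have hP := measure_first_lt_one hT hadm hcontr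
  refine exists_balancedWeights_of_lt_one hC hβ hβ1 hd hd' ?_ (lt_of_le_of_lt (le_max_right _ _) hmax)
    (lt_of_le_of_lt (le_max_left _ _) hmax)
  exact ENNReal.toReal_lt_of_lt_ofReal (by rwa [ENNReal.ofReal_one])

lemma exists_balancedWeights_of_mem_domainB [IsProbabilityMeasure P] (hC : AEMeasurable C P) (hT : AEMeasurable T P)
    (hβ : beta P T = 1)
    (hadm : ∀ᵐ ω ∂P, Admissible (beta P T) δ S (T ω))
    (hcontr : ∫⁻ ω, ENNReal.ofReal (powerSum p (T ω)) ∂P < 1) (hθ : θ ∈ domainB P C T) :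
    ∃ A κ m₀ w₁ w₂, BalancedWeights P C T (beta P T) θ A κ m₀ w₁ w₂ := by
  obtain ⟨hmax, hb, hd', hd⟩ := hθ
  simp only [bFun, aFun, hβ, gt_iff_lt] at hb
  rw [hβ]
  exact exists_balancedWeights_of_eq_one hC hd hd'
    (measureReal_first_add_last_lt_one hT hadm hcontr)
    (lt_of_le_of_lt (le_max_right _ _) hmax) (lt_of_le_of_lt (le_max_left _ _) hmax) hb

/-- When `-β` is not attained, `b` vanishes and the determinant condition follows from `a < 1`. This
brings the boundary case `β = 1` of (c) under the argument for (b). -/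
lemma mem_domainB_of_mem_domainA (hβ : beta P T = 1)
    (h0 : P {ω | lastWeight (T ω) = -beta P T} = 0) (hθ : θ ∈ domainA P C T) :
    θ ∈ domainB P C T := by
  rw [domainA, Set.mem_ofPred_eq, hβ, neg_one_mul] at hθ
  obtain ⟨hmax, hd', hd⟩ := hθ
  refine ⟨hmax, ?_, hd', hd⟩
  have hz : ∀ s, bFun P C T s = 0 := fun s => setIntegral_measure_zero _ h0
  rw [hz, zero_mul]
  exact mul_pos (sub_pos.2 (lt_of_le_of_lt (le_max_left _ _) hmax))
    (sub_pos.2 (lt_of_le_of_lt (le_max_right _ _) hmax))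

end Sufficiency

lemma map_eq_infinitePi {Ω Ω' : Type*} [MeasurableSpace Ω] [MeasurableSpace Ω'] {P : Measure Ω}
    {P' : Measure Ω'} {C : Ω → ℝ} {T : Ω → ℕ → ℝ} {Y : List ℕ → Ω' → ℝ × (ℕ → ℝ)} (hY_indep : iIndepFun Y P')
    (hY_copy : ∀ v, IdentDistrib (Y v) (fun ω => (C ω, T ω)) P' P) :
    P'.map (fun ω v => Y v ω) =
      Measure.infinitePi fun _ : List ℕ => P.map fun ω => (C ω, T ω) := by
  rw [hY_indep.map_fun_eq_infinitePi_map₀' fun v => (hY_copy v).aemeasurable_fst]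
  simp_rw [fun v => (hY_copy v).map_eq]

end

end SmoothingTransform

theorem theorem3p5
    {Ω Ω' : Type*} [MeasurableSpace Ω] [MeasurableSpace Ω']
    (P : Measure Ω) [IsProbabilityMeasure P] (P' : Measure Ω') [IsProbabilityMeasure P']
    -- the generic pair and its i.i.d. copies at the vertices of the Ulam-Harris tree
    (C : Ω → ℝ) (T : Ω → ℕ → ℝ) (Y : List ℕ → Ω' → ℝ × (ℕ → ℝ))
    (hY_indep : iIndepFun Y P')
    (hY_copy : ∀ v, IdentDistrib (Y v) (fun ω => (C ω, T ω)) P' P)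
    (hT_ordered : ∀ᵐ ω ∂P, SmoothingTransform.IsOrdered (T ω))
    -- mean zero, finite moment of order `p`, and contraction
    (p : ℝ) (hp : p ∈ Set.Icc (1 : ℝ) 2)
    (hC_mean : ∫ ω, C ω ∂P = 0)
    (hC_moment : MemLp C (ENNReal.ofReal p) P)
    (h_contr : eLpNorm (fun ω => SmoothingTransform.powerSum p (T ω)) 1 P < 1)
    -- bounded weights and bounded sum of squares
    (hT_le : ∀ᵐ ω ∂P, ∀ k, |T ω k| ≤ 1)
    (h_beta : 0 < SmoothingTransform.beta P T)
    (h_sq : eLpNorm (fun ω => SmoothingTransform.powerSum 2 (T ω)) ∞ P < ∞)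
    -- separation conditions
    (δ : ℝ) (hδ : δ ∈ Set.Ioo (0 : ℝ) 1)
    (h_sep : ∀ᵐ ω ∂P,
      (∀ k, 1 ≤ k → k < SmoothingTransform.numWeights (T ω) → T ω k ≤ 1 - δ) ∧
      (∀ k, k + 1 < SmoothingTransform.numWeights (T ω) →
        -SmoothingTransform.beta P T * (1 - δ) ≤ T ω k))
    (h_sep' : P {ω | SmoothingTransform.firstWeight (T ω) > 1 - δ ∧
      SmoothingTransform.lastWeight (T ω) < -SmoothingTransform.beta P T * (1 - δ)} = 0)
    (h_first : P {ω | SmoothingTransform.firstWeight (T ω) = 1 ∧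
      2 ≤ SmoothingTransform.numWeights (T ω)} = 0)
    (h_last : P {ω | SmoothingTransform.lastWeight (T ω) = -SmoothingTransform.beta P T ∧
      2 ≤ SmoothingTransform.numWeights (T ω)} = 0) :
    let W : Ω' → ℝ := fun ω => SmoothingTransform.canonicalSolution (fun v => Y v ω)
    -- the canonical solution is well defined
    (∀ᵐ ω ∂P', Tendsto (SmoothingTransform.partialSolution (fun v => Y v ω)) atTop (𝓝 (W ω))) ∧
    (0 < P {ω | SmoothingTransform.lastWeight (T ω) = -SmoothingTransform.beta P T} →
      SmoothingTransform.beta P T < 1 →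
      integrableExpSet W P' = SmoothingTransform.domainA P C T) ∧
    (0 < P {ω | SmoothingTransform.lastWeight (T ω) = -1} →
      integrableExpSet W P' = SmoothingTransform.domainB P C T) ∧
    (P {ω | SmoothingTransform.lastWeight (T ω) = -SmoothingTransform.beta P T} = 0 →
      interior (integrableExpSet W P') ⊆ SmoothingTransform.domainA P C T ∧
      SmoothingTransform.domainA P C T ⊆ integrableExpSet W P') := by
  intro W
  obtain ⟨hp1, hp2⟩ := hp
  obtain ⟨hδ0, hδ1⟩ := hδ
  have hCT : AEMeasurable (fun ω => (C ω, T ω)) P := (hY_copy []).aemeasurable_snd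
  have hC : AEMeasurable C P := measurable_fst.comp_aemeasurable hCT
  have hT : AEMeasurable T P := measurable_snd.comp_aemeasurable hCT
  set μ : Measure (ℝ × (ℕ → ℝ)) := P.map fun ω => (C ω, T ω) with hμ
  have hμprob : IsProbabilityMeasure μ := Measure.isProbabilityMeasure_map hCT
  have hlaw : P'.map (fun ω v => Y v ω) = Measure.infinitePi fun _ : List ℕ => μ :=
    SmoothingTransform.map_eq_infinitePi hY_indep hY_copy
  have hYm : AEMeasurable (fun ω v => Y v ω) P' :=
    aemeasurable_pi_lambda _ fun v => (hY_copy v).aemeasurable_fst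
  have hcontr : ∫⁻ ω, ENNReal.ofReal (SmoothingTransform.powerSum p (T ω)) ∂P < 1 := by
    rw [eLpNorm_one_eq_lintegral_enorm] at h_contr
    refine lt_of_le_of_lt (lintegral_mono fun ω => ?_) h_contr
    rw [← ofReal_norm]
    exact ENNReal.ofReal_le_ofReal (le_abs_self _)
  have hord : ∀ᵐ e ∂μ, SmoothingTransform.IsOrdered e.2 :=
    (ae_map_iff hCT (measurable_snd SmoothingTransform.measurableSet_isOrdered)).2 hT_ordered
  have hint : Integrable (fun e => e.1) μ :=
    (integrable_map_measure (by fun_prop) hCT).2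
      (hC_moment.integrable (ENNReal.one_le_ofReal.2 hp1))
  have hmean : ∫ e, e.1 ∂μ = 0 := by
    rw [hμ, integral_map hCT (by fun_prop)]
    exact hC_mean
  have hmom : ∫⁻ e, ENNReal.ofReal (|e.1| ^ p) ∂μ ≠ ∞ := by
    rw [hμ, lintegral_map' (by fun_prop) hCT]
    have hp0 : ENNReal.ofReal p ≠ 0 := by
      rw [Ne, ENNReal.ofReal_eq_zero, not_le]
      linarith
    have h := hC_moment.integrable_norm_rpow hp0 ENNReal.ofReal_ne_top
    rw [ENNReal.toReal_ofReal (by linarith)] at h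
    exact ((hasFiniteIntegral_iff_ofReal (ae_of_all _ fun _ => by positivity)).1 h.2).ne
  have hcontrμ : ∫⁻ e, ENNReal.ofReal (SmoothingTransform.powerSum p e.2) ∂μ < 1 := by
    have hm : Measurable fun e : ℝ × (ℕ → ℝ) =>
        ENNReal.ofReal (SmoothingTransform.powerSum p e.2) :=
      ((SmoothingTransform.measurable_powerSum p).comp measurable_snd).ennreal_ofReal
    rw [hμ, lintegral_map' hm.aemeasurable hCT]
    exact hcontr
  obtain ⟨hconv, hWint, hWmean, hfix⟩ := SmoothingTransform.canonicalSolution_spec hord hp1 hp2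
    hint hmean hmom hcontrμ
  have hcanm : AEMeasurable SmoothingTransform.canonicalSolution
      (Measure.infinitePi fun _ : List ℕ => μ) := hWint.aemeasurable
  have hWm : AEMeasurable W P' := by
    rw [← hlaw] at hcanm
    exact hcanm.comp_aemeasurable hYm
  have hWlaw : P'.map W = (Measure.infinitePi fun _ : List ℕ => μ).map
      SmoothingTransform.canonicalSolution := by
    rw [← hlaw] at hcanm ⊢
    exact (AEMeasurable.map_map_of_aemeasurable hcanm hYm).symm
  set ν := (Measure.infinitePi fun _ : List ℕ => μ).map
    SmoothingTransform.canonicalSolution with hν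
  have hνprob : IsProbabilityMeasure ν := Measure.isProbabilityMeasure_map hcanm
  set Ψ := SmoothingTransform.expMoment ν with hΨdef
  have hdom : ∀ s, Ψ s < ∞ ↔ s ∈ integrableExpSet W P' := fun s => by
    rw [← SmoothingTransform.expMoment_lt_top_iff hWm, hWlaw]
  have hΨ1 : ∀ s, 1 ≤ Ψ s := SmoothingTransform.one_le_expMoment
    ((integrable_map_measure (by fun_prop) hcanm).2 hWint)
    (by rwa [hν, integral_map hcanm (by fun_prop)])
  have hΨ : ∀ s, Ψ s = ∫⁻ ω, ENNReal.ofReal (Real.exp (s * C ω)) *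
      ∏ k ∈ Finset.range (SmoothingTransform.numWeights (T ω)), Ψ (s * T ω k) ∂P := fun s => by
    rw [← SmoothingTransform.expMoment_smoothingStep_map hCT ν s, ← hfix]
  have hβ1 := SmoothingTransform.beta_le_one hT_le
  have hadm := SmoothingTransform.ae_admissible hT_ordered hT_le h_sq h_sep h_sep' h_first h_last
  have hV1 := SmoothingTransform.integral_powerSum_two_lt_one hT (by linarith) hp2 hT_le hcontr
  have hsuff : ∀ θ, θ ∈ integrableExpSet C P →
      -SmoothingTransform.beta P T * θ ∈ integrableExpSet C P →
      (∃ A κ m₀ w₁ w₂, SmoothingTransform.BalancedWeights P C T (SmoothingTransform.beta P T) θ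
        A κ m₀ w₁ w₂) → θ ∈ integrableExpSet W P' := by
    rintro θ hθ hθ' ⟨A, κ, m₀, w₁, w₂, hw⟩
    -- The outward scaling needs `θ ≠ 0`; at `0` there is nothing to prove.
    rcases eq_or_ne θ 0 with rfl | hθ0
    · simp [integrableExpSet]
    obtain ⟨V, hV⟩ := SmoothingTransform.exists_bound_iterates hC hT hadm h_beta hβ1 hδ0 hδ1
      ENNReal.toReal_nonneg hθ0 hθ hθ' hC_mean hV1 hw
      (Ψ := fun n s => SmoothingTransform.expMoment
        ((SmoothingTransform.smoothingStep μ)^[n] (Measure.dirac 0)) s)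
      (fun s => by simp [SmoothingTransform.expMoment]) (fun n s => by
        have := SmoothingTransform.isProbabilityMeasure_iterate_smoothingStep (μ := μ) n
        rw [Function.iterate_succ_apply']
        exact SmoothingTransform.expMoment_smoothingStep_map hCT _ s)
    exact (hdom θ).1 ((SmoothingTransform.expMoment_canonicalSolution_le hord hconv hV).trans_lt
      ENNReal.ofReal_lt_top)
  have hsuffA : SmoothingTransform.beta P T < 1 →
      SmoothingTransform.domainA P C T ⊆ integrableExpSet W P' := fun hlt θ hθ =>
    hsuff θ hθ.2.2 hθ.2.1
      (SmoothingTransform.exists_balancedWeights_of_mem_domainA hC hT h_beta hlt hadm hcontr hθ)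
  have hsuffB : SmoothingTransform.beta P T = 1 →
      SmoothingTransform.domainB P C T ⊆ integrableExpSet W P' := fun heq θ hθ =>
    hsuff θ hθ.2.2.2 (by rw [heq, neg_one_mul]; exact hθ.2.2.1)
      (SmoothingTransform.exists_balancedWeights_of_mem_domainB hC hT heq hadm hcontr hθ)
  refine ⟨?_, fun hP hlt => ?_, fun hP => ?_, fun hP => ⟨fun θ hθ => ?_, ?_⟩⟩
  · rw [← hlaw] at hconv
    exact ae_of_ae_map hYm hconv
  · refine Set.Subset.antisymm (fun θ hθ => ?_) (hsuffA hlt)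
    have hs := (hdom θ).2 hθ
    exact SmoothingTransform.mem_domainA_of_functional_eq hC hT h_beta hadm hcontr hΨ1 hΨ hs
      (SmoothingTransform.lt_top_neg_of_functional_eq hC hT h_beta hadm hΨ1 hΨ hP hs)
  -- All weights have modulus at most `1`, so attaining `-1` with positive probability forces `β =
  -- 1`.
  · have heq : SmoothingTransform.beta P T = 1 := by
      refine le_antisymm hβ1 (not_lt.1 fun hlt => hP.ne' ?_)
      refine measure_eq_zero_iff_ae_notMem.2
        ((SmoothingTransform.ae_neg_beta_le_lastWeight hT_le).mono fun ω hω hω' => ?_)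
      have hω'' : SmoothingTransform.lastWeight (T ω) = -1 := hω'
      linarith
    exact Set.Subset.antisymm (fun θ hθ => SmoothingTransform.mem_domainB_of_functional_eq hC hT
      heq hadm hcontr hΨ1 hΨ hP ((hdom θ).2 hθ)) (hsuffB heq)
  · have hset : {s | Ψ s < ∞} = integrableExpSet W P' := Set.ext hdom
    have hs' := SmoothingTransform.lt_top_neg_of_mem_interior hT h_beta hΨ1 hΨ
      (by rw [hset]; exact convex_integrableExpSet) ((hdom 0).2 (by simp [integrableExpSet]))
      (by rwa [hset])
    exact SmoothingTransform.mem_domainA_of_functional_eq hC hT h_beta hadm hcontr hΨ1 hΨ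
      ((hdom θ).2 (interior_subset hθ)) hs'
  · rcases hβ1.lt_or_eq with hlt | heq
    · exact hsuffA hlt
    · exact fun θ hθ => hsuffB heq (SmoothingTransform.mem_domainB_of_mem_domainA heq hP hθ)
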